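/- Let $\mathbb{F}$ be a field with $\operatorname{char}\mathbb{F}\neq 2$ and let $k\ge 0$. Let $R_k^{\mathrm{nil}}$ be the $q$-graded dga over $\mathbb{F}$ with generators $s_i$ ($1\le i\le k-1$) and $\xi_j$ ($1\le j\le k$) and relations $$s_i^2=0,\quad s_is_{i+1}s_i=s_{i+1}s_is_{i+1},\quad s_is_{i'}=s_{i'}s_i\ (|i-i'|>1),\quad \xi_j^2=0,\quad \xi_j\xi_{j'}=-\xi_{j'}\xi_j\ (j\ne j'),$$ $$\xi_is_i=s_i\xi_{i+1},\quad \xi_{i+1}s_i=s_i\xi_i,\quad \xi_js_i=s_i\xi_j\ (j\ne i,i+1),$$ differential $d(s_i)=\xi_i-\xi_{i+1}$, $d(\xi_j)=0$, extended by the graded Leibniz rule, cohomological degrees $\deg s_i=0$, $\deg\xi_j=1$, and $q$-degrees $\deg_q s_i=\deg_q\xi_j=-2$. Let $\mathrm{NH}_k$ be the nilHecke algebra with generators $\partial_i$ ($1\le i\le k-1$), $x_j$ ($1\le j\le k$) and relations $$\partial_i^2=0,\quad \partial_i\partial_{i+1}\partial_i=\partial_{i+1}\partial_i\partial_{i+1},\quad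 \partial_i\partial_{i'}=\partial_{i'}\partial_i\ (|i-i'|>1),\quad x_jx_{j'}=x_{j'}x_j,$$ $$x_i\partial_i-\partial_ix_{i+1}=1,\quad x_{i+1}\partial_i-\partial_ix_i=-1,\quad x_j\partial_i=\partial_ix_j\ (j\ne i,i+1),$$ graded by $\deg_q x_j=2$, $\deg_q\partial_i=-2$. Let $\mathcal{U}^+$ be Lauda's additive monoidal category categorifying the positive half of $U_q\mathfrak{sl}_2$: its objects are finite direct sums of $q$-shifts of $\mathcal{E}^{\otimes k}$, $k\ge 0$, with $\operatorname{End}(\mathcal{E}^{\otimes k})=\mathrm{NH}_k$ (maps of all $q$-degrees), no nonzero maps between $\mathcal{E}^{\otimes k}$ and $\mathcal{E}^{\otimes l}$ for $k\ne l$, and tensor product of maps given by juxtaposition of diagrams. Let $\mathcal{DG}(\mathcal{U}^+)$ be the monoidal dg category of bounded complexes over $\mathcal{U}^+$, let $L_{\mathcal{E}}=(\mathcal{E}\xrightarrow{x_1}\mathcal{E})$ in cohomological degrees $0,1$ (the second copy $q$-shifted so that the differential has $q$-degree $0$), and let $\operatorname{End}(L_{\mathcal{E}}^{\otimes k})$ be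 its endomorphism dga in $\mathcal{DG}(\mathcal{U}^+)$. Let $\zeta\in\operatorname{End}(L_{\mathcal{E}})$ be the identity map from the copy of $\mathcal{E}$ in degree $0$ to the copy in degree $1$, and let $\tau\in\operatorname{End}(L_{\mathcal{E}}^{\otimes 2})$ map the summand of $L_{\mathcal{E}}^{\otimes 2}$ in degrees $(a,b)$ to the one in degrees $(b,a)$ by $(-1)^{ab}\partial_1$, for $a,b\in\{0,1\}$. Then: 1. There is a (necessarily unique) morphism of $q$-graded dgas $\rho_k:R_k^{\mathrm{nil}}\to\operatorname{End}(L_{\mathcal{E}}^{\otimes k})$ with $$\rho_k(\xi_j)=\mathrm{id}^{\otimes (j-1)}\otimes\zeta\otimes\mathrm{id}^{\otimes (k-j)},\qquad \rho_k(s_i)=\mathrm{id}^{\otimes (i-1)}\otimes\tau\otimes\mathrm{id}^{\otimes (k-i-1)}$$ (tensor products of maps with the Koszul sign rule). It is injective and a quasi-isomorphism. 2. $R_k^{\mathrm{nil}}$ is formal: it is connected to its cohomology algebra $H(R_k^{\mathrm{nil}})$, with zero differential, by a finite zigzag of quasi-isomorphisms of $q$-graded dgas. 3. $H(R_k^{\mathrm{nil}})$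 is an exterior algebra on $k$ generators, which can be chosen of bidegrees $(\deg,\deg_q)=(1,-2i)$, $1\le i\le k$. -/

import Mathlib

universe u

namespace QDG

open DirectSum

theorem mul_units_smul {A : Type*} [Ring A] (u : ℤˣ) (a b : A) : a * u • b = u • (a * b) := by
  rw [Units.smul_def, Units.smul_def, mul_smul_comm]

theorem map_units_smul {F M N : Type*} [FunLike F M N] [AddCommGroup M] [AddCommGroup N]
    [AddMonoidHomClass F M N] (f : F) (u : ℤˣ) (a : M) : f (u • a) = u • f a := by
  rw [Units.smul_def, Units.smul_def, map_zsmul]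

/-- If every element is a sum of homogeneous elements and each degree admits an additive projection,
then the family of submodules is a direct sum decomposition. -/
theorem isInternal_of_proj {R M ι : Type*} [DecidableEq ι] [Ring R] [AddCommGroup M] [Module R M]
    (gr : ι → Submodule R M) (π : ι → M → M)
    (hadd : ∀ i a b, π i (a + b) = π i a + π i b)
    (hself : ∀ i, ∀ a ∈ gr i, π i a = a)
    (hne : ∀ i j, i ≠ j → ∀ a ∈ gr i, π j a = 0)
    (htop : ∀ a, a ∈ ⨆ i, gr i) : DirectSum.IsInternal gr := by
  let P : ι → M →+ M := fun i => AddMonoidHom.mk' (π i) (hadd i)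
  have key : ∀ (x : ⨁ i, gr i) (j : ι), P j (DirectSum.coeLinearMap gr x) = (x j : M) := by
    intro x j
    induction x using DirectSum.induction_on with
    | zero => simp
    | of i a =>
      rw [DirectSum.coeLinearMap_of]
      by_cases h : i = j
      · subst h
        rw [DirectSum.of_eq_same]
        exact hself i _ a.2
      · rw [DirectSum.of_eq_of_ne _ _ _ (Ne.symm h)]
        exact hne i j h _ a.2
    | add x y hx hy => simp only [map_add, hx, hy, DirectSum.add_apply, Submodule.coe_add]
  constructor
  · rw [← AddMonoidHom.ker_eq_bot_iff, eq_bot_iff]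
    intro x hx
    have hx' : DirectSum.coeLinearMap gr x = 0 := hx
    rw [AddSubgroup.mem_bot]
    ext j
    rw [← key x j, hx', map_zero]
    rfl
  · intro a
    have h := htop a
    rw [← DirectSum.range_coeLinearMap] at h
    exact h

/-- A `q`-graded dga over `F`: a unital associative algebra with a (cohomological degree, `q`-degree)
bigrading and a differential of bidegree `(1, 0)` satisfying the graded Leibniz rule with respect to
the cohomological degree. -/
structure QDGA (F : Type u) [Field F] where
  carrier : Type u
  [ring : Ring carrier]
  [algebra : Algebra F carrier]
  gr : ℤ × ℤ → Submodule F carrier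
  [graded : GradedAlgebra gr]
  d : carrier →ₗ[F] carrier
  d_mem : ∀ (p q : ℤ) (a : carrier), a ∈ gr (p, q) → d a ∈ gr (p + 1, q)
  d_d : ∀ a : carrier, d (d a) = 0
  leibniz : ∀ (p q : ℤ) (a b : carrier), a ∈ gr (p, q) →
    d (a * b) = d a * b + p.negOnePow • (a * d b)

attribute [instance] QDGA.ring QDGA.algebra QDGA.graded

namespace QDGA

variable {F : Type u} [Field F]

/-- A morphism of `q`-graded dgas. -/
structure Hom (A B : QDGA F) where
  toAlgHom : A.carrier →ₐ[F] B.carrier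
  map_mem : ∀ (i : ℤ × ℤ) (a : A.carrier), a ∈ A.gr i → toAlgHom a ∈ B.gr i
  map_d : ∀ a : A.carrier, toAlgHom (A.d a) = B.d (toAlgHom a)

variable (A : QDGA F)

theorem d_one : A.d 1 = 0 := by
  have h := A.leibniz 0 0 1 1 (SetLike.GradedOne.one_mem (A := A.gr))
  simpa using h

/-- Projection to a bidegree. -/
noncomputable abbrev proj (i : ℤ × ℤ) : A.carrier →ₗ[F] A.carrier := GradedAlgebra.proj A.gr i

theorem proj_mem (i : ℤ × ℤ) (a : A.carrier) : A.proj i a ∈ A.gr i := by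
  rw [GradedAlgebra.proj_apply]
  exact Subtype.prop _

theorem proj_same (i : ℤ × ℤ) (a : A.carrier) (h : a ∈ A.gr i) : A.proj i a = a := by
  rw [GradedAlgebra.proj_apply, DirectSum.decompose_of_mem_same _ h]

theorem proj_ne (i j : ℤ × ℤ) (hij : i ≠ j) (a : A.carrier) (h : a ∈ A.gr i) :
    A.proj j a = 0 := by
  rw [GradedAlgebra.proj_apply, DirectSum.decompose_of_mem_ne _ h hij]

theorem d_proj (p q : ℤ) (a : A.carrier) : A.d (A.proj (p, q) a) = A.proj (p + 1, q) (A.d a) := by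
  induction a using DirectSum.Decomposition.inductionOn A.gr with
  | zero => simp
  | @homogeneous i m =>
    by_cases h : i = (p, q)
    · subst h
      rw [A.proj_same _ _ m.2, A.proj_same _ _ (A.d_mem p q _ m.2)]
    · rw [A.proj_ne _ _ h _ m.2, map_zero]
      obtain ⟨p', q'⟩ := i
      rw [A.proj_ne (p' + 1, q') _ _ _ (A.d_mem p' q' _ m.2)]
      intro h'
      simp only [Prod.mk.injEq, add_left_inj] at h' h
      exact h h'
  | add a b ha hb => simp only [map_add, ha, hb]

theorem sum_proj (a : A.carrier) : ∃ s : Finset (ℤ × ℤ), a = ∑ i ∈ s, A.proj i a := by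
  classical
  refine ⟨(DirectSum.decompose A.gr a).support, ?_⟩
  exact (DirectSum.sum_support_decompose A.gr a).symm

theorem d_mul_of_closed (z : A.carrier) (hz : A.d z = 0) :
    ∃ z' : A.carrier, A.d z' = 0 ∧ ∀ b, A.d (z' * b) = z * A.d b := by
  classical
  obtain ⟨s, hs⟩ := A.sum_proj z
  have hc : ∀ i : ℤ × ℤ, A.d (A.proj i z) = 0 := by
    rintro ⟨p, q⟩
    rw [A.d_proj, hz, map_zero]
  refine ⟨∑ i ∈ s, i.1.negOnePow • A.proj i z, ?_, fun b => ?_⟩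
  · rw [map_sum]
    refine Finset.sum_eq_zero fun i _ => ?_
    rw [Units.smul_def, map_zsmul, hc, smul_zero]
  · conv_rhs => rw [hs]
    rw [Finset.sum_mul, Finset.sum_mul, map_sum]
    refine Finset.sum_congr rfl fun i _ => ?_
    rw [smul_mul_assoc, Units.smul_def, map_zsmul, ← Units.smul_def,
      A.leibniz i.1 i.2 _ b (A.proj_mem i z), hc, zero_mul, zero_add, smul_smul,
      Int.units_mul_self, one_smul]

theorem mul_closed (a z : A.carrier) (hz : A.d z = 0) : A.d (a * z) = A.d a * z := by
  induction a using DirectSum.Decomposition.inductionOn A.gr with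
  | zero => simp
  | @homogeneous i m => rw [A.leibniz i.1 i.2 _ z m.2, hz, mul_zero, smul_zero, add_zero]
  | add a b ha hb => rw [add_mul, map_add, ha, hb, map_add, add_mul]

/-- The algebra of cocycles. -/
def cocycles : Subalgebra F A.carrier where
  carrier := {a | A.d a = 0}
  mul_mem' := by
    intro a b ha hb
    have ha' : A.d a = 0 := ha
    show A.d (a * b) = 0
    rw [A.mul_closed a b hb, ha', zero_mul]
  add_mem' := by
    intro a b ha hb
    have ha' : A.d a = 0 := ha
    have hb' : A.d b = 0 := hb
    show A.d (a + b) = 0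
    rw [map_add, ha', hb', add_zero]
  algebraMap_mem' := by
    intro r
    show A.d (algebraMap F A.carrier r) = 0
    rw [Algebra.algebraMap_eq_smul_one, map_smul, A.d_one, smul_zero]

/-- The two-sided ideal of coboundaries in the algebra of cocycles. -/
def coboundaries : Ideal A.cocycles where
  carrier := {z | ∃ a, A.d a = z}
  add_mem' := by
    rintro x y ⟨a, ha⟩ ⟨b, hb⟩
    exact ⟨a + b, by rw [map_add, ha, hb]; rfl⟩
  zero_mem' := ⟨0, map_zero _⟩
  smul_mem' := by
    rintro z x ⟨a, ha⟩
    obtain ⟨z', -, h⟩ := A.d_mul_of_closed z z.2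
    exact ⟨z' * a, by rw [h, ha]; rfl⟩

instance : A.coboundaries.IsTwoSided where
  mul_mem_of_left := by
    rintro x z ⟨a, ha⟩
    exact ⟨a * z, by rw [A.mul_closed a z z.2, ha]; rfl⟩

/-- The cohomology algebra: cocycles modulo coboundaries. -/
abbrev Coh : Type u := A.cocycles ⧸ A.coboundaries

/-- The class of a cocycle. -/
noncomputable abbrev cls : A.cocycles →ₐ[F] A.Coh := Ideal.Quotient.mkₐ F A.coboundaries

theorem cls_eq_zero_iff (z : A.cocycles) : A.cls z = 0 ↔ ∃ a, A.d a = z :=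
  Ideal.Quotient.eq_zero_iff_mem

/-- Bidegree `i` part of cohomology: classes of cocycles of bidegree `i`. -/
noncomputable def cohGr (i : ℤ × ℤ) : Submodule F A.Coh :=
  ((A.gr i).comap A.cocycles.val.toLinearMap).map A.cls.toLinearMap

theorem mem_cohGr (i : ℤ × ℤ) (h : A.Coh) :
    h ∈ A.cohGr i ↔ ∃ z : A.cocycles, (z : A.carrier) ∈ A.gr i ∧ A.cls z = h := Iff.rfl

/-- Projection of a cocycle to a bidegree. -/
noncomputable def zproj (i : ℤ × ℤ) (z : A.cocycles) : A.cocycles :=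
  ⟨A.proj i z, by
    obtain ⟨p, q⟩ := i
    show A.d _ = 0
    rw [A.d_proj, show A.d z = 0 from z.2, map_zero]⟩

theorem cohGr_isInternal : DirectSum.IsInternal A.cohGr := by
  classical
  have hsurj : Function.Surjective A.cls := Ideal.Quotient.mk_surjective
  let s : A.Coh → A.cocycles := Function.surjInv hsurj
  have hs : ∀ h, A.cls (s h) = h := Function.surjInv_eq hsurj
  have key : ∀ i (z w : A.cocycles), A.cls z = A.cls w →
      A.cls (A.zproj i z) = A.cls (A.zproj i w) := by
    rintro ⟨p, q⟩ z w h
    rw [← sub_eq_zero, ← map_sub, cls_eq_zero_iff] at h ⊢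
    obtain ⟨a, ha⟩ := h
    refine ⟨A.proj (p - 1, q) a, ?_⟩
    rw [A.d_proj, ha, sub_add_cancel]
    exact map_sub (A.proj (p, q)) _ _
  refine isInternal_of_proj A.cohGr (fun i h => A.cls (A.zproj i (s h))) ?_ ?_ ?_ ?_
  · intro i a b
    rw [← map_add, key i (s (a + b)) (s a + s b) (by rw [hs, map_add, hs, hs])]
    congr 1
    exact Subtype.ext (map_add (A.proj i) _ _)
  · rintro i a ⟨z, hz, rfl⟩
    change A.cls (A.zproj i (s (A.cls z))) = A.cls z
    rw [key i (s (A.cls z)) z (hs _)]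
    congr 1
    exact Subtype.ext (A.proj_same i _ hz)
  · rintro i j hij a ⟨z, hz, rfl⟩
    change A.cls (A.zproj j (s (A.cls z))) = 0
    rw [key j (s (A.cls z)) z (hs _), ← map_zero A.cls]
    congr 1
    exact Subtype.ext (A.proj_ne i j hij _ hz)
  · intro h
    obtain ⟨z, rfl⟩ := hsurj h
    obtain ⟨t, ht⟩ := A.sum_proj z
    have : z = ∑ i ∈ t, A.zproj i z := by
      apply Subtype.ext
      rw [AddSubmonoidClass.coe_finsetSum]
      exact ht
    rw [this, map_sum]
    refine Submodule.sum_mem _ fun i _ => ?_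
    exact Submodule.mem_iSup_of_mem i ⟨A.zproj i z, A.proj_mem i _, rfl⟩

noncomputable instance cohGraded : GradedAlgebra A.cohGr where
  one_mem := ⟨1, SetLike.GradedOne.one_mem (A := A.gr), map_one A.cls⟩
  mul_mem := by
    rintro i j _ _ ⟨z, hz, rfl⟩ ⟨w, hw, rfl⟩
    exact ⟨z * w, SetLike.GradedMul.mul_mem (A := A.gr) hz hw, map_mul A.cls z w⟩
  toDecomposition := A.cohGr_isInternal.chooseDecomposition

/-- The cohomology of a `q`-graded dga, as a `q`-graded dga with zero differential. -/
noncomputable def H : QDGA F where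
  carrier := A.Coh
  gr := A.cohGr
  d := 0
  d_mem := by intros; exact Submodule.zero_mem _
  d_d := by intros; rfl
  leibniz := by intros; simp

variable {A} {B : QDGA F}

/-- The map on cocycles induced by a morphism. -/
def Hom.mapCocycles (f : Hom A B) : A.cocycles →ₐ[F] B.cocycles :=
  (f.toAlgHom.comp A.cocycles.val).codRestrict B.cocycles (by
    intro z
    show B.d (f.toAlgHom z) = 0
    rw [← f.map_d, show A.d z = 0 from z.2, map_zero])

/-- The map on cohomology induced by a morphism. -/
noncomputable def Hom.mapH (f : Hom A B) : A.Coh →ₐ[F] B.Coh :=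
  Ideal.Quotient.liftₐ A.coboundaries (B.cls.comp f.mapCocycles) (by
    rintro z ⟨a, ha⟩
    show B.cls (f.mapCocycles z) = 0
    rw [cls_eq_zero_iff]
    refine ⟨f.toAlgHom a, ?_⟩
    rw [← f.map_d, ha]
    rfl)

/-- A morphism is a quasi-isomorphism if it induces an isomorphism on cohomology. -/
def Hom.IsQuasiIso (f : Hom A B) : Prop := Function.Bijective f.mapH

/-- Two `q`-graded dgas are quasi-isomorphic if they are connected by a finite zigzag of
quasi-isomorphisms of `q`-graded dgas. -/
def QuasiIsomorphic (A B : QDGA F) : Prop :=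
  Relation.EqvGen (fun X Y : QDGA F => ∃ f : Hom X Y, f.IsQuasiIso) A B

/-- A `q`-graded dga is formal if it is quasi-isomorphic to its cohomology. -/
def IsFormal (A : QDGA F) : Prop := QuasiIsomorphic A A.H

end QDGA

end QDG

namespace QDG

section Presented

variable {F : Type u} [Field F] {X : Type}

/-- The `F`-algebra with generators `X` and relations `r`. -/
def Pres (r : FreeAlgebra F X → FreeAlgebra F X → Prop) : Type u := RingQuot r

namespace Pres

variable (r : FreeAlgebra F X → FreeAlgebra F X → Prop)

noncomputable instance : Ring (Pres r) := inferInstanceAs (Ring (RingQuot r))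

noncomputable instance : Algebra F (Pres r) := inferInstanceAs (Algebra F (RingQuot r))

/-- The quotient map from the free algebra. -/
noncomputable def mk : FreeAlgebra F X →ₐ[F] Pres r := RingQuot.mkAlgHom F r

/-- The class of a generator. -/
noncomputable def gen (x : X) : Pres r := mk r (FreeAlgebra.ι F x)

variable {r}

theorem mk_rel {a b : FreeAlgebra F X} (h : r a b) : mk r a = mk r b := RingQuot.mkAlgHom_rel F h

@[simp] theorem mk_ι (x : X) : mk r (FreeAlgebra.ι F x) = gen r x := rfl

theorem mk_surjective : Function.Surjective (mk r) := RingQuot.mkAlgHom_surjective F r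

/-- The algebra map defined by values on the generators that satisfy the relations. -/
noncomputable def lift {B : Type*} [Semiring B] [Algebra F B] (f : X → B)
    (h : ∀ ⦃a b⦄, r a b → FreeAlgebra.lift F f a = FreeAlgebra.lift F f b) : Pres r →ₐ[F] B :=
  RingQuot.liftAlgHom F ⟨FreeAlgebra.lift F f, h⟩

theorem lift_mk {B : Type*} [Semiring B] [Algebra F B] (f : X → B)
    (h : ∀ ⦃a b⦄, r a b → FreeAlgebra.lift F f a = FreeAlgebra.lift F f b) (a : FreeAlgebra F X) :
    lift f h (mk r a) = FreeAlgebra.lift F f a :=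
  RingQuot.liftAlgHom_mkAlgHom_apply F _ h a

@[simp] theorem lift_gen {B : Type*} [Semiring B] [Algebra F B] (f : X → B)
    (h : ∀ ⦃a b⦄, r a b → FreeAlgebra.lift F f a = FreeAlgebra.lift F f b) (x : X) :
    lift f h (gen r x) = f x := by
  rw [gen, lift_mk, FreeAlgebra.lift_ι_apply]

theorem hom_ext {B : Type*} [Semiring B] [Algebra F B] {f g : Pres r →ₐ[F] B}
    (h : ∀ x, f (gen r x) = g (gen r x)) : f = g := by
  have : f.comp (mk r) = g.comp (mk r) := FreeAlgebra.hom_ext (funext h)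
  ext a
  obtain ⟨a, rfl⟩ := mk_surjective a
  exact DFunLike.congr_fun this a

end Pres

variable {ι : Type} [AddCommMonoid ι]

/-- Degree `i` part of the algebra generated by `X` with relations `r`, when `x : X` has degree
`δ x`: the span of the words of degree `i` in the generators. -/
noncomputable def wordGr (r : FreeAlgebra F X → FreeAlgebra F X → Prop) (δ : X → ι) (i : ι) :
    Submodule F (Pres r) :=
  Submodule.span F {a | ∃ l : List X, (l.map δ).sum = i ∧
    a = (l.map fun x => Pres.gen r x).prod}

variable (F) in
/-- The span of the words of degree `i` in the free algebra. -/
def wspan (δ : X → ι) (i : ι) : Submodule F (FreeAlgebra F X) :=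
  Submodule.span F {a | ∃ l : List X, (l.map δ).sum = i ∧
    a = (l.map fun x => FreeAlgebra.ι F x).prod}

/-- All relations are homogeneous: both sides are combinations of words of one and the same degree. -/
def HomogRel (r : FreeAlgebra F X → FreeAlgebra F X → Prop) (δ : X → ι) : Prop :=
  ∀ a b, r a b → ∃ i, a ∈ wspan F δ i ∧ b ∈ wspan F δ i

variable (r : FreeAlgebra F X → FreeAlgebra F X → Prop) (δ : X → ι)

theorem wordGr_gradedMonoid : SetLike.GradedMonoid (wordGr r δ) where
  one_mem := Submodule.subset_span ⟨[], by simp, by simp⟩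
  mul_mem := by
    intro i j a b ha hb
    have h : wordGr r δ i * wordGr r δ j ≤ wordGr r δ (i + j) := by
      unfold wordGr
      rw [Submodule.span_mul_span, Submodule.span_le]
      rintro _ ⟨_, ⟨l, hl, rfl⟩, _, ⟨m, hm, rfl⟩, rfl⟩
      refine Submodule.subset_span ⟨l ++ m, ?_, ?_⟩
      · rw [List.map_append, List.sum_append, hl, hm]
      · simp
    exact h (Submodule.mul_mem_mul ha hb)

theorem gen_mem (x : X) : Pres.gen r x ∈ wordGr r δ (δ x) :=
  Submodule.subset_span ⟨[x], by simp, by simp⟩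

/-- The grading of an algebra presented by generators with degrees and homogeneous relations. -/
@[reducible] noncomputable def wordGrading [DecidableEq ι] (h : HomogRel r δ) : GradedAlgebra (wordGr r δ) :=
  letI := wordGr_gradedMonoid r δ
  let φ₀ : FreeAlgebra F X →ₐ[F] DirectSum ι fun i => wordGr r δ i :=
    FreeAlgebra.lift F fun x => DirectSum.of (fun i => wordGr r δ i) (δ x) ⟨_, gen_mem r δ x⟩
  have hword : ∀ l : List X, ∃ y : wordGr r δ (l.map δ).sum,
      (y : Pres r) = Pres.mk r (l.map fun x => FreeAlgebra.ι F x).prod ∧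
      φ₀ (l.map fun x => FreeAlgebra.ι F x).prod = DirectSum.of (fun i => wordGr r δ i) _ y := by
    intro l
    induction l with
    | nil => exact ⟨⟨1, SetLike.GradedOne.one_mem (A := wordGr r δ)⟩, by simp, by simp; rfl⟩
    | cons x l ih =>
      obtain ⟨y, hy, hy'⟩ := ih
      refine ⟨⟨Pres.gen r x * y, ?_⟩, ?_, ?_⟩
      · exact SetLike.GradedMul.mul_mem (A := wordGr r δ) (gen_mem r δ x) y.2
      · simp [hy]
      · rw [List.map_cons, List.prod_cons, map_mul, hy']
        simp only [φ₀, FreeAlgebra.lift_ι_apply]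
        rw [DirectSum.of_mul_of]
        rfl
  have hspan : ∀ i, ∀ a ∈ wspan F δ i, ∃ y : wordGr r δ i,
      (y : Pres r) = Pres.mk r a ∧ φ₀ a = DirectSum.of (fun i => wordGr r δ i) _ y := by
    intro i a ha
    unfold wspan at ha
    induction ha using Submodule.span_induction with
    | mem a ha =>
      obtain ⟨l, rfl, rfl⟩ := ha
      exact hword l
    | zero => exact ⟨0, by simp, by simp⟩
    | add a b _ _ iha ihb =>
      obtain ⟨y, hy, hy'⟩ := iha
      obtain ⟨z, hz, hz'⟩ := ihb
      exact ⟨y + z, by simp [hy, hz], by simp [hy', hz']⟩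
    | smul c a _ iha =>
      obtain ⟨y, hy, hy'⟩ := iha
      refine ⟨c • y, by simp [hy], ?_⟩
      rw [map_smul, hy']
      exact (DirectSum.lof F ι (fun i => wordGr r δ i) i).map_smul c y |>.symm
  have hrel : ∀ ⦃a b⦄, r a b → φ₀ a = φ₀ b := by
    intro a b hab
    obtain ⟨i, ha, hb⟩ := h a b hab
    obtain ⟨y, hy, hy'⟩ := hspan i a ha
    obtain ⟨z, hz, hz'⟩ := hspan i b hb
    rw [hy', hz']
    congr 1
    exact Subtype.ext (by rw [hy, hz, Pres.mk_rel hab])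
  GradedAlgebra.ofAlgHom (wordGr r δ) (Pres.lift _ hrel)
    (by
      apply Pres.hom_ext
      intro x
      rw [AlgHom.comp_apply, Pres.lift_gen]
      simp)
    (by
      intro i x
      obtain ⟨x, hx⟩ := x
      unfold wordGr at hx
      induction hx using Submodule.span_induction with
      | mem a ha =>
        obtain ⟨l, rfl, rfl⟩ := ha
        obtain ⟨y, hy, hy'⟩ := hword l
        have e : (l.map fun x => Pres.gen r x).prod =
            Pres.mk r (l.map fun x => FreeAlgebra.ι F x).prod := by
          rw [map_list_prod, List.map_map]; rfl
        simp only [e]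
        rw [Pres.lift_mk, hy']
        congr 1
        exact Subtype.ext hy
      | zero => 
        rw [map_zero]
        exact (map_zero (DirectSum.of (fun i => wordGr r δ i) i)).symm
      | add a b ha hb iha ihb =>
        rw [map_add, iha, ihb, ← map_add]
        rfl
      | smul c a ha iha =>
        rw [map_smul, iha]
        exact (DirectSum.lof F ι (fun i => wordGr r δ i) i).map_smul c ⟨a, ha⟩ |>.symm)

end Presented

end QDG

namespace QDG

/-- Labels of the generators of algebras of diagrams on `k` strands (numbered from `0`): the crossing
of the strands `i` and `i + 1`, and the dot on the strand `j`. -/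
inductive Gen (k : ℕ) : Type
  | cross (i : ℕ) (h : i + 1 < k) : Gen k
  | dot (j : Fin k) : Gen k

variable (F : Type u) [Field F] (k : ℕ)

/-- The crossing as an element of the free algebra. -/
abbrev fc (i : ℕ) (h : i + 1 < k) : FreeAlgebra F (Gen k) := FreeAlgebra.ι F (Gen.cross i h)

/-- The dot as an element of the free algebra. -/
abbrev fd (j : ℕ) (h : j < k) : FreeAlgebra F (Gen k) := FreeAlgebra.ι F (Gen.dot ⟨j, h⟩)

/-- Defining relations of the nilHecke algebra (crossings `∂_i`, dots `x_j`). -/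
inductive NHRel : FreeAlgebra F (Gen k) → FreeAlgebra F (Gen k) → Prop
  | sq (i : ℕ) (h : i + 1 < k) : NHRel (fc F k i h * fc F k i h) 0
  | braid (i : ℕ) (h : i + 1 < k) (h' : i + 1 + 1 < k) :
      NHRel (fc F k i h * fc F k (i + 1) h' * fc F k i h)
        (fc F k (i + 1) h' * fc F k i h * fc F k (i + 1) h')
  | far (i i' : ℕ) (h : i + 1 < k) (h' : i' + 1 < k) (hii : i + 1 < i') :
      NHRel (fc F k i h * fc F k i' h') (fc F k i' h' * fc F k i h)
  | dots (j j' : ℕ) (h : j < k) (h' : j' < k) (hjj : j ≠ j') :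
      NHRel (fd F k j h * fd F k j' h') (fd F k j' h' * fd F k j h)
  | left (i : ℕ) (h₀ : i < k) (h : i + 1 < k) :
      NHRel (fd F k i h₀ * fc F k i h - fc F k i h * fd F k (i + 1) h) 1
  | right (i : ℕ) (h₀ : i < k) (h : i + 1 < k) :
      NHRel (fd F k (i + 1) h * fc F k i h - fc F k i h * fd F k i h₀) (-1)
  | slide (i j : ℕ) (h : i + 1 < k) (hj : j < k) (h1 : j ≠ i) (h2 : j ≠ i + 1) :
      NHRel (fd F k j hj * fc F k i h) (fc F k i h * fd F k j hj)

/-- Defining relations of `R_k^nil` (crossings `s_i`, dots `ξ_j`). -/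
inductive RRel : FreeAlgebra F (Gen k) → FreeAlgebra F (Gen k) → Prop
  | sq (i : ℕ) (h : i + 1 < k) : RRel (fc F k i h * fc F k i h) 0
  | braid (i : ℕ) (h : i + 1 < k) (h' : i + 1 + 1 < k) :
      RRel (fc F k i h * fc F k (i + 1) h' * fc F k i h)
        (fc F k (i + 1) h' * fc F k i h * fc F k (i + 1) h')
  | far (i i' : ℕ) (h : i + 1 < k) (h' : i' + 1 < k) (hii : i + 1 < i') :
      RRel (fc F k i h * fc F k i' h') (fc F k i' h' * fc F k i h)
  | dotSq (j : ℕ) (h : j < k) : RRel (fd F k j h * fd F k j h) 0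
  | dots (j j' : ℕ) (h : j < k) (h' : j' < k) (hjj : j ≠ j') :
      RRel (fd F k j h * fd F k j' h') (-(fd F k j' h' * fd F k j h))
  | left (i : ℕ) (h₀ : i < k) (h : i + 1 < k) :
      RRel (fd F k i h₀ * fc F k i h) (fc F k i h * fd F k (i + 1) h)
  | right (i : ℕ) (h₀ : i < k) (h : i + 1 < k) :
      RRel (fd F k (i + 1) h * fc F k i h) (fc F k i h * fd F k i h₀)
  | slide (i j : ℕ) (h : i + 1 < k) (hj : j < k) (h1 : j ≠ i) (h2 : j ≠ i + 1) :
      RRel (fd F k j hj * fc F k i h) (fc F k i h * fd F k j hj)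

/-- The nilHecke algebra on `k` strands. -/
abbrev NH : Type u := Pres (NHRel F k)

/-- The underlying algebra of `R_k^nil`. -/
abbrev RAlg : Type u := Pres (RRel F k)

/-- The `q`-degrees of the generators of the nilHecke algebra. -/
def nhDeg : Gen k → ℤ
  | .cross _ _ => -2
  | .dot _ => 2

/-- The bidegrees of the generators of `R_k^nil`. -/
def rDeg : Gen k → ℤ × ℤ
  | .cross _ _ => (0, -2)
  | .dot _ => (1, -2)

section words

variable {F} {X : Type} {ι : Type} [AddCommMonoid ι]

theorem w0 (δ : X → ι) (i : ι) : (0 : FreeAlgebra F X) ∈ wspan F δ i := Submodule.zero_mem _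

theorem w1 (δ : X → ι) (i : ι) (h : 0 = i) : (1 : FreeAlgebra F X) ∈ wspan F δ i :=
  Submodule.subset_span ⟨[], by simpa using h, by simp⟩

theorem w2 (δ : X → ι) (x y : X) (i : ι) (h : δ x + δ y = i) :
    FreeAlgebra.ι F x * FreeAlgebra.ι F y ∈ wspan F δ i :=
  Submodule.subset_span ⟨[x, y], by simpa using h, by simp⟩

theorem w3 (δ : X → ι) (x y z : X) (i : ι) (h : δ x + δ y + δ z = i) :
    FreeAlgebra.ι F x * FreeAlgebra.ι F y * FreeAlgebra.ι F z ∈ wspan F δ i :=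
  Submodule.subset_span ⟨[x, y, z], by simpa [add_assoc] using h, by simp [mul_assoc]⟩

end words

theorem nh_homog : HomogRel (NHRel F k) (nhDeg k) := by
  intro a b hab
  cases hab with
  | sq i h => exact ⟨-4, w2 _ _ _ _ rfl, w0 _ _⟩
  | braid i h h' => exact ⟨-6, w3 _ _ _ _ _ rfl, w3 _ _ _ _ _ rfl⟩
  | far i i' h h' _ => exact ⟨-4, w2 _ _ _ _ rfl, w2 _ _ _ _ rfl⟩
  | dots j j' h h' _ => exact ⟨4, w2 _ _ _ _ rfl, w2 _ _ _ _ rfl⟩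
  | left i h₀ h =>
    exact ⟨0, Submodule.sub_mem _ (w2 _ _ _ _ rfl) (w2 _ _ _ _ rfl), w1 _ _ rfl⟩
  | right i h₀ h =>
    exact ⟨0, Submodule.sub_mem _ (w2 _ _ _ _ rfl) (w2 _ _ _ _ rfl),
      Submodule.neg_mem _ (w1 _ _ rfl)⟩
  | slide i j h hj _ _ => exact ⟨0, w2 _ _ _ _ rfl, w2 _ _ _ _ rfl⟩

theorem r_homog : HomogRel (RRel F k) (rDeg k) := by
  intro a b hab
  cases hab with
  | sq i h => exact ⟨(0, -4), w2 _ _ _ _ rfl, w0 _ _⟩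
  | braid i h h' => exact ⟨(0, -6), w3 _ _ _ _ _ rfl, w3 _ _ _ _ _ rfl⟩
  | far i i' h h' _ => exact ⟨(0, -4), w2 _ _ _ _ rfl, w2 _ _ _ _ rfl⟩
  | dotSq j h => exact ⟨(2, -4), w2 _ _ _ _ rfl, w0 _ _⟩
  | dots j j' h h' _ =>
    exact ⟨(2, -4), w2 _ _ _ _ rfl, Submodule.neg_mem _ (w2 _ _ _ _ rfl)⟩
  | left i h₀ h => exact ⟨(1, -4), w2 _ _ _ _ rfl, w2 _ _ _ _ rfl⟩
  | right i h₀ h => exact ⟨(1, -4), w2 _ _ _ _ rfl, w2 _ _ _ _ rfl⟩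
  | slide i j h hj _ _ => exact ⟨(1, -4), w2 _ _ _ _ rfl, w2 _ _ _ _ rfl⟩

namespace NH

variable {k}

/-- The generator `∂_i` (strands numbered from `0`). -/
noncomputable def del (i : ℕ) (h : i + 1 < k) : NH F k :=
  Pres.gen (NHRel F k) (Gen.cross i h)

/-- The generator `x_j` (strands numbered from `0`). -/
noncomputable def x (j : Fin k) : NH F k :=
  Pres.gen (NHRel F k) (Gen.dot j)

variable (k)

/-- The `q`-grading of the nilHecke algebra. -/
noncomputable def gr (q : ℤ) : Submodule F (NH F k) := wordGr (NHRel F k) (nhDeg k) q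

noncomputable instance graded : GradedAlgebra (NH.gr F k) := wordGrading _ _ (nh_homog F k)

end NH

namespace RNil

variable {k}

/-- The generator `s_i` (strands numbered from `0`). -/
noncomputable def s (i : ℕ) (h : i + 1 < k) : RAlg F k :=
  Pres.gen (RRel F k) (Gen.cross i h)

/-- The generator `ξ_j` (strands numbered from `0`). -/
noncomputable def xi (j : Fin k) : RAlg F k :=
  Pres.gen (RRel F k) (Gen.dot j)

variable (k)

/-- The bigrading of `R_k^nil`. -/
noncomputable def gr (i : ℤ × ℤ) : Submodule F (RAlg F k) := wordGr (RRel F k) (rDeg k) i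

noncomputable instance graded : GradedAlgebra (RNil.gr F k) := wordGrading _ _ (r_homog F k)

variable {k}

theorem s_sq (i : ℕ) (h : i + 1 < k) : s F i h * s F i h = 0 := by
  simpa [s] using Pres.mk_rel (RRel.sq (F := F) i h)

theorem braid (i : ℕ) (h : i + 1 < k) (h' : i + 1 + 1 < k) :
    s F i h * s F (i + 1) h' * s F i h = s F (i + 1) h' * s F i h * s F (i + 1) h' := by
  simpa [s] using Pres.mk_rel (RRel.braid (F := F) i h h')

theorem far (i i' : ℕ) (h : i + 1 < k) (h' : i' + 1 < k) (hii : i + 1 < i') :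
    s F i h * s F i' h' = s F i' h' * s F i h := by
  simpa [s] using Pres.mk_rel (RRel.far (F := F) i i' h h' hii)

theorem xi_sq (j : Fin k) : xi F j * xi F j = 0 := by
  simpa [xi] using Pres.mk_rel (RRel.dotSq (F := F) j.1 j.2)

theorem xi_xi (j j' : Fin k) (hjj : j ≠ j') : xi F j * xi F j' = -(xi F j' * xi F j) := by
  simpa [xi] using Pres.mk_rel
    (RRel.dots (F := F) j.1 j'.1 j.2 j'.2 (fun h => hjj (Fin.ext h)))

theorem s_xi_right (i : ℕ) (h₀ : i < k) (h : i + 1 < k) :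
    s F i h * xi F ⟨i + 1, h⟩ = xi F ⟨i, h₀⟩ * s F i h := by
  simpa [s, xi] using (Pres.mk_rel (RRel.left (F := F) i h₀ h)).symm

theorem s_xi_left (i : ℕ) (h₀ : i < k) (h : i + 1 < k) :
    s F i h * xi F ⟨i, h₀⟩ = xi F ⟨i + 1, h⟩ * s F i h := by
  simpa [s, xi] using (Pres.mk_rel (RRel.right (F := F) i h₀ h)).symm

theorem s_xi (i j : ℕ) (h : i + 1 < k) (hj : j < k) (h1 : j ≠ i) (h2 : j ≠ i + 1) :
    s F i h * xi F ⟨j, hj⟩ = xi F ⟨j, hj⟩ * s F i h := by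
  simpa [s, xi] using (Pres.mk_rel (RRel.slide (F := F) i j h hj h1 h2)).symm

/-- `d s_i = ξ_i - ξ_{i+1}`. -/
noncomputable def ds (i : ℕ) (h : i + 1 < k) : RAlg F k :=
  xi F ⟨i, Nat.lt_of_succ_lt h⟩ - xi F ⟨i + 1, h⟩

theorem s_ds (i : ℕ) (h : i + 1 < k) : s F i h * ds F i h = -(ds F i h * s F i h) := by
  rw [ds, mul_sub, s_xi_right F i (Nat.lt_of_succ_lt h), s_xi_left, sub_mul, neg_sub]

theorem s_ds_far (i i' : ℕ) (h : i + 1 < k) (h' : i' + 1 < k) (hii : i + 1 < i' ∨ i' + 1 < i) :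
    s F i h * ds F i' h' = ds F i' h' * s F i h := by
  rw [ds, mul_sub, s_xi F i _ h _ (by omega) (by omega), s_xi F i _ h _ (by omega) (by omega),
    sub_mul]

/-- Values on the generators of `a ↦ ![σ a, d a; 0, a]`, where `σ a = (-1)^|a| a`. -/
noncomputable def dblGen : Gen k → Matrix (Fin 2) (Fin 2) (RAlg F k)
  | .cross i h => !![s F i h, ds F i h; 0, s F i h]
  | .dot j => !![-xi F j, 0; 0, xi F j]

variable (k)

theorem dbl_rel ⦃a b : FreeAlgebra F (Gen k)⦄ (hab : RRel F k a b) :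
    FreeAlgebra.lift F (dblGen F (k := k)) a = FreeAlgebra.lift F (dblGen F (k := k)) b := by
  cases hab with
  | sq i h =>
    simp only [map_mul, map_zero, FreeAlgebra.lift_ι_apply, dblGen, Matrix.mul_fin_two, s_sq, s_ds]
    ext a b; fin_cases a <;> fin_cases b <;> simp
  | braid i h h' =>
    have h₀ := Nat.lt_of_succ_lt h
    have e1 : s F i h * s F (i + 1) h' * ds F i h = ds F (i + 1) h' * (s F i h * s F (i + 1) h') := by
      rw [ds, ds, mul_assoc, mul_sub, s_xi F (i + 1) i h' h₀ (by omega) (by omega),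
        s_xi_left F (i + 1) h h', mul_sub, ← mul_assoc, ← mul_assoc, s_xi_left F i h₀ h,
        s_xi F i (i + 1 + 1) h h' (by omega) (by omega)]
      simp only [sub_mul, mul_assoc]
    have e2 : s F (i + 1) h' * s F i h * ds F (i + 1) h' = ds F i h * (s F (i + 1) h' * s F i h) := by
      rw [ds, ds, mul_assoc, mul_sub, s_xi_right F i h₀ h,
        s_xi F i (i + 1 + 1) h h' (by omega) (by omega), mul_sub, ← mul_assoc, ← mul_assoc,
        s_xi F (i + 1) i h' h₀ (by omega) (by omega), s_xi_right F (i + 1) h h']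
      simp only [sub_mul, mul_assoc]
    have e3 : s F i h * ds F (i + 1) h' * s F i h = 0 := by
      rw [ds, mul_sub, s_xi_right F i h₀ h,
        s_xi F i (i + 1 + 1) h h' (by omega) (by omega), sub_mul, mul_assoc, mul_assoc, s_sq,
        mul_zero, mul_zero, sub_zero]
    have e4 : s F (i + 1) h' * ds F i h * s F (i + 1) h' = 0 := by
      rw [ds, mul_sub, s_xi F (i + 1) i h' h₀ (by omega) (by omega), s_xi_left F (i + 1) h h',
        sub_mul, mul_assoc, mul_assoc, s_sq, mul_zero, mul_zero, sub_zero]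
    simp only [map_mul, FreeAlgebra.lift_ι_apply, dblGen, Matrix.mul_fin_two]
    ext a b; fin_cases a <;> fin_cases b <;>
      simp [braid F i h h', add_mul, e1, e2, e3, e4, mul_assoc, add_comm]
  | far i i' h h' hii =>
    simp only [map_mul, FreeAlgebra.lift_ι_apply, dblGen, Matrix.mul_fin_two]
    ext a b; fin_cases a <;> fin_cases b <;>
      simp [far F i i' h h' hii, s_ds_far F i i' h h' (Or.inl hii),
        s_ds_far F i' i h' h (Or.inr hii), add_comm]
  | dotSq j h =>
    simp only [map_mul, map_zero, FreeAlgebra.lift_ι_apply, dblGen, Matrix.mul_fin_two]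
    ext a b; fin_cases a <;> fin_cases b <;> simp [xi_sq]
  | dots j j' h h' hjj =>
    have e := xi_xi F ⟨j, h⟩ ⟨j', h'⟩ (fun h => hjj (Fin.mk.inj_iff.1 h))
    simp only [map_mul, map_neg, FreeAlgebra.lift_ι_apply, dblGen, Matrix.mul_fin_two]
    ext a b; fin_cases a <;> fin_cases b <;> simp [e]
  | left i h₀ h =>
    have e := s_xi_right F i h₀ h
    have e' := xi_xi F ⟨i, h₀⟩ ⟨i + 1, h⟩ (by simp)
    simp only [map_mul, FreeAlgebra.lift_ι_apply, dblGen, Matrix.mul_fin_two]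
    ext a b; fin_cases a <;> fin_cases b <;> simp [e, ds, mul_sub, sub_mul, xi_sq, e']
  | right i h₀ h =>
    have e := s_xi_left F i h₀ h
    simp only [map_mul, FreeAlgebra.lift_ι_apply, dblGen, Matrix.mul_fin_two]
    ext a b; fin_cases a <;> fin_cases b <;> simp [e, ds, mul_sub, sub_mul, xi_sq]
  | slide i j h hj h1 h2 =>
    have e := s_xi F i j h hj h1 h2
    have e1 := xi_xi F ⟨i, Nat.lt_of_succ_lt h⟩ ⟨j, hj⟩ (by simpa using h1.symm)
    have e2 := xi_xi F ⟨i + 1, h⟩ ⟨j, hj⟩ (by simpa using h2.symm)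
    simp only [map_mul, FreeAlgebra.lift_ι_apply, dblGen, Matrix.mul_fin_two]
    ext a b; fin_cases a <;> fin_cases b <;> simp [e, ds, mul_sub, sub_mul, e1, e2]


/-- The algebra map `a ↦ ![σ a, d a; 0, a]`, where `σ a = (-1)^|a| a`; it is multiplicative precisely
because `d` satisfies the graded Leibniz rule. -/
noncomputable def dbl : RAlg F k →ₐ[F] Matrix (Fin 2) (Fin 2) (RAlg F k) :=
  Pres.lift (dblGen F) (dbl_rel F k)

/-- The differential of `R_k^nil`: the derivation (in the graded sense) with `d s_i = ξ_i - ξ_{i+1}`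
and `d ξ_j = 0`. -/
noncomputable def d : RAlg F k →ₗ[F] RAlg F k where
  toFun a := dbl F k a 0 1
  map_add' a b := by rw [map_add]; rfl
  map_smul' c a := by rw [map_smul]; rfl

theorem dbl_gen (g : Gen k) :
    dbl F k (Pres.gen (RRel F k) g) = dblGen F g := by
  rw [dbl, Pres.lift_gen]

theorem d_s (i : ℕ) (h : i + 1 < k) :
    d F k (s F i h) = xi F ⟨i, Nat.lt_of_succ_lt h⟩ - xi F ⟨i + 1, h⟩ := by
  show dbl F k (s F i h) 0 1 = _
  rw [s, dbl_gen]; rfl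

theorem d_xi (j : Fin k) : d F k (xi F j) = 0 := by
  show dbl F k (xi F j) 0 1 = _
  rw [xi, dbl_gen]; rfl

/-- The product of the generators in a word. -/
noncomputable abbrev wd (l : List (Gen k)) : RAlg F k :=
  (l.map fun x => Pres.gen (RRel F k) x).prod

theorem dbl_wd (l : List (Gen k)) : dbl F k (wd F k l) 1 0 = 0 ∧
    dbl F k (wd F k l) 1 1 = wd F k l ∧
    dbl F k (wd F k l) 0 0 = (l.map (rDeg k)).sum.1.negOnePow • wd F k l := by
  induction l with
  | nil => simp [wd]
  | cons g l ih =>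
    obtain ⟨h1, h2, h3⟩ := ih
    have e : wd F k (g :: l) = Pres.gen (RRel F k) g * wd F k l := rfl
    rw [e, map_mul, dbl_gen, List.map_cons, List.sum_cons, Prod.fst_add]
    cases g with
    | cross i h => simp [Matrix.mul_apply, Fin.sum_univ_two, dblGen, h1, h2, h3, rDeg, s, mul_units_smul]
    | dot j =>
      simp [Matrix.mul_apply, Fin.sum_univ_two, dblGen, h1, h2, h3, rDeg, xi, mul_units_smul, Int.negOnePow_add]

theorem dbl_homog (p q : ℤ) (a : RAlg F k) (ha : a ∈ gr F k (p, q)) : dbl F k a 1 0 = 0 ∧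
    dbl F k a 1 1 = a ∧ dbl F k a 0 0 = p.negOnePow • a := by
  unfold gr wordGr at ha
  induction ha using Submodule.span_induction with
  | mem a ha =>
    obtain ⟨l, hl, rfl⟩ := ha
    have := dbl_wd F k l
    rwa [hl] at this
  | zero => simp
  | add a b _ _ iha ihb =>
    simp only [map_add, Matrix.add_apply, iha, ihb, smul_add, add_zero, and_self]
  | smul c a _ ih =>
    simp only [map_smul, Matrix.smul_apply, ih, smul_zero, smul_comm c, and_self]

theorem dbl_11 (a : RAlg F k) : dbl F k a 1 1 = a := by
  induction a using DirectSum.Decomposition.inductionOn (gr F k) with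
  | zero => simp
  | @homogeneous i m => exact (dbl_homog F k i.1 i.2 _ m.2).2.1
  | add a b ha hb => rw [map_add, Matrix.add_apply, ha, hb]

theorem leibniz (p q : ℤ) (a b : RAlg F k) (ha : a ∈ gr F k (p, q)) :
    d F k (a * b) = d F k a * b + p.negOnePow • (a * d F k b) := by
  show dbl F k (a * b) 0 1 = dbl F k a 0 1 * b + p.negOnePow • (a * dbl F k b 0 1)
  rw [map_mul, Matrix.mul_apply, Fin.sum_univ_two, dbl_11, (dbl_homog F k p q a ha).2.2,
    smul_mul_assoc, add_comm]

theorem d_gen_mem (g : Gen k) :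
    d F k (Pres.gen (RRel F k) g) ∈ gr F k (rDeg k g + (1, 0)) := by
  cases g with
  | cross i h =>
    have := d_s F k i h
    rw [s] at this
    rw [this]
    exact Submodule.sub_mem _ (gen_mem (RRel F k) (rDeg k) (.dot _))
      (gen_mem (RRel F k) (rDeg k) (.dot _))
  | dot j =>
    have := d_xi F k j
    rw [xi] at this
    rw [this]
    exact Submodule.zero_mem _

theorem d_d_gen (g : Gen k) :
    d F k (d F k (Pres.gen (RRel F k) g)) = 0 := by
  cases g with
  | cross i h =>
    have := d_s F k i h
    rw [s] at this
    rw [this, map_sub, d_xi, d_xi, sub_zero]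
  | dot j =>
    have := d_xi F k j
    rw [xi] at this
    rw [this, map_zero]

theorem wd_mem (l : List (Gen k)) : wd F k l ∈ gr F k (l.map (rDeg k)).sum :=
  Submodule.subset_span ⟨l, rfl, rfl⟩

theorem d_one : d F k 1 = 0 := by
  show dbl F k 1 0 1 = 0
  simp

theorem d_wd (l : List (Gen k)) : d F k (wd F k l) ∈ gr F k ((l.map (rDeg k)).sum + (1, 0)) ∧
    d F k (d F k (wd F k l)) = 0 := by
  induction l with
  | nil => simp only [wd, List.map_nil, List.prod_nil, d_one, map_zero, zero_mem, and_self]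
  | cons g l ih =>
    have e : wd F k (g :: l) = Pres.gen (RRel F k) g * wd F k l := rfl
    have hg : Pres.gen (RRel F k) g ∈ gr F k (rDeg k g) :=
      gen_mem (RRel F k) (rDeg k) g
    rw [e, leibniz F k (rDeg k g).1 (rDeg k g).2 _ _ hg, List.map_cons, List.sum_cons]
    constructor
    · refine Submodule.add_mem _ ?_ ?_
      · have := SetLike.GradedMul.mul_mem (A := gr F k) (d_gen_mem F k g) (wd_mem F k l)
        rwa [add_right_comm] at this
      · rw [Units.smul_def]
        have := SetLike.GradedMul.mul_mem (A := gr F k) hg ih.1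
        rw [← add_assoc] at this
        exact zsmul_mem this _
    · have h1 : rDeg k g + (1, 0) = ((rDeg k g).1 + 1, (rDeg k g).2) := by
        ext <;> simp
      have h2 := d_gen_mem F k g
      rw [h1] at h2
      rw [map_add, leibniz F k _ _ _ _ h2, d_d_gen, zero_mul, zero_add, map_units_smul,
        leibniz F k (rDeg k g).1 (rDeg k g).2 _ _ hg, ih.2, mul_zero, smul_zero, add_zero,
        Int.negOnePow_succ, Units.neg_smul, neg_add_cancel]

theorem d_mem_d_d (p q : ℤ) (a : RAlg F k) (ha : a ∈ gr F k (p, q)) :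
    d F k a ∈ gr F k (p + 1, q) ∧ d F k (d F k a) = 0 := by
  have h1 : ((p + 1, q) : ℤ × ℤ) = (p, q) + (1, 0) := by simp
  rw [h1]
  unfold gr wordGr at ha
  induction ha using Submodule.span_induction with
  | mem a ha =>
    obtain ⟨l, hl, rfl⟩ := ha
    have := d_wd F k l
    rwa [hl] at this
  | zero => simp
  | add a b _ _ iha ihb =>
    rw [map_add, map_add, iha.2, ihb.2, add_zero]
    exact ⟨Submodule.add_mem _ iha.1 ihb.1, rfl⟩
  | smul c a _ ih =>
    rw [map_smul, map_smul, ih.2, smul_zero]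
    exact ⟨Submodule.smul_mem _ c ih.1, rfl⟩

end RNil

/-- The `q`-graded dga `R_k^nil`. -/
noncomputable def Rnil : QDGA F where
  carrier := RAlg F k
  gr := RNil.gr F k
  d := RNil.d F k
  d_mem p q a ha := (RNil.d_mem_d_d F k p q a ha).1
  d_d a := by
    induction a using DirectSum.Decomposition.inductionOn (RNil.gr F k) with
    | zero => simp
    | @homogeneous i m => exact (RNil.d_mem_d_d F k i.1 i.2 _ m.2).2
    | add a b ha hb => rw [map_add, map_add, ha, hb, add_zero]
  leibniz := RNil.leibniz F k

end QDG

namespace QDG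

variable (F : Type u) [Field F]

theorem Pres.map_wordGr {F : Type u} [Field F] {X : Type} {ι : Type} [AddCommMonoid ι]
    {r : FreeAlgebra F X → FreeAlgebra F X → Prop} {δ : X → ι} {B : Type*} [Ring B] [Algebra F B]
    (φ : Pres r →ₐ[F] B) (G : ι → Submodule F B) [SetLike.GradedMonoid G]
    (h : ∀ x, φ (Pres.gen r x) ∈ G (δ x)) (i : ι) (a : Pres r) (ha : a ∈ wordGr r δ i) :
    φ a ∈ G i := by
  unfold wordGr at ha
  induction ha using Submodule.span_induction with
  | mem a ha =>
    obtain ⟨l, rfl, rfl⟩ := ha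
    induction l with
    | nil => simpa using SetLike.GradedOne.one_mem (A := G)
    | cons x l ih =>
      simp only [List.map_cons, List.prod_cons, List.sum_cons, map_mul]
      exact SetLike.GradedMul.mul_mem (A := G) (h x) ih
  | zero => rw [map_zero]; exact Submodule.zero_mem _
  | add a b _ _ iha ihb => rw [map_add]; exact Submodule.add_mem _ iha ihb
  | smul c a _ ih => rw [map_smul]; exact Submodule.smul_mem _ c ih

theorem Pres.commute_of_gen {F : Type u} [Field F] {X : Type}
    {r : FreeAlgebra F X → FreeAlgebra F X → Prop} {B : Type*} [Ring B] [Algebra F B]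
    (φ : Pres r →ₐ[F] B) (b : B) (h : ∀ x, Commute (φ (Pres.gen r x)) b) (a : Pres r) :
    Commute (φ a) b := by
  obtain ⟨a, rfl⟩ := Pres.mk_surjective a
  induction a using FreeAlgebra.induction with
  | grade0 c => simpa using Algebra.commute_algebraMap_left c b
  | grade1 x => exact h x
  | mul a a' ha ha' => rw [map_mul, map_mul]; exact ha.mul_left ha'
  | add a a' ha ha' => rw [map_add, map_add]; exact ha.add_left ha'

namespace NH

variable {k : ℕ}

theorem del_sq (i : ℕ) (h : i + 1 < k) : del F i h * del F i h = 0 := by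
  simpa [del] using Pres.mk_rel (NHRel.sq (F := F) i h)

theorem braid (i : ℕ) (h : i + 1 < k) (h' : i + 1 + 1 < k) :
    del F i h * del F (i + 1) h' * del F i h = del F (i + 1) h' * del F i h * del F (i + 1) h' := by
  simpa [del] using Pres.mk_rel (NHRel.braid (F := F) i h h')

theorem far (i i' : ℕ) (h : i + 1 < k) (h' : i' + 1 < k) (hii : i + 1 < i') :
    del F i h * del F i' h' = del F i' h' * del F i h := by
  simpa [del] using Pres.mk_rel (NHRel.far (F := F) i i' h h' hii)

theorem x_x (j j' : Fin k) : x F j * x F j' = x F j' * x F j := by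
  by_cases hjj : j = j'
  · rw [hjj]
  · simpa [x] using Pres.mk_rel
      (NHRel.dots (F := F) j.1 j'.1 j.2 j'.2 (fun h => hjj (Fin.ext h)))

theorem x_del_left (i : ℕ) (h₀ : i < k) (h : i + 1 < k) :
    x F ⟨i, h₀⟩ * del F i h - del F i h * x F ⟨i + 1, h⟩ = 1 := by
  simpa [del, x] using Pres.mk_rel (NHRel.left (F := F) i h₀ h)

theorem x_del_right (i : ℕ) (h₀ : i < k) (h : i + 1 < k) :
    x F ⟨i + 1, h⟩ * del F i h - del F i h * x F ⟨i, h₀⟩ = -1 := by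
  simpa [del, x] using Pres.mk_rel (NHRel.right (F := F) i h₀ h)

theorem x_del (i j : ℕ) (h : i + 1 < k) (hj : j < k) (h1 : j ≠ i) (h2 : j ≠ i + 1) :
    x F ⟨j, hj⟩ * del F i h = del F i h * x F ⟨j, hj⟩ := by
  simpa [del, x] using Pres.mk_rel (NHRel.slide (F := F) i j h hj h1 h2)

theorem del_mem (i : ℕ) (h : i + 1 < k) : del F i h ∈ gr F k (-2) :=
  gen_mem (NHRel F k) (nhDeg k) (.cross i h)

theorem x_mem (j : Fin k) : x F j ∈ gr F k 2 := gen_mem (NHRel F k) (nhDeg k) (.dot j)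

variable (k) (l : ℕ)

/-- Adding `l` vertical strands on the right: the functor `- ⊗ E^l` on endomorphisms of `E^k`. -/
noncomputable def inl : NH F k →ₐ[F] NH F (k + l) :=
  Pres.lift (fun g => match g with
    | .cross i h => del F i (by omega)
    | .dot j => x F ⟨j.1, by omega⟩) (by
    intro a b hab
    cases hab with
    | sq i h => simp [del_sq]
    | braid i h h' => simpa using braid F i _ _
    | far i i' h h' hii => simpa using far F i i' _ _ hii
    | dots j j' h h' hjj => simpa using x_x F _ _
    | left i h₀ h => simpa using x_del_left F i _ _
    | right i h₀ h => simpa using x_del_right F i _ _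
    | slide i j h hj h1 h2 => simpa using x_del F i j _ _ h1 h2)

/-- Adding `k` vertical strands on the left: the functor `E^k ⊗ -` on endomorphisms of `E^l`. -/
noncomputable def inr : NH F l →ₐ[F] NH F (k + l) :=
  Pres.lift (fun g => match g with
    | .cross i h => del F (k + i) (by omega)
    | .dot j => x F ⟨k + j.1, by omega⟩) (by
    intro a b hab
    cases hab with
    | sq i h => simp [del_sq]
    | braid i h h' => simpa [← add_assoc] using braid F (k + i) _ _
    | far i i' h h' hii => simpa using far F (k + i) (k + i') _ _ (by omega)
    | dots j j' h h' hjj => simpa using x_x F _ _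
    | left i h₀ h => simpa [← add_assoc] using x_del_left F (k + i) _ _
    | right i h₀ h => simpa [← add_assoc] using x_del_right F (k + i) _ _
    | slide i j h hj h1 h2 => simpa using x_del F (k + i) (k + j) _ _ (by omega) (by omega))

theorem inl_mem (q : ℤ) (a : NH F k) (ha : a ∈ gr F k q) : inl F k l a ∈ gr F (k + l) q :=
  Pres.map_wordGr (inl F k l) (gr F (k + l)) (by
    intro g
    rw [inl, Pres.lift_gen]
    cases g with
    | cross i h => exact del_mem F _ _
    | dot j => exact x_mem F _) q a ha

theorem inr_mem (q : ℤ) (a : NH F l) (ha : a ∈ gr F l q) : inr F k l a ∈ gr F (k + l) q :=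
  Pres.map_wordGr (inr F k l) (gr F (k + l)) (by
    intro g
    rw [inr, Pres.lift_gen]
    cases g with
    | cross i h => exact del_mem F _ _
    | dot j => exact x_mem F _) q a ha

theorem inl_inr_commute (a : NH F k) (b : NH F l) : Commute (inl F k l a) (inr F k l b) := by
  refine Pres.commute_of_gen _ _ (fun g => ?_) a
  refine (Pres.commute_of_gen _ _ (fun g' => ?_) b).symm
  rw [inl, inr, Pres.lift_gen, Pres.lift_gen]
  cases g with
  | cross i h =>
    cases g' with
    | cross i' h' => exact (far F i (k + i') _ _ (by omega)).symm
    | dot j => exact x_del F i (k + j) _ _ (by omega) (by omega)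
  | dot j =>
    cases g' with
    | cross i' h' => exact (x_del F (k + i') j _ _ (by omega) (by omega)).symm
    | dot j' => exact x_x F _ _

end NH

/-- A bounded complex over `U^+` whose terms are finite direct sums of `q`-shifts of `E^k`. The
additive monoidal category `U^+` has objects the sums of `q`-shifts of `E^k`, `k ≥ 0`, with
`End(E^k) = NH_k`, no nonzero maps between `E^k` and `E^l` for `k ≠ l`, `E^k ⊗ E^l = E^(k+l)`, and
with the tensor product of maps given by juxtaposition of diagrams.

The complex has one summand `E^k` for every `i : I`; it sits in cohomological degree `deg i`, and its
generator has `q`-degree `shift i`. The component of a map from the summand `i` to the summand `j` is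
an element of `NH_k`; if that element has `q`-degree `m`, then the component has `q`-degree
`m + shift j - shift i`. The differential `D` has `q`-degree `0`. -/
structure Cpx (k : ℕ) where
  I : Type
  [fintype : Fintype I]
  [decEq : DecidableEq I]
  deg : I → ℤ
  shift : I → ℤ
  D : Matrix I I (NH F k)
  D_deg : ∀ j i, deg j ≠ deg i + 1 → D j i = 0
  D_gr : ∀ j i, D j i ∈ NH.gr F k (shift i - shift j)
  D_sq : D * D = 0

attribute [instance] Cpx.fintype Cpx.decEq

namespace Cpx

variable {F} {k l : ℕ}

section EndDga

variable (X : Cpx F k)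

/-- Matrices of cohomological degree `p` and `q`-degree `q`. -/
noncomputable def endGr (i : ℤ × ℤ) : Submodule F (Matrix X.I X.I (NH F k)) where
  carrier := {f | ∀ b a, (X.deg b - X.deg a ≠ i.1 → f b a = 0) ∧
    f b a ∈ NH.gr F k (i.2 + X.shift a - X.shift b)}
  add_mem' := by
    intro f g hf hg b a
    refine ⟨fun h => ?_, Submodule.add_mem _ (hf b a).2 (hg b a).2⟩
    rw [Matrix.add_apply, (hf b a).1 h, (hg b a).1 h, add_zero]
  zero_mem' := fun b a => ⟨fun _ => rfl, Submodule.zero_mem _⟩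
  smul_mem' := by
    intro c f hf b a
    refine ⟨fun h => ?_, Submodule.smul_mem _ c (hf b a).2⟩
    rw [Matrix.smul_apply, (hf b a).1 h, smul_zero]

instance endGr_gradedMonoid : SetLike.GradedMonoid X.endGr where
  one_mem := by
    intro b a
    by_cases h : b = a
    · subst h
      refine ⟨fun h => absurd (sub_self _) h, ?_⟩
      rw [Matrix.one_apply_eq, Prod.snd_zero, zero_add, sub_self]
      exact SetLike.GradedOne.one_mem (A := NH.gr F k)
    · rw [Matrix.one_apply_ne h]
      exact ⟨fun _ => rfl, Submodule.zero_mem _⟩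
  mul_mem := by
    intro i j f g hf hg b a
    rw [Matrix.mul_apply]
    constructor
    · intro h
      refine Finset.sum_eq_zero fun c _ => ?_
      by_cases h1 : X.deg b - X.deg c = i.1
      · by_cases h2 : X.deg c - X.deg a = j.1
        · refine absurd ?_ h
          rw [Prod.fst_add, ← h1, ← h2]
          ring
        · rw [(hg c a).1 h2, mul_zero]
      · rw [(hf b c).1 h1, zero_mul]
    · refine Submodule.sum_mem _ fun c _ => ?_
      have h := SetLike.GradedMul.mul_mem (A := NH.gr F k) (hf b c).2 (hg c a).2
      convert h using 2
      rw [Prod.snd_add]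
      ring

theorem endGr_isInternal : DirectSum.IsInternal X.endGr := by
  classical
  refine isInternal_of_proj X.endGr (fun i f => Matrix.of fun b a =>
    if X.deg b - X.deg a = i.1 then
      GradedAlgebra.proj (NH.gr F k) (i.2 + X.shift a - X.shift b) (f b a) else 0) ?_ ?_ ?_ ?_
  · intro i f g
    ext b a
    simp only [Matrix.of_apply, Matrix.add_apply]
    split_ifs
    · rw [map_add]
    · rw [add_zero]
  · intro i f hf
    ext b a
    simp only [Matrix.of_apply]
    split_ifs with h
    · rw [GradedAlgebra.proj_apply, DirectSum.decompose_of_mem_same _ (hf b a).2]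
    · exact ((hf b a).1 h).symm
  · intro i j hij f hf
    ext b a
    simp only [Matrix.of_apply, Matrix.zero_apply]
    split_ifs with h
    · by_cases h1 : X.deg b - X.deg a = i.1
      · rw [GradedAlgebra.proj_apply, DirectSum.decompose_of_mem_ne _ (hf b a).2]
        intro h2
        exact hij (Prod.ext (h1.symm.trans h) (by omega))
      · rw [(hf b a).1 h1, map_zero]
    · rfl
  · intro f
    rw [Matrix.matrix_eq_sum_single f]
    refine Submodule.sum_mem _ fun b _ => Submodule.sum_mem _ fun a _ => ?_
    induction f b a using DirectSum.Decomposition.inductionOn (NH.gr F k) with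
    | zero => rw [Matrix.single_zero]; exact Submodule.zero_mem _
    | @homogeneous m y =>
      refine Submodule.mem_iSup_of_mem (X.deg b - X.deg a, m + X.shift b - X.shift a) ?_
      intro b' a'
      rw [Matrix.single_apply]
      split_ifs with h
      · obtain ⟨rfl, rfl⟩ := h
        refine ⟨fun h => absurd rfl h, ?_⟩
        convert y.2 using 2
        ring
      · exact ⟨fun _ => rfl, Submodule.zero_mem _⟩
    | add y z hy hz => rw [Matrix.single_add]; exact Submodule.add_mem _ hy hz

noncomputable instance endGraded : GradedAlgebra X.endGr where
  toGradedMonoid := X.endGr_gradedMonoid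
  toDecomposition := X.endGr_isInternal.chooseDecomposition

/-- The sign `(-1)^|f|` applied to every homogeneous part of `f`. -/
noncomputable def par (f : Matrix X.I X.I (NH F k)) : Matrix X.I X.I (NH F k) :=
  Matrix.of fun b a => (X.deg b - X.deg a).negOnePow • f b a

theorem par_mul (f g : Matrix X.I X.I (NH F k)) : X.par (f * g) = X.par f * X.par g := by
  ext b a
  simp only [par, Matrix.of_apply, Matrix.mul_apply, Finset.smul_sum]
  refine Finset.sum_congr rfl fun c _ => ?_
  rw [mul_units_smul, smul_mul_assoc, smul_smul, mul_comm, ← Int.negOnePow_add]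
  congr 2
  ring

theorem par_sub (f g : Matrix X.I X.I (NH F k)) : X.par (f - g) = X.par f - X.par g := by
  ext b a
  simp only [par, Matrix.of_apply, Matrix.sub_apply, smul_sub]

theorem par_par (f : Matrix X.I X.I (NH F k)) : X.par (X.par f) = f := by
  ext b a
  simp only [par, Matrix.of_apply, smul_smul, Int.units_mul_self, one_smul]

theorem par_of_mem (i : ℤ × ℤ) (f : Matrix X.I X.I (NH F k)) (hf : f ∈ X.endGr i) :
    X.par f = i.1.negOnePow • f := by
  ext b a
  simp only [par, Matrix.of_apply, Matrix.smul_apply]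
  by_cases h : X.deg b - X.deg a = i.1
  · rw [h]
  · rw [(hf b a).1 h, smul_zero, smul_zero]

theorem D_mem : X.D ∈ X.endGr (1, 0) := by
  intro b a
  refine ⟨fun h => X.D_deg b a fun h' => h (by rw [h']; ring), ?_⟩
  rw [zero_add]
  exact X.D_gr b a

theorem par_D : X.par X.D = -X.D := by
  rw [X.par_of_mem _ _ X.D_mem]
  simp

/-- The differential `d f = D f - (-1)^|f| f D` on endomorphisms. -/
noncomputable def endD : Matrix X.I X.I (NH F k) →ₗ[F] Matrix X.I X.I (NH F k) where
  toFun f := X.D * f - X.par f * X.D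
  map_add' f g := by
    have : X.par (f + g) = X.par f + X.par g := by
      ext b a; simp only [par, Matrix.of_apply, Matrix.add_apply, smul_add]
    rw [this, mul_add, add_mul]
    abel
  map_smul' c f := by
    have : X.par (c • f) = c • X.par f := by
      ext b a
      simp only [par, Matrix.of_apply, Matrix.smul_apply]
      rw [smul_comm]
    rw [this, mul_smul_comm, smul_mul_assoc, ← smul_sub, RingHom.id_apply]

theorem endD_apply (f : Matrix X.I X.I (NH F k)) : X.endD f = X.D * f - X.par f * X.D := rfl

/-- The endomorphism dga of a complex in the dg category of complexes over `U^+`: all endomorphisms of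
the underlying sum of copies of `E^k`, of every cohomological degree and `q`-degree, multiplied by
composition, with the commutator differential. -/
noncomputable def End : QDGA F where
  carrier := Matrix X.I X.I (NH F k)
  gr := X.endGr
  d := X.endD
  d_mem p q f hf := by
    rw [endD_apply, X.par_of_mem _ _ hf]
    have h1 : ((p + 1, q) : ℤ × ℤ) = (1, 0) + (p, q) := by simp [add_comm]
    have h2 : ((p + 1, q) : ℤ × ℤ) = (p, q) + (1, 0) := by simp
    refine Submodule.sub_mem _ ?_ ?_
    · rw [h1]
      exact SetLike.GradedMul.mul_mem (A := X.endGr) X.D_mem hf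
    · rw [h2, smul_mul_assoc, Units.smul_def]
      exact zsmul_mem (SetLike.GradedMul.mul_mem (A := X.endGr) hf X.D_mem) _
  d_d f := by
    simp only [endD_apply, par_sub, par_mul, par_par, par_D]
    simp only [mul_sub, sub_mul, neg_mul, mul_neg, ← mul_assoc, X.D_sq, zero_mul]
    rw [mul_assoc f, X.D_sq]
    simp
  leibniz p q f g hf := by
    rw [endD_apply, endD_apply, endD_apply, par_mul, X.par_of_mem _ _ hf]
    simp only [mul_sub, sub_mul, smul_sub, smul_mul_assoc, mul_assoc]
    abel

end EndDga

section Tensor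

variable (X : Cpx F k) (Y : Cpx F l)

/-- The tensor product of endomorphisms, with the Koszul sign
`(f ⊗ g)(x ⊗ y) = (-1)^(|g| |x|) f x ⊗ g y`. -/
noncomputable def tens (f : Matrix X.I X.I (NH F k)) (g : Matrix Y.I Y.I (NH F l)) :
    Matrix (X.I × Y.I) (X.I × Y.I) (NH F (k + l)) :=
  Matrix.of fun b a => ((Y.deg b.2 - Y.deg a.2) * X.deg a.1).negOnePow •
    (NH.inl F k l (f b.1 a.1) * NH.inr F k l (g b.2 a.2))

theorem tens_mul (f f' : Matrix X.I X.I (NH F k)) (g g' : Matrix Y.I Y.I (NH F l)) (p : ℤ)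
    (hf' : ∀ b a, X.deg b ≠ X.deg a + p → f' b a = 0) :
    tens X Y f g * tens X Y f' g' = tens X Y (f * f')
      ((Matrix.of fun b a => ((Y.deg b - Y.deg a) * p).negOnePow • g b a) * g') := by
  ext b a
  simp only [tens, Matrix.mul_apply, Matrix.of_apply, Fintype.sum_prod_type, map_sum,
    Finset.sum_mul_sum, Finset.smul_sum]
  refine Finset.sum_congr rfl fun c _ => Finset.sum_congr rfl fun e _ => ?_
  by_cases h : X.deg c = X.deg a.1 + p
  · rw [smul_mul_assoc, mul_units_smul, smul_smul, smul_mul_assoc, map_units_smul, map_mul, map_mul,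
      mul_units_smul, smul_smul, ← Int.negOnePow_add, ← Int.negOnePow_add, h]
    congr 1
    · congr 1
      ring
    · rw [mul_assoc, mul_assoc, ← mul_assoc (NH.inr F k l _) (NH.inl F k l _),
        ← (NH.inl_inr_commute F k l (f' c a.1) (g b.2 e)).eq, mul_assoc]
  · rw [hf' _ _ h, map_zero, zero_mul, smul_zero, mul_zero, mul_zero, map_zero, zero_mul, smul_zero]

theorem tens_D_one_mul : tens X Y X.D 1 * tens X Y X.D 1 = 0 := by
  rw [tens_mul X Y _ _ _ _ 1 X.D_deg, X.D_sq]
  ext b a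
  simp [tens]

theorem tens_one_D_mul : tens X Y 1 Y.D * tens X Y 1 Y.D = 0 := by
  rw [tens_mul X Y _ _ _ _ 0 (fun b a h => Matrix.one_apply_ne fun h' => h (by simp [h']))]
  have : (Matrix.of fun b a => ((Y.deg b - Y.deg a) * 0).negOnePow • Y.D b a) = Y.D := by
    ext b a; simp
  rw [this, Y.D_sq]
  ext b a
  simp [tens]

theorem tens_D_anti : tens X Y X.D 1 * tens X Y 1 Y.D + tens X Y 1 Y.D * tens X Y X.D 1 = 0 := by
  rw [tens_mul X Y _ _ _ _ 0 (fun b a h => Matrix.one_apply_ne fun h' => h (by simp [h'])),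
    tens_mul X Y _ _ _ _ 1 X.D_deg, mul_one, mul_one, one_mul]
  have h1 : (Matrix.of fun b a => ((Y.deg b - Y.deg a) * 0).negOnePow •
      (1 : Matrix Y.I Y.I (NH F l)) b a) = 1 := by
    ext b a; simp
  have h2 : (Matrix.of fun b a => ((Y.deg b - Y.deg a) * 1).negOnePow • Y.D b a) = -Y.D := by
    rw [← Y.par_D]
    ext b a; simp [par]
  rw [h1, h2, one_mul]
  ext b a
  simp [tens]

/-- The tensor product of complexes, with differential `D ⊗ 1 + 1 ⊗ D`. -/
noncomputable abbrev tensor : Cpx F (k + l) where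
  I := X.I × Y.I
  deg a := X.deg a.1 + Y.deg a.2
  shift a := X.shift a.1 + Y.shift a.2
  D := tens X Y X.D 1 + tens X Y 1 Y.D
  D_deg := by
    intro b a h
    have e1 : X.D b.1 a.1 = 0 ∨ (1 : Matrix Y.I Y.I (NH F l)) b.2 a.2 = 0 := by
      by_cases h2 : b.2 = a.2
      · refine Or.inl (X.D_deg _ _ fun h' => h ?_)
        rw [h', h2]; ring
      · exact Or.inr (Matrix.one_apply_ne h2)
    have e2 : (1 : Matrix X.I X.I (NH F k)) b.1 a.1 = 0 ∨ Y.D b.2 a.2 = 0 := by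
      by_cases h2 : b.1 = a.1
      · refine Or.inr (Y.D_deg _ _ fun h' => h ?_)
        rw [h', h2]; ring
      · exact Or.inl (Matrix.one_apply_ne h2)
    simp only [tens, Matrix.add_apply, Matrix.of_apply]
    rcases e1 with e1 | e1 <;> rcases e2 with e2 | e2 <;> simp [e1, e2]
  D_gr := by
    intro b a
    simp only [tens, Matrix.add_apply, Matrix.of_apply]
    refine Submodule.add_mem _ ?_ ?_
    · rw [Units.smul_def]
      refine zsmul_mem ?_ _
      by_cases h : b.2 = a.2
      · rw [h, Matrix.one_apply_eq, map_one, mul_one, add_sub_add_right_eq_sub]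
        exact NH.inl_mem F k l _ _ (X.D_gr _ _)
      · rw [Matrix.one_apply_ne h, map_zero, mul_zero]
        exact Submodule.zero_mem _
    · rw [Units.smul_def]
      refine zsmul_mem ?_ _
      by_cases h : b.1 = a.1
      · rw [h, Matrix.one_apply_eq, map_one, one_mul, add_sub_add_left_eq_sub]
        exact NH.inr_mem F k l _ _ (Y.D_gr _ _)
      · rw [Matrix.one_apply_ne h, map_zero, zero_mul]
        exact Submodule.zero_mem _
  D_sq := by
    rw [add_mul, mul_add, mul_add, tens_D_one_mul, tens_one_D_mul, zero_add, add_zero, tens_D_anti]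

end Tensor

variable (F)

/-- The unit complex: `E^0` in degree `0`. -/
noncomputable abbrev unit : Cpx F 0 where
  I := Unit
  deg _ := 0
  shift _ := 0
  D := 0
  D_deg _ _ _ := rfl
  D_gr _ _ := Submodule.zero_mem _
  D_sq := zero_mul _

/-- The two-term complex `L_E = (E → E)` in degrees `0` and `1` with differential `x_1`; the second
copy of `E` is shifted so that the differential has `q`-degree `0`. -/
noncomputable abbrev LofE : Cpx F 1 where
  I := Fin 2
  deg := ![0, 1]
  shift := ![0, -2]
  D := !![0, 0; NH.x F 0, 0]
  D_deg := by
    intro j i h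
    fin_cases j <;> fin_cases i <;> simp at h ⊢
  D_gr := by
    intro j i
    fin_cases j <;> fin_cases i
    · exact Submodule.zero_mem _
    · exact Submodule.zero_mem _
    · simpa using NH.x_mem F (0 : Fin 1)
    · exact Submodule.zero_mem _
  D_sq := by
    rw [Matrix.mul_fin_two]
    ext j i
    fin_cases j <;> fin_cases i <;> simp

/-- The tensor power `L_E^{⊗ k}`. -/
noncomputable def LPow : (k : ℕ) → Cpx F k
  | 0 => unit F
  | k + 1 => (LPow k).tensor (LofE F)

/-- `ρ_1(ξ_1)`: the identity map from the copy of `E` in degree `0` to the one in degree `1`. -/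
noncomputable def rhoXi : Matrix (LofE F).I (LofE F).I (NH F 1) :=
  (!![0, 0; 1, 0] : Matrix (Fin 2) (Fin 2) (NH F 1))

/-- `ρ_2(s_1)` on `L_E ⊗ L_E`: from the summand `(a, b)` to the summand `(b, a)` it is `∂_1` with the
Koszul sign `(-1)^(|a| |b|)`; the other components are zero. -/
noncomputable def rhoS : Matrix ((LofE F).tensor (LofE F)).I ((LofE F).tensor (LofE F)).I (NH F (1 + 1)) :=
  Matrix.of fun b a : Fin 2 × Fin 2 => if b = a.swap then
    ((LofE F).deg a.1 * (LofE F).deg a.2).negOnePow • NH.del F 0 (by omega) else 0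

/-- `ρ_k(ξ_j) = id^{⊗ (j-1)} ⊗ ρ_1(ξ_1) ⊗ id^{⊗ (k-j)}`; strands are numbered from `0`. -/
noncomputable def xiOp : (k : ℕ) → ℕ → Matrix (LPow F k).I (LPow F k).I (NH F k)
  | 0, _ => 0
  | k + 1, j => if j = k then tens (LPow F k) (LofE F) 1 (rhoXi F)
      else tens (LPow F k) (LofE F) (xiOp k j) 1

/-- `ρ_k(s_i) = id^{⊗ (i-1)} ⊗ ρ_2(s_1) ⊗ id^{⊗ (k-i-1)}`; strands are numbered from `0`. The summands
of `L_E^{⊗ k} ⊗ (L_E ⊗ L_E)` and of `(L_E^{⊗ k} ⊗ L_E) ⊗ L_E` are identified by the associator. -/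
noncomputable def sOp : (k : ℕ) → ℕ → Matrix (LPow F k).I (LPow F k).I (NH F k)
  | 0, _ => 0
  | 1, _ => 0
  | k + 2, i => if i = k then
      Matrix.of fun b a : ((LPow F k).I × Fin 2) × Fin 2 =>
        tens (LPow F k) ((LofE F).tensor (LofE F)) 1 (rhoS F)
          (Equiv.prodAssoc _ _ _ b) (Equiv.prodAssoc _ _ _ a)
      else tens (LPow F (k + 1)) (LofE F) (sOp (k + 1) i) 1

end Cpx

end QDG

open QDG

/-! An endomorphism of `L_E^{⊗ k}` is a matrix over `NH_k` indexed by the subsets of the `k` tensor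
factors, and the operators that matter are nilHecke elements tensored with integer matrices: `ρ(ξ_j)
= 1 ⊗ raise_j`, `ρ(s_i) = ∂_i ⊗ flip_i`, `D = Σ x_j ⊗ raise_j`. That `ρ_k` respects relations and
differentials thus splits into identities of integer sign matrices and the nilHecke relations.

Why `ρ_k` is an injective quasi-isomorphism: `NH_k` is a free left module over the polynomials in
the dots, with a basis from the nilCoxeter algebra `NC_k` (`ofNH_toNH`, `toNH_ofNH`). So the dots
are a regular sequence for left multiplication (`xN_regular`), and left multiplication by `D` makes
every column of an endomorphism an element of a Koszul complex, exact except at the top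
(`kD_exact`), where the quotient of `NH_k` by the right ideal of the dots is `NC_k`. Keep only the
top row of an endomorphism, with left dots set to zero (`topRow`). The kernel is an acyclic
subcomplex (`exists_endD_of_topRow_eq_zero`), and on `R_k^nil` this map is bijective
(`topRow_rhoAlg_bijective`): `R_k^nil` is spanned by nilCoxeter elements times monomials in the
`ξ_j`, and each such product has, up to sign, its nilCoxeter element as the only entry of the top
row, in the column complementary to the monomial.

Why the cohomology is exterior: let `S = Σ s_i`, `η_0 = ξ_0`, `η_{m+1} = [S, η_m]`. The series `Σ
η_m t^m` is the conjugate of `ξ_0` by the product of the `1 + t s_i`, which makes all `η_m`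
anticommute with `ξ_0` (`xiN_zero_eta`), hence with each other (`eta_anti`), and makes them cocycles
(`d_eta`). For the size of the cohomology, `R_{k+1}^nil` is free over `R_k^nil` on `t_q = s_{k-1} ⋯
s_q` and `u_q = ξ_k t_q`, `0 ≤ q ≤ k`. Since `d t_q = -u_{q+1}` plus later terms, everything cancels
except `t_k = 1` and `u_0`, and `η_k` has coefficient `1` at `u_0`. So the cohomology of
`R_{k+1}^nil` is free over that of `R_k^nil` on `1` and the class of `η_k`, and inductively the
ordered monomials in the `η_m` represent a basis.

Formality: in characteristic different from `2` the anticommuting cocycles `η_m` define a map from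
the exterior algebra to `R_k^nil` that is an isomorphism onto cohomology. Inverting it gives a
quasi-isomorphism from the cohomology algebra to `R_k^nil`, so the zigzag is a single arrow. -/

namespace QDG

/-! ### Integer sign matrices: raising operators, flips and parity on the tensor factors. -/

section SignMatrices

open Kronecker

variable (F : Type u) [Field F]

/-- The index set of the summands of `L_E^{⊗ k}`. -/
abbrev LI (k : ℕ) : Type := (Cpx.LPow F k).I

/-- Square matrices over `R` indexed by the summands of `L_E^{⊗ k}`. -/
abbrev LMat (k : ℕ) (R : Type*) : Type _ := Matrix (LI F k) (LI F k) R

variable {F} {k : ℕ}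

/-- The summand of `L_E^{⊗ (k + 1)}` given by summands of `L_E^{⊗ k}` and of `L_E`. -/
def sn (a : LI F k) (i : Fin 2) : LI F (k + 1) := (a, i)

/-- The component of a summand of `L_E^{⊗ (k + 1)}` in the first `k` tensor factors. -/
def initial (a : LI F (k + 1)) : LI F k := (show LI F k × Fin 2 from a).1

/-- The component of a summand of `L_E^{⊗ (k + 1)}` in the last tensor factor. -/
def final (a : LI F (k + 1)) : Fin 2 := (show LI F k × Fin 2 from a).2

@[simp] theorem initial_sn (a : LI F k) (i : Fin 2) : initial (sn a i) = a := rfl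

@[simp] theorem final_sn (a : LI F k) (i : Fin 2) : final (sn a i) = i := rfl

theorem sn_inj {a b : LI F k} {i j : Fin 2} : sn a i = sn b j ↔ a = b ∧ i = j := Prod.mk_inj

theorem sn_surj (a : LI F (k + 1)) : ∃ b i, a = sn b i := ⟨initial a, final a, rfl⟩

theorem sum_sn {M : Type*} [AddCommMonoid M] (f : LI F (k + 1) → M) :
    ∑ a, f a = ∑ a, (f (sn a 0) + f (sn a 1)) := by
  have h := Fintype.sum_prod_type fun a : LI F k × Fin 2 => f (sn a.1 a.2)
  simp only [Fin.sum_univ_two] at h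
  exact h

/-- Kronecker product with a matrix acting on the last tensor factor. -/
def kr (A : LMat F k ℤ) (B : Matrix (Fin 2) (Fin 2) ℤ) : LMat F (k + 1) ℤ :=
  (A ⊗ₖ B : Matrix (LI F k × Fin 2) (LI F k × Fin 2) ℤ)

/-- Kronecker product with a matrix acting on the last two tensor factors. -/
def kr2 (A : LMat F k ℤ) (B : Matrix (Fin 2 × Fin 2) (Fin 2 × Fin 2) ℤ) : LMat F (k + 2) ℤ :=
  ((A ⊗ₖ B).submatrix (Equiv.prodAssoc _ _ _) (Equiv.prodAssoc _ _ _) :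
    Matrix ((LI F k × Fin 2) × Fin 2) ((LI F k × Fin 2) × Fin 2) ℤ)

theorem kr_apply (A : LMat F k ℤ) (B : Matrix (Fin 2) (Fin 2) ℤ) (b a : LI F k) (j i : Fin 2) :
    kr A B (sn b j) (sn a i) = A b a * B j i := rfl

theorem kr2_apply (A : LMat F k ℤ) (B : Matrix (Fin 2 × Fin 2) (Fin 2 × Fin 2) ℤ) (b a : LI F k)
    (j j' i i' : Fin 2) : kr2 A B (sn (sn b j) j') (sn (sn a i) i') = A b a * B (j, j') (i, i') := rfl

theorem kr_mul (A A' : LMat F k ℤ) (B B' : Matrix (Fin 2) (Fin 2) ℤ) :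
    kr A B * kr A' B' = kr (A * A') (B * B') :=
  (Matrix.mul_kronecker_mul A A' B B').symm

theorem kr2_mul (A A' : LMat F k ℤ) (B B' : Matrix (Fin 2 × Fin 2) (Fin 2 × Fin 2) ℤ) :
    kr2 A B * kr2 A' B' = kr2 (A * A') (B * B') := by
  have h := Matrix.mul_kronecker_mul A A' B B'
  unfold kr2
  rw [h]
  exact Matrix.submatrix_mul_equiv _ _ _ _ _

theorem kr_one : kr (1 : LMat F k ℤ) 1 = 1 :=
  Matrix.one_kronecker_one

theorem kr_kr (A : LMat F k ℤ) (B C : Matrix (Fin 2) (Fin 2) ℤ) :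
    kr (kr A B) C = kr2 A (B ⊗ₖ C) := by
  ext b a
  obtain ⟨b, j', rfl⟩ := sn_surj b
  obtain ⟨b, j, rfl⟩ := sn_surj b
  obtain ⟨a, i', rfl⟩ := sn_surj a
  obtain ⟨a, i, rfl⟩ := sn_surj a
  exact mul_assoc _ _ _

theorem kr_neg_left (A : LMat F k ℤ) (B : Matrix (Fin 2) (Fin 2) ℤ) : kr (-A) B = -kr A B := by
  ext b a
  obtain ⟨b, j, rfl⟩ := sn_surj b
  obtain ⟨a, i, rfl⟩ := sn_surj a
  exact neg_mul _ _

theorem kr_zero_left (B : Matrix (Fin 2) (Fin 2) ℤ) : kr (0 : LMat F k ℤ) B = 0 := by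
  ext b a
  obtain ⟨b, j, rfl⟩ := sn_surj b
  obtain ⟨a, i, rfl⟩ := sn_surj a
  exact zero_mul _

theorem kr_zero_right (A : LMat F k ℤ) : kr A 0 = 0 := by
  ext b a
  obtain ⟨b, j, rfl⟩ := sn_surj b
  obtain ⟨a, i, rfl⟩ := sn_surj a
  exact mul_zero _

variable (F)

/-- The operator `(-1)^deg`. -/
noncomputable def parity (k : ℕ) : LMat F k ℤ :=
  Matrix.diagonal fun a => (((Cpx.LPow F k).deg a).negOnePow : ℤ)

/-- Raising the degree of one tensor factor from `0` to `1`. -/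
def up : Matrix (Fin 2) (Fin 2) ℤ := !![0, 0; 1, 0]

/-- The operator `(-1)^deg` on one tensor factor. -/
def zz : Matrix (Fin 2) (Fin 2) ℤ := !![1, 0; 0, -1]

/-- The flip of two tensor factors with Koszul sign. -/
def koszul : Matrix (Fin 2 × Fin 2) (Fin 2 × Fin 2) ℤ :=
  Matrix.of fun b a => if b = a.swap then (if a = (1, 1) then -1 else 1) else 0

/-- Raising the degree of the `j`-th tensor factor, with Koszul sign. -/
noncomputable def raise : (k : ℕ) → ℕ → LMat F k ℤ
  | 0, _ => 0
  | k + 1, j => if j = k then kr (parity F k) up else kr (raise k j) 1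

/-- The flip of the `i`-th and the next tensor factor, with Koszul sign. -/
noncomputable def flip : (k : ℕ) → ℕ → LMat F k ℤ
  | 0, _ => 0
  | 1, _ => 0
  | k + 2, i => if i = k then kr2 1 koszul else kr (flip (k + 1) i) 1

theorem raise_last (k : ℕ) : raise F (k + 1) k = kr (parity F k) up := by simp [raise]

theorem raise_lt {k j : ℕ} (h : j ≠ k) : raise F (k + 1) j = kr (raise F k j) 1 := by
  simp [raise, h]

theorem flip_last (k : ℕ) : flip F (k + 2) k = kr2 1 koszul := by simp [flip]

theorem flip_lt {k i : ℕ} (h : i ≠ k) : flip F (k + 2) i = kr (flip F (k + 1) i) 1 := by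
  simp [flip, h]

theorem deg_succ (k : ℕ) (a : LI F k) (i : Fin 2) :
    (Cpx.LPow F (k + 1)).deg (sn a i) = (Cpx.LPow F k).deg a + (i : ℕ) := by
  show (Cpx.LPow F k).deg a + (Cpx.LofE F).deg i = _
  fin_cases i <;> rfl

/-- Consequently an integer matrix of cohomological degree `p` is homogeneous of `q`-degree `-2p`,
which is what `rhoGen_mem` needs. -/
theorem shift_eq (k : ℕ) (a : LI F k) : (Cpx.LPow F k).shift a = -2 * (Cpx.LPow F k).deg a := by
  induction k with
  | zero => rfl
  | succ k ih =>
    obtain ⟨a, i, rfl⟩ := sn_surj a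
    rw [deg_succ]
    show (Cpx.LPow F k).shift a + (Cpx.LofE F).shift i = _
    rw [ih]
    fin_cases i
    · show _ + (0 : ℤ) = _
      simp
    · show _ + (-2 : ℤ) = _
      push_cast
      ring

theorem deg_nonneg (k : ℕ) (a : LI F k) : 0 ≤ (Cpx.LPow F k).deg a := by
  induction k with
  | zero => exact le_refl (0 : ℤ)
  | succ k ih =>
    obtain ⟨a, i, rfl⟩ := sn_surj a
    rw [deg_succ]
    have := ih a
    omega

theorem deg_le (k : ℕ) (a : LI F k) : (Cpx.LPow F k).deg a ≤ k := by
  induction k with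
  | zero => exact le_refl (0 : ℤ)
  | succ k ih =>
    obtain ⟨a, i, rfl⟩ := sn_surj a
    rw [deg_succ]
    have := ih a
    have := i.2
    push_cast
    omega

theorem parity_mul_apply (k : ℕ) (M : LMat F k ℤ) (b a : LI F k) :
    (parity F k * M) b a = (((Cpx.LPow F k).deg b).negOnePow : ℤ) * M b a :=
  Matrix.diagonal_mul _ _ _ _

theorem mul_parity_apply (k : ℕ) (M : LMat F k ℤ) (b a : LI F k) :
    (M * parity F k) b a = M b a * (((Cpx.LPow F k).deg a).negOnePow : ℤ) :=
  Matrix.mul_diagonal _ _ _ _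

theorem parity_succ (k : ℕ) : parity F (k + 1) = kr (parity F k) zz := by
  ext b a
  obtain ⟨b, j, rfl⟩ := sn_surj b
  obtain ⟨a, i, rfl⟩ := sn_surj a
  rw [kr_apply]
  by_cases h : b = a
  · subst h
    by_cases h' : j = i
    · subst h'
      simp only [parity, Matrix.diagonal_apply_eq, deg_succ, Int.negOnePow_add]
      fin_cases j <;> simp [zz]
    · have : sn b j ≠ sn b i := fun h => h' (sn_inj.1 h).2
      rw [parity, Matrix.diagonal_apply_ne _ this]
      fin_cases j <;> fin_cases i <;> simp_all [zz]
  · have : sn b j ≠ sn a i := fun h' => h (sn_inj.1 h').1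
    rw [parity, Matrix.diagonal_apply_ne _ this, parity, Matrix.diagonal_apply_ne _ h, zero_mul]

theorem parity_mul_parity (k : ℕ) : parity F k * parity F k = 1 := by
  rw [parity, Matrix.diagonal_mul_diagonal, ← Matrix.diagonal_one]
  congr 1
  funext a
  rw [← Units.val_mul, Int.units_mul_self, Units.val_one]

theorem raise_homog (k j : ℕ) (b a : LI F k)
    (h : (Cpx.LPow F k).deg b ≠ (Cpx.LPow F k).deg a + 1) : raise F k j b a = 0 := by
  induction k with
  | zero => rfl
  | succ k ih =>
    obtain ⟨b, j', rfl⟩ := sn_surj b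
    obtain ⟨a, i', rfl⟩ := sn_surj a
    rw [deg_succ, deg_succ] at h
    by_cases hj : j = k
    · subst hj
      rw [raise_last, kr_apply]
      by_cases hab : b = a
      · subst hab
        fin_cases j' <;> fin_cases i' <;> simp_all [up]
      · rw [parity, Matrix.diagonal_apply_ne _ hab, zero_mul]
    · rw [raise_lt _ hj, kr_apply]
      by_cases hij : j' = i'
      · subst hij
        rw [ih _ _ (fun h' => h (by rw [h']; ring)), zero_mul]
      · rw [Matrix.one_apply_ne hij, mul_zero]

theorem flip_homog (k i : ℕ) (b a : LI F k)
    (h : (Cpx.LPow F k).deg b ≠ (Cpx.LPow F k).deg a) : flip F k i b a = 0 := by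
  induction k with
  | zero => rfl
  | succ k ih =>
    cases k with
    | zero => rfl
    | succ k =>
      by_cases hi : i = k
      · subst hi
        obtain ⟨b, j', rfl⟩ := sn_surj b
        obtain ⟨b, j, rfl⟩ := sn_surj b
        obtain ⟨a, i', rfl⟩ := sn_surj a
        obtain ⟨a, i, rfl⟩ := sn_surj a
        rw [flip_last, kr2_apply]
        by_cases hab : b = a
        · subst hab
          rw [deg_succ, deg_succ, deg_succ, deg_succ] at h
          fin_cases j <;> fin_cases i <;> fin_cases j' <;> fin_cases i' <;> simp_all [koszul]
        · rw [Matrix.one_apply_ne hab, zero_mul]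
      · obtain ⟨b, j, rfl⟩ := sn_surj b
        obtain ⟨a, i', rfl⟩ := sn_surj a
        rw [deg_succ, deg_succ] at h
        rw [flip_lt _ hi, kr_apply]
        by_cases hij : j = i'
        · subst hij
          rw [ih _ _ (fun h' => h (by rw [h'])), zero_mul]
        · rw [Matrix.one_apply_ne hij, mul_zero]

theorem parity_raise (k j : ℕ) : parity F k * raise F k j = -(raise F k j * parity F k) := by
  ext b a
  rw [Matrix.neg_apply, parity_mul_apply, mul_parity_apply]
  by_cases h : (Cpx.LPow F k).deg b = (Cpx.LPow F k).deg a + 1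
  · rw [h, Int.negOnePow_succ, Units.val_neg]
    ring
  · rw [raise_homog F k j b a h]
    ring

theorem parity_flip (k i : ℕ) : parity F k * flip F k i = flip F k i * parity F k := by
  ext b a
  rw [parity_mul_apply, mul_parity_apply]
  by_cases h : (Cpx.LPow F k).deg b = (Cpx.LPow F k).deg a
  · rw [h]
    ring
  · rw [flip_homog F k i b a h]
    ring

/-- Raising a factor puts the parity operator on all earlier factors, and parity anticommutes with
every operator of degree `1`; raising the same factor twice gives zero. -/
theorem raise_anti (k j j' : ℕ) : raise F k j * raise F k j' = -(raise F k j' * raise F k j) := by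
  induction k with
  | zero => ext b a; simp [raise]
  | succ k ih =>
    by_cases h : j = k <;> by_cases h' : j' = k
    · subst h h'
      rw [raise_last, kr_mul, parity_mul_parity, show up * up = 0 by decide, kr_zero_right, neg_zero]
    · subst h
      rw [raise_last, raise_lt _ h', kr_mul, kr_mul, mul_one, one_mul, parity_raise, kr_neg_left]
    · subst h'
      rw [raise_last, raise_lt _ h, kr_mul, kr_mul, mul_one, one_mul, parity_raise, kr_neg_left,
        neg_neg]
    · rw [raise_lt _ h, raise_lt _ h', kr_mul, kr_mul, ih, kr_neg_left]

/-- The signs live over `ℤ`, where an entry equal to its own negative vanishes, so the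
characteristic of `F` plays no role. -/
theorem raise_sq (k j : ℕ) : raise F k j * raise F k j = 0 := by
  have h := raise_anti F k j j
  ext b a
  have := congrFun (congrFun h b) a
  rw [Matrix.neg_apply] at this
  rw [Matrix.zero_apply]
  omega

/-- When the flip is on the last two factors, the two exchange rules are identities of `4 × 4`
integer matrices. For an earlier flip, raising the last factor only sees parity, which commutes with
flips. -/
theorem raise_flip (k i : ℕ) (hi : i + 1 < k) : raise F k i * flip F k i = flip F k i * raise F k (i + 1) ∧
    raise F k (i + 1) * flip F k i = flip F k i * raise F k i ∧
    ∀ j, j ≠ i → j ≠ i + 1 → raise F k j * flip F k i = flip F k i * raise F k j := by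
  induction k with
  | zero => omega
  | succ k ih =>
    obtain ⟨k, rfl⟩ : ∃ k', k = k' + 1 := ⟨k - 1, by omega⟩
    by_cases h : i = k
    · subst h
      have e1 : raise F (i + 2) i = kr2 (parity F i) (up ⊗ₖ 1) := by
        rw [raise_lt F (by omega : i ≠ i + 1), raise_last, kr_kr]
      have e2 : raise F (i + 2) (i + 1) = kr2 (parity F i) (zz ⊗ₖ up) := by
        rw [raise_last, parity_succ, kr_kr]
      refine ⟨?_, ?_, fun j h1 h2 => ?_⟩
      · rw [e1, e2, flip_last, kr2_mul, kr2_mul, one_mul, mul_one]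
        exact congrArg _ (by decide)
      · rw [e1, e2, flip_last, kr2_mul, kr2_mul, one_mul, mul_one]
        exact congrArg _ (by decide)
      · have e3 : raise F (i + 2) j = kr2 (raise F i j) 1 := by
          rw [raise_lt F h2, raise_lt F h1, kr_kr, Matrix.one_kronecker_one]
        rw [e3, flip_last, kr2_mul, kr2_mul, one_mul, mul_one, one_mul, mul_one]
    · obtain ⟨h1, h2, h3⟩ := ih (by omega)
      rw [flip_lt _ h]
      refine ⟨?_, ?_, fun j hj hj' => ?_⟩
      · rw [raise_lt F (by omega : i ≠ k + 1), raise_lt F (by omega : i + 1 ≠ k + 1), kr_mul, kr_mul,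
          h1]
      · rw [raise_lt F (by omega : i ≠ k + 1), raise_lt F (by omega : i + 1 ≠ k + 1), kr_mul, kr_mul,
          h2]
      · by_cases hjk : j = k + 1
        · subst hjk
          rw [raise_last, kr_mul, kr_mul, parity_flip, mul_one, one_mul]
        · rw [raise_lt F hjk, kr_mul, kr_mul, h3 j hj hj']

/-- The summand of top degree. -/
def top : (k : ℕ) → LI F k
  | 0 => ()
  | k + 1 => sn (top k) 1

theorem deg_top (k : ℕ) : (Cpx.LPow F k).deg (top F k) = k := by
  induction k with
  | zero => rfl
  | succ k ih =>
    show (Cpx.LPow F (k + 1)).deg (sn (top F k) 1) = _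
    rw [deg_succ, ih]
    simp

/-- In the top summand both flipped factors have degree `1`, so the flip fixes it and only the
Koszul sign remains. -/
theorem flip_top (k i : ℕ) (hi : i + 1 < k) (b : LI F k) :
    flip F k i (top F k) b = -(1 : LMat F k ℤ) (top F k) b := by
  induction k with
  | zero => omega
  | succ k ih =>
    obtain ⟨k, rfl⟩ : ∃ k', k = k' + 1 := ⟨k - 1, by omega⟩
    by_cases h : i = k
    · subst h
      obtain ⟨b, j', rfl⟩ := sn_surj b
      obtain ⟨b, j, rfl⟩ := sn_surj b
      have e : (1 : LMat F (i + 2) ℤ) = kr2 1 1 := by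
        rw [← Matrix.one_kronecker_one, ← kr_kr, kr_one, kr_one]
      rw [flip_last, e]
      show kr2 1 koszul (sn (sn (top F i) 1) 1) _ = -kr2 1 1 (sn (sn (top F i) 1) 1) _
      rw [kr2_apply, kr2_apply, ← mul_neg]
      have hk : ∀ j j' : Fin 2, koszul (1, 1) (j, j') =
          -(1 : Matrix (Fin 2 × Fin 2) (Fin 2 × Fin 2) ℤ) (1, 1) (j, j') := by decide
      rw [hk]
    · obtain ⟨b, j, rfl⟩ := sn_surj b
      rw [flip_lt _ h]
      show kr (flip F (k + 1) i) 1 (sn (top F (k + 1)) 1) _ = -_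
      have e : (1 : LMat F (k + 1 + 1) ℤ) = kr 1 1 := kr_one.symm
      rw [kr_apply, ih (by omega), e]
      exact neg_mul _ _

end SignMatrices

/-! ### Ordered monomials in anticommuting elements. -/

section Monomials

variable (F : Type u) [Field F] {A : Type*} [Ring A]

/-- The ordered product of the elements `e j`, `j < k`, with `j` in the subset of `{0, …, k - 1}` that
corresponds to a summand of `L_E^{⊗ k}`. -/
noncomputable def mono (e : ℕ → A) : (k : ℕ) → LI F k → A
  | 0, _ => 1
  | k + 1, S => mono e k (initial S) * if final S = 1 then e k else 1

theorem fin2_cases (ε : Fin 2) : ε = 0 ∨ ε = 1 := by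
  revert ε
  decide

theorem mono_zero (e : ℕ → A) (S : LI F 0) : mono F e 0 S = 1 := rfl

theorem mono_succ_zero (e : ℕ → A) (k : ℕ) (S : LI F k) :
    mono F e (k + 1) (sn S 0) = mono F e k S :=
  mul_one _

theorem mono_succ_one (e : ℕ → A) (k : ℕ) (S : LI F k) :
    mono F e (k + 1) (sn S 1) = mono F e k S * e k := rfl

theorem map_mono {B : Type*} [Ring B] (f : A →+* B) (e : ℕ → A) (k : ℕ) (S : LI F k) :
    f (mono F e k S) = mono F (fun j => f (e j)) k S := by
  induction k with
  | zero => exact map_one f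
  | succ k ih =>
    obtain ⟨S, ε, rfl⟩ := sn_surj S
    rcases fin2_cases ε with rfl | rfl
    · rw [mono_succ_zero, mono_succ_zero, ih]
    · rw [mono_succ_one, mono_succ_one, map_mul, ih]

theorem mono_congr (e e' : ℕ → A) (k : ℕ) (h : ∀ j < k, e j = e' j) (S : LI F k) :
    mono F e k S = mono F e' k S := by
  induction k with
  | zero => rfl
  | succ k ih =>
    obtain ⟨S, ε, rfl⟩ := sn_surj S
    have h1 := ih (fun j hj => h j (by omega)) S
    rcases fin2_cases ε with rfl | rfl
    · rw [mono_succ_zero, mono_succ_zero, h1]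
    · rw [mono_succ_one, mono_succ_one, h1, h k (by omega)]

/-- An element that anticommutes with the factors commutes with a monomial up to sign. -/
theorem mul_mono_sign (e : ℕ → A) (x : A) (k : ℕ) (h : ∀ j < k, x * e j = -(e j * x)) (S : LI F k) :
    ∃ u : ℤˣ, x * mono F e k S = u • (mono F e k S * x) := by
  induction k with
  | zero => exact ⟨1, by rw [mono_zero, mul_one, one_mul, one_smul]⟩
  | succ k ih =>
    obtain ⟨S, ε, rfl⟩ := sn_surj S
    obtain ⟨u, hu⟩ := ih (fun j hj => h j (by omega)) S
    rcases fin2_cases ε with rfl | rfl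
    · exact ⟨u, by
        show x * mono F e (k + 1) (sn S 0) = u • (mono F e (k + 1) (sn S 0) * x)
        rw [mono_succ_zero, hu]⟩
    · refine ⟨-u, ?_⟩
      show x * mono F e (k + 1) (sn S 1) = -u • (mono F e (k + 1) (sn S 1) * x)
      rw [mono_succ_one, ← mul_assoc, hu, smul_mul_assoc, mul_assoc, h k (by omega), Units.neg_smul,
        mul_neg, smul_neg, mul_assoc]

variable [Algebra F A]

/-- The span of the ordered monomials in anticommuting elements of square zero is closed under left
multiplication by them. -/
theorem mul_mono_mem (e : ℕ → A) (k : ℕ) (hsq : ∀ j < k, e j * e j = 0)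
    (h : ∀ i < k, ∀ j < k, i ≠ j → e i * e j = -(e j * e i)) (j : ℕ) (hj : j < k) (S : LI F k) :
    e j * mono F e k S ∈ Submodule.span F (Set.range (mono F e k)) := by
  induction k with
  | zero => omega
  | succ k ih =>
    obtain ⟨S, ε, rfl⟩ := sn_surj S
    have hle : ∀ x ∈ Submodule.span F (Set.range (mono F e k)),
        x ∈ Submodule.span F (Set.range (mono F e (k + 1))) ∧
        x * e k ∈ Submodule.span F (Set.range (mono F e (k + 1))) := by
      intro x hx
      induction hx using Submodule.span_induction with
      | mem x hx =>
        obtain ⟨T, rfl⟩ := hx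
        exact ⟨Submodule.subset_span ⟨(sn T 0), mono_succ_zero F e k T⟩,
          Submodule.subset_span ⟨(sn T 1), mono_succ_one F e k T⟩⟩
      | zero => simp
      | add x y _ _ hx hy => rw [add_mul]; exact ⟨add_mem hx.1 hy.1, add_mem hx.2 hy.2⟩
      | smul c x _ hx =>
        rw [smul_mul_assoc]
        exact ⟨Submodule.smul_mem _ c hx.1, Submodule.smul_mem _ c hx.2⟩
    by_cases hjk : j = k
    · subst hjk
      obtain ⟨u, hu⟩ := mul_mono_sign F e (e j) j (fun i hi => h j hj i (by omega) (by omega)) S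
      rcases fin2_cases ε with rfl | rfl
      · show e j * mono F e (j + 1) (sn S 0) ∈ _
        rw [mono_succ_zero, hu, Units.smul_def]
        exact zsmul_mem (hle _ (Submodule.subset_span ⟨S, rfl⟩)).2 _
      · show e j * mono F e (j + 1) (sn S 1) ∈ _
        rw [mono_succ_one, ← mul_assoc, hu, smul_mul_assoc, mul_assoc, hsq j hj, mul_zero, smul_zero]
        exact zero_mem _
    · have h1 := ih (fun i hi => hsq i (by omega))
        (fun a ha b hb => h a (by omega) b (by omega)) (by omega) S
      rcases fin2_cases ε with rfl | rfl
      · show e j * mono F e (k + 1) (sn S 0) ∈ _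
        rw [mono_succ_zero]
        exact (hle _ h1).1
      · show e j * mono F e (k + 1) (sn S 1) ∈ _
        rw [mono_succ_one, ← mul_assoc]
        exact (hle _ h1).2

theorem one_mem_span_mono (e : ℕ → A) (k : ℕ) :
    (1 : A) ∈ Submodule.span F (Set.range (mono F e k)) := by
  suffices ∃ S, mono F e k S = 1 by
    obtain ⟨S, hS⟩ := this
    exact Submodule.subset_span ⟨S, hS⟩
  induction k with
  | zero => exact ⟨(), rfl⟩
  | succ k ih =>
    obtain ⟨S, hS⟩ := ih
    exact ⟨(sn S 0), (mono_succ_zero F e k S).trans hS⟩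

end Monomials

theorem mono_mul_comm (F : Type u) [Field F] {A : Type*} [Ring A] (e e' : ℕ → A) (x : A) (k : ℕ)
    (h : ∀ j < k, e j * x = x * e' j) (S : LI F k) :
    mono F e k S * x = x * mono F e' k S := by
  induction k with
  | zero => rw [mono_zero, mono_zero, mul_one, one_mul]
  | succ k ih =>
    obtain ⟨S, ε, rfl⟩ := sn_surj S
    have h1 := ih (fun j hj => h j (by omega)) S
    rcases fin2_cases ε with rfl | rfl
    · rw [mono_succ_zero, mono_succ_zero, h1]
    · rw [mono_succ_one, mono_succ_one, mul_assoc, h k (by omega), ← mul_assoc, h1, mul_assoc]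

/-! ### Matrices determined by their top row; braid relations of the flips. -/

section TopRow

variable (F : Type u) [Field F]

/-- The complementary subset. -/
def compl : (k : ℕ) → LI F k → LI F k
  | 0, S => S
  | k + 1, S => sn (compl k (initial S)) (1 - final S)

theorem compl_sn (k : ℕ) (S : LI F k) (ε : Fin 2) :
    compl F (k + 1) (sn S ε) = sn (compl F k S) (1 - ε) := rfl

theorem compl_compl (k : ℕ) (S : LI F k) : compl F k (compl F k S) = S := by
  induction k with
  | zero => rfl
  | succ k ih =>
    obtain ⟨S, ε, rfl⟩ := sn_surj S
    rw [compl_sn, compl_sn, ih, sub_sub_cancel]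

/-- `A ↦ A ⊗ 1` as a ring homomorphism. -/
def krHom (k : ℕ) : LMat F k ℤ →+* LMat F (k + 1) ℤ where
  toFun A := kr A 1
  map_one' := kr_one
  map_mul' A B := by rw [kr_mul, mul_one]
  map_zero' := kr_zero_left _
  map_add' A B := by
    ext b a
    obtain ⟨b, j, rfl⟩ := sn_surj b
    obtain ⟨a, i, rfl⟩ := sn_surj a
    exact add_mul _ _ _

/-- Raising the factors in `S` reaches the top summand only from the summand whose factors of degree
`1` are those outside `S`; the unit records the Koszul signs. -/
theorem mono_raise_top (k : ℕ) (S : LI F k) : ∃ u : ℤˣ, ∀ b,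
    mono F (raise F k) k S (top F k) b = if b = compl F k S then (u : ℤ) else 0 := by
  induction k with
  | zero => exact ⟨1, fun b => rfl⟩
  | succ k ih =>
    obtain ⟨S, ε, rfl⟩ := sn_surj S
    obtain ⟨u, hu⟩ := ih S
    have e : mono F (raise F (k + 1)) k S = kr (mono F (raise F k) k S) 1 := by
      rw [mono_congr F (raise F (k + 1)) (fun j => krHom F k (raise F k j)) k
        (fun j hj => raise_lt F (by omega)) S, ← map_mono]
      rfl
    rcases fin2_cases ε with rfl | rfl
    · refine ⟨u, fun b => ?_⟩
      obtain ⟨b, j, rfl⟩ := sn_surj b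
      rw [mono_succ_zero, e, compl_sn]
      show kr _ 1 (sn (top F k) 1) (sn b j) = _
      rw [kr_apply, hu]
      simp only [sn_inj]
      by_cases h : b = compl F k S <;> rcases fin2_cases j with rfl | rfl <;> simp [h]
    · refine ⟨u * ((Cpx.LPow F k).deg (compl F k S)).negOnePow, fun b => ?_⟩
      obtain ⟨b, j, rfl⟩ := sn_surj b
      rw [mono_succ_one, e, compl_sn, raise_last, kr_mul, one_mul]
      show kr _ up (sn (top F k) 1) (sn b j) = _
      rw [kr_apply, mul_parity_apply, hu]
      simp only [sn_inj]
      by_cases h : b = compl F k S <;> rcases fin2_cases j with rfl | rfl <;> simp [h, up]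

/-- A matrix is determined by its top row and the way it commutes with the raising operators. -/
theorem eq_of_top_row (k : ℕ) (M N : LMat F k ℤ) (σ : ℕ → ℕ)
    (hM : ∀ j < k, raise F k j * M = M * raise F k (σ j))
    (hN : ∀ j < k, raise F k j * N = N * raise F k (σ j))
    (h : ∀ b, M (top F k) b = N (top F k) b) : M = N := by
  -- Left multiplication by a monomial in the raising operators brings any chosen row of `P` to the
  -- top, up to sign.
  have key : ∀ (P : LMat F k ℤ) (S : LI F k) (u : ℤˣ), (∀ b,
      mono F (raise F k) k S (top F k) b = if b = compl F k S then (u : ℤ) else 0) → ∀ b,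
      (mono F (raise F k) k S * P) (top F k) b = u * P (compl F k S) b := by
    intro P S u hu b
    rw [Matrix.mul_apply, Finset.sum_eq_single (compl F k S)]
    · rw [hu, if_pos rfl]
    · intro c _ hc
      rw [hu, if_neg hc, zero_mul]
    · intro h
      exact absurd (Finset.mem_univ _) h
  ext S b
  obtain ⟨u, hu⟩ := mono_raise_top F k (compl F k S)
  have h1 := key M _ u hu b
  have h2 := key N _ u hu b
  -- Moved to the right of the matrix, the monomial acts on its top row; so corresponding rows of
  -- `M` and `N` are computed from equal top rows.
  rw [mono_mul_comm F _ _ M k hM, Matrix.mul_apply] at h1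
  rw [mono_mul_comm F _ _ N k hN, Matrix.mul_apply] at h2
  simp only [h] at h1
  rw [h1] at h2
  rw [compl_compl] at h2
  exact mul_left_cancel₀ u.ne_zero h2

/-- The transposition of `i` and `i + 1`. -/
def tr (i j : ℕ) : ℕ := if j = i then i + 1 else if j = i + 1 then i else j

theorem raise_flip_tr (k i : ℕ) (hi : i + 1 < k) (j : ℕ) :
    raise F k j * flip F k i = flip F k i * raise F k (tr i j) := by
  obtain ⟨h1, h2, h3⟩ := raise_flip F k i hi
  unfold tr
  split_ifs with h h'
  · rw [h, h1]
  · rw [h', h2]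
  · exact h3 j h h'

theorem mul_flip_top (k i : ℕ) (hi : i + 1 < k) (M : LMat F k ℤ) (c : ℤ)
    (hM : ∀ b, M (top F k) b = c * (1 : LMat F k ℤ) (top F k) b) (b : LI F k) :
    (M * flip F k i) (top F k) b = -c * (1 : LMat F k ℤ) (top F k) b := by
  simp only [Matrix.mul_apply, hM, mul_assoc, ← Finset.mul_sum]
  have h : (1 * flip F k i) (top F k) b = flip F k i (top F k) b := by rw [one_mul]
  rw [Matrix.mul_apply] at h
  rw [h, flip_top F k i hi]
  ring

theorem flip_top' (k i : ℕ) (hi : i + 1 < k) (b : LI F k) :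
    flip F k i (top F k) b = -1 * (1 : LMat F k ℤ) (top F k) b := by
  rw [flip_top F k i hi, neg_one_mul]

/-- Both sides permute the raising operators in the same way and multiply the top row by `(-1)^3`,
so `eq_of_top_row` applies and no larger matrix has to be computed. -/
theorem flip_braid (k i : ℕ) (h : i + 1 + 1 < k) :
    flip F k i * flip F k (i + 1) * flip F k i = flip F k (i + 1) * flip F k i * flip F k (i + 1) := by
  refine eq_of_top_row F k _ _ (fun j => tr i (tr (i + 1) (tr i j))) ?_ ?_ ?_
  · intro j _
    rw [← mul_assoc, ← mul_assoc, raise_flip_tr F k i (by omega), mul_assoc (flip F k i),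
      raise_flip_tr F k (i + 1) h, ← mul_assoc, mul_assoc _ _ (flip F k i),
      raise_flip_tr F k i (by omega), ← mul_assoc]
  · intro j _
    rw [← mul_assoc, ← mul_assoc, raise_flip_tr F k (i + 1) h, mul_assoc (flip F k (i + 1)),
      raise_flip_tr F k i (by omega), ← mul_assoc, mul_assoc _ _ (flip F k (i + 1)),
      raise_flip_tr F k (i + 1) h, ← mul_assoc]
    congr 2
    unfold tr
    split_ifs <;> omega
  · intro b
    rw [mul_flip_top F k i (by omega) _ _ (mul_flip_top F k (i + 1) h _ _
      (flip_top' F k i (by omega))), mul_flip_top F k (i + 1) h _ _ (mul_flip_top F k i (by omega) _ _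
      (flip_top' F k (i + 1) h))]

theorem flip_far (k i i' : ℕ) (h : i + 1 < k) (h' : i' + 1 < k) (hii : i + 1 < i') :
    flip F k i * flip F k i' = flip F k i' * flip F k i := by
  refine eq_of_top_row F k _ _ (fun j => tr i' (tr i j)) ?_ ?_ ?_
  · intro j _
    rw [← mul_assoc, raise_flip_tr F k i h, mul_assoc, raise_flip_tr F k i' h', ← mul_assoc]
  · intro j _
    rw [← mul_assoc, raise_flip_tr F k i' h', mul_assoc, raise_flip_tr F k i h, ← mul_assoc]
    congr 2
    unfold tr
    split_ifs <;> omega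
  · intro b
    rw [mul_flip_top F k i' h' _ _ (flip_top' F k i h), mul_flip_top F k i h _ _ (flip_top' F k i' h')]

end TopRow

/-! ### Operators on `L_E^{⊗ k}` as nilHecke elements tensored with integer matrices. -/

section Em

variable {F : Type u} [Field F] {k : ℕ}

/-- The tensor product of an element of the nilHecke algebra with an integer matrix. -/
noncomputable def em (x : NH F k) (M : LMat F k ℤ) : LMat F k (NH F k) := M.map fun z => z • x

theorem em_apply (x : NH F k) (M : LMat F k ℤ) (b a : LI F k) : em x M b a = M b a • x := rfl

theorem em_mul (x y : NH F k) (M N : LMat F k ℤ) : em x M * em y N = em (x * y) (M * N) := by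
  ext b a
  rw [Matrix.mul_apply, em_apply, Matrix.mul_apply, Finset.sum_smul]
  refine Finset.sum_congr rfl fun c _ => ?_
  rw [em_apply, em_apply, smul_mul_smul_comm]

theorem em_one : em (1 : NH F k) 1 = 1 := by
  ext b a
  rw [em_apply]
  by_cases h : b = a
  · rw [h, Matrix.one_apply_eq, Matrix.one_apply_eq, one_smul]
  · rw [Matrix.one_apply_ne h, Matrix.one_apply_ne h, zero_smul]

theorem em_neg_right (x : NH F k) (M : LMat F k ℤ) : em x (-M) = -em x M := by
  ext b a
  exact neg_smul (M b a) x

theorem em_zero_right (x : NH F k) : em x (0 : LMat F k ℤ) = 0 := by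
  ext b a
  exact zero_smul ℤ x

theorem em_zero_left (M : LMat F k ℤ) : em (0 : NH F k) M = 0 := by
  ext b a
  exact smul_zero (M b a)

theorem em_sub_left (x y : NH F k) (M : LMat F k ℤ) : em (x - y) M = em x M - em y M := by
  ext b a
  exact smul_sub (M b a) x y

theorem em_neg_left (x : NH F k) (M : LMat F k ℤ) : em (-x) M = -em x M := by
  ext b a
  exact smul_neg (M b a) x

variable (F) (k)

/-- The dots of the nilHecke algebra, indexed by natural numbers. -/
noncomputable def xN (j : ℕ) : NH F k := if h : j < k then NH.x F ⟨j, h⟩ else 0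

theorem xN_of_lt (j : ℕ) (h : j < k) : xN F k j = NH.x F ⟨j, h⟩ := dif_pos h

theorem inl_del (i : ℕ) (h : i + 1 < k) : NH.inl F k 1 (NH.del F i h) = NH.del F i (by omega) := by
  rw [NH.del, NH.inl, Pres.lift_gen]

theorem inl_x (j : ℕ) (h : j < k) : NH.inl F k 1 (NH.x F ⟨j, h⟩) = NH.x F ⟨j, by omega⟩ := by
  rw [NH.x, NH.inl, Pres.lift_gen]

theorem inl_xN (j : ℕ) (h : j < k) : NH.inl F k 1 (xN F k j) = xN F (k + 1) j := by
  rw [xN_of_lt F k j h, inl_x, xN_of_lt]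

theorem inr_x : NH.inr F k 1 (NH.x F 0) = xN F (k + 1) k := by
  rw [NH.x, NH.inr, Pres.lift_gen, xN_of_lt F (k + 1) k (by omega)]
  rfl

theorem inr_del : NH.inr F k 2 (NH.del F 0 (by omega)) = NH.del F k (by omega) := by
  rw [NH.del, NH.inr, Pres.lift_gen]
  rfl

theorem tens_left (x : NH F k) (M : LMat F k ℤ) :
    Cpx.tens (Cpx.LPow F k) (Cpx.LofE F) (em x M) 1 = (em (NH.inl F k 1 x) (kr M 1) : LMat F (k + 1) _) := by
  ext b a
  obtain ⟨b, j, rfl⟩ := sn_surj b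
  obtain ⟨a, i, rfl⟩ := sn_surj a
  rw [em_apply, kr_apply]
  show (((Cpx.LofE F).deg j - (Cpx.LofE F).deg i) * (Cpx.LPow F k).deg a).negOnePow •
    (NH.inl F k 1 (em x M b a) * NH.inr F k 1 ((1 : Matrix (Fin 2) (Fin 2) (NH F 1)) j i)) = _
  rw [em_apply]
  by_cases h : j = i
  · rw [h, Matrix.one_apply_eq, Matrix.one_apply_eq, map_one, mul_one, mul_one, sub_self, zero_mul,
      Int.negOnePow_zero, one_smul, map_zsmul]
  · rw [Matrix.one_apply_ne h, Matrix.one_apply_ne h, map_zero, mul_zero, mul_zero, smul_zero, zero_smul]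

/-- An operator of degree `1` on the last factor picks up the Koszul sign `(-1)^deg` from the
earlier factors; this is the source of `parity` in `raise`. -/
theorem tens_right (y : NH F 1) :
    Cpx.tens (Cpx.LPow F k) (Cpx.LofE F) 1 (!![0, 0; y, 0] : Matrix (Fin 2) (Fin 2) (NH F 1)) =
      (em (NH.inr F k 1 y) (kr (parity F k) up) : LMat F (k + 1) _) := by
  ext b a
  obtain ⟨b, j, rfl⟩ := sn_surj b
  obtain ⟨a, i, rfl⟩ := sn_surj a
  rw [em_apply, kr_apply]
  show (((Cpx.LofE F).deg j - (Cpx.LofE F).deg i) * (Cpx.LPow F k).deg a).negOnePow •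
    (NH.inl F k 1 ((1 : LMat F k (NH F k)) b a) *
      NH.inr F k 1 ((!![0, 0; y, 0] : Matrix (Fin 2) (Fin 2) (NH F 1)) j i)) = _
  by_cases h : b = a
  · subst h
    rw [Matrix.one_apply_eq, parity, Matrix.diagonal_apply_eq, map_one, one_mul, Units.smul_def]
    rcases fin2_cases j with rfl | rfl <;> rcases fin2_cases i with rfl | rfl <;> simp [up]
  · rw [Matrix.one_apply_ne h, parity, Matrix.diagonal_apply_ne _ h, map_zero, zero_mul, zero_mul,
      smul_zero, zero_smul]

theorem tens_right_two :
    (Matrix.of fun b a : ((Cpx.LPow F k).I × Fin 2) × Fin 2 =>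
        Cpx.tens (Cpx.LPow F k) ((Cpx.LofE F).tensor (Cpx.LofE F)) 1 (Cpx.rhoS F)
          (Equiv.prodAssoc _ _ _ b) (Equiv.prodAssoc _ _ _ a)) =
      (em (NH.del F k (by omega)) (kr2 1 koszul) : LMat F (k + 2) _) := by
  ext b a
  obtain ⟨b, j', rfl⟩ := sn_surj (k := k + 1) b
  obtain ⟨b, j, rfl⟩ := sn_surj b
  obtain ⟨a, i', rfl⟩ := sn_surj (k := k + 1) a
  obtain ⟨a, i, rfl⟩ := sn_surj a
  rw [em_apply, kr2_apply]
  show (((![0, 1] j + ![0, 1] j') - (![0, 1] i + ![0, 1] i') : ℤ) * (Cpx.LPow F k).deg a).negOnePow •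
    (NH.inl F k 2 ((1 : LMat F k (NH F k)) b a) *
      NH.inr F k 2 (if (j, j') = (i, i').swap then
    ((![0, 1] i * ![0, 1] i' : ℤ)).negOnePow • NH.del F 0 (by omega) else 0)) = _
  by_cases h : b = a
  · subst h
    rw [Matrix.one_apply_eq, Matrix.one_apply_eq, map_one, one_mul, one_mul, koszul, Matrix.of_apply]
    by_cases h' : (j, j') = (i, i').swap
    · rw [if_pos h', if_pos h', map_units_smul, inr_del]
      obtain ⟨rfl, rfl⟩ := Prod.mk_inj.1 h'
      -- The flip preserves the total degree of its two factors, so it passes the first `k` factors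
      -- without a Koszul sign.
      rw [show ((![0, 1] j + ![0, 1] j') - (![0, 1] j' + ![0, 1] j) : ℤ) = 0 by ring, zero_mul,
        Int.negOnePow_zero, one_smul]
      rcases fin2_cases j with rfl | rfl <;> rcases fin2_cases j' with rfl | rfl <;> simp
    · rw [if_neg h', if_neg h', map_zero, smul_zero, zero_smul]
  · rw [Matrix.one_apply_ne h, Matrix.one_apply_ne h, map_zero, zero_mul, zero_mul, smul_zero, zero_smul]

theorem xiOp_eq (j : ℕ) : Cpx.xiOp F k j = em 1 (raise F k j) := by
  induction k with
  | zero => exact (em_zero_right 1).symm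
  | succ k ih =>
    by_cases h : j = k
    · subst h
      have := tens_right F j 1
      rw [map_one, ← raise_last] at this
      exact (if_pos rfl).trans this
    · have := tens_left F k 1 (raise F k j)
      rw [map_one, ← ih, ← raise_lt F h] at this
      exact (if_neg h).trans this

theorem sOp_eq (i : ℕ) (h : i + 1 < k) : Cpx.sOp F k i = em (NH.del F i h) (flip F k i) := by
  induction k with
  | zero => omega
  | succ k ih =>
    obtain ⟨k, rfl⟩ : ∃ k', k = k' + 1 := ⟨k - 1, by omega⟩
    by_cases hi : i = k
    · subst hi
      have := tens_right_two F i
      rw [← flip_last] at this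
      exact (if_pos rfl).trans this
    · have := tens_left F (k + 1) (NH.del F i (by omega)) (flip F (k + 1) i)
      rw [inl_del, ← ih (by omega), ← flip_lt F hi] at this
      exact (if_neg hi).trans this

/-- The operator `f ↦ f ⊗ 1`. -/
noncomputable def tensOne : LMat F k (NH F k) →+ LMat F (k + 1) (NH F (k + 1)) :=
  AddMonoidHom.mk' (fun f => Cpx.tens (Cpx.LPow F k) (Cpx.LofE F) f 1) (by
    intro f g
    ext b a
    obtain ⟨b, j, rfl⟩ := sn_surj b
    obtain ⟨a, i, rfl⟩ := sn_surj a
    show (_ : ℤˣ) • (NH.inl F k 1 (f b a + g b a) * _) =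
      (_ : ℤˣ) • (NH.inl F k 1 (f b a) * _) + (_ : ℤˣ) • (NH.inl F k 1 (g b a) * _)
    rw [map_add, add_mul, smul_add]
    rfl)

theorem tensOne_em (x : NH F k) (M : LMat F k ℤ) :
    tensOne F k (em x M) = em (NH.inl F k 1 x) (kr M 1) :=
  tens_left F k x M

/-- All Koszul signs of the tensor differential are absorbed in `raise`. In this form left
multiplication by `D` is the Koszul differential for the dots. -/
theorem D_eq : (Cpx.LPow F k).D = ∑ j ∈ Finset.range k, em (xN F k j) (raise F k j) := by
  induction k with
  | zero => rfl
  | succ k ih =>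
    have h1 : (Cpx.LPow F (k + 1)).D = tensOne F k (Cpx.LPow F k).D +
      @id (LMat F (k + 1) (NH F (k + 1)))
        (Cpx.tens (Cpx.LPow F k) (Cpx.LofE F) 1 (Cpx.LofE F).D) := rfl
    rw [h1, ih, map_sum, Finset.sum_range_succ]
    congr 1
    · refine Finset.sum_congr rfl fun j hj => ?_
      have hj := Finset.mem_range.1 hj
      rw [tensOne_em, inl_xN F k j hj, ← raise_lt F (by omega : j ≠ k)]
    · have := tens_right F k (NH.x F 0)
      rw [inr_x, ← raise_last] at this
      exact this

end Em

/-! ### One-sided induction over words in the generators. -/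

section Induction

variable {F : Type u} [Field F] {X : Type} {r : FreeAlgebra F X → FreeAlgebra F X → Prop}

theorem Pres.induction_left {P : Pres r → Prop} (one : P 1)
    (gen : ∀ x b, P b → P (Pres.gen r x * b)) (add : ∀ a b, P a → P b → P (a + b))
    (smul : ∀ (c : F) a, P a → P (c • a)) (a : Pres r) : P a := by
  -- Strengthened to all `b` satisfying `P`, the claim becomes stable under products, as induction
  -- on the free algebra requires.
  suffices h : ∀ b, P b → P (a * b) by simpa using h 1 one
  obtain ⟨a, rfl⟩ := Pres.mk_surjective a
  induction a using FreeAlgebra.induction with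
  | grade0 c =>
    intro b hb
    rw [AlgHom.commutes, ← Algebra.smul_def]
    exact smul c b hb
  | grade1 x => exact gen x
  | mul a a' ha ha' =>
    intro b hb
    rw [map_mul, mul_assoc]
    exact ha _ (ha' _ hb)
  | add a a' ha ha' =>
    intro b hb
    rw [map_add, add_mul]
    exact add _ _ (ha _ hb) (ha' _ hb)

theorem Pres.induction_right {P : Pres r → Prop} (one : P 1)
    (gen : ∀ x b, P b → P (b * Pres.gen r x)) (add : ∀ a b, P a → P b → P (a + b))
    (smul : ∀ (c : F) a, P a → P (c • a)) (a : Pres r) : P a := by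
  suffices h : ∀ b, P b → P (b * a) by simpa using h 1 one
  obtain ⟨a, rfl⟩ := Pres.mk_surjective a
  induction a using FreeAlgebra.induction with
  | grade0 c =>
    intro b hb
    rw [AlgHom.commutes, ← Algebra.commutes, ← Algebra.smul_def]
    exact smul c b hb
  | grade1 x => exact gen x
  | mul a a' ha ha' =>
    intro b hb
    rw [map_mul, ← mul_assoc]
    exact ha' _ (ha _ hb)
  | add a a' ha ha' =>
    intro b hb
    rw [map_add, mul_add]
    exact add _ _ (ha _ hb) (ha' _ hb)

end Induction

/-! ### The morphism `ρ_k`. -/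

section Rho

variable (F : Type u) [Field F] (k : ℕ)

-- The matrix half of `d s_i = ξ_i - ξ_{i+1}`: in the commutator of `D` with `ρ(s_i)` the nilHecke
-- relations leave exactly the difference of these two raised flips. On two tensor factors it is a
-- finite check.
open Kronecker in
theorem raise_sub_flip (i : ℕ) (h : i + 1 < k) : raise F k i * flip F k i -
    raise F k (i + 1) * flip F k i = raise F k i - raise F k (i + 1) := by
  have hkr : ∀ {n : ℕ} (A A' : LMat F n ℤ) B, kr A B - kr A' B = kr (A - A') B := by
    intro n A A' B
    ext b a
    obtain ⟨b, j, rfl⟩ := sn_surj b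
    obtain ⟨a, i, rfl⟩ := sn_surj a
    exact (sub_mul _ _ _).symm
  have hkr2 : ∀ {n : ℕ} (A : LMat F n ℤ) B B', kr2 A B - kr2 A B' = kr2 A (B - B') := by
    intro n A B B'
    ext b a
    obtain ⟨b, j', rfl⟩ := sn_surj b
    obtain ⟨b, j, rfl⟩ := sn_surj b
    obtain ⟨a, i', rfl⟩ := sn_surj a
    obtain ⟨a, i, rfl⟩ := sn_surj a
    exact (mul_sub _ _ _).symm
  induction k with
  | zero => omega
  | succ k ih =>
    obtain ⟨k, rfl⟩ : ∃ k', k = k' + 1 := ⟨k - 1, by omega⟩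
    by_cases hi : i = k
    · subst hi
      rw [raise_lt F (by omega : i ≠ i + 1), raise_last, kr_kr, raise_last, parity_succ, kr_kr,
        flip_last, kr2_mul, kr2_mul, hkr2, hkr2, mul_one]
      exact congrArg _ (by decide)
    · rw [flip_lt _ hi, raise_lt F (by omega : i ≠ k + 1), raise_lt F (by omega : i + 1 ≠ k + 1),
        kr_mul, kr_mul, hkr, hkr, ih (by omega), mul_one]

theorem em_sub_right (x : NH F k) (M N : LMat F k ℤ) : em x (M - N) = em x M - em x N := by
  ext b a
  exact sub_smul (M b a) (N b a) x

/-- The values of `ρ_k` on the generators. -/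
noncomputable def rhoGen : Gen k → LMat F k (NH F k)
  | .cross i h => em (NH.del F i h) (flip F k i)
  | .dot j => em 1 (raise F k j)

theorem rho_rel ⦃a b : FreeAlgebra F (Gen k)⦄ (hab : RRel F k a b) :
    FreeAlgebra.lift F (rhoGen F k) a = FreeAlgebra.lift F (rhoGen F k) b := by
  cases hab with
  | sq i h =>
    simp only [map_mul, map_zero, FreeAlgebra.lift_ι_apply, rhoGen, em_mul, NH.del_sq, em_zero_left]
  | braid i h h' =>
    simp only [map_mul, FreeAlgebra.lift_ι_apply, rhoGen, em_mul, NH.braid F i h h', flip_braid F k i h']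
  | far i i' h h' hii =>
    simp only [map_mul, FreeAlgebra.lift_ι_apply, rhoGen, em_mul, NH.far F i i' h h' hii,
      flip_far F k i i' h h' hii]
  | dotSq j h =>
    simp only [map_mul, map_zero, FreeAlgebra.lift_ι_apply, rhoGen, em_mul, raise_sq, em_zero_right]
  | dots j j' h h' hjj =>
    simp only [map_mul, map_neg, FreeAlgebra.lift_ι_apply, rhoGen, em_mul]
    rw [raise_anti F k j j', em_neg_right]
  | left i h₀ h =>
    simp only [map_mul, FreeAlgebra.lift_ι_apply, rhoGen, em_mul, one_mul, mul_one,
      (raise_flip F k i h).1]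
  | right i h₀ h =>
    simp only [map_mul, FreeAlgebra.lift_ι_apply, rhoGen, em_mul, one_mul, mul_one,
      (raise_flip F k i h).2.1]
  | slide i j h hj h1 h2 =>
    simp only [map_mul, FreeAlgebra.lift_ι_apply, rhoGen, em_mul, one_mul, mul_one,
      (raise_flip F k i h).2.2 j h1 h2]

/-- The algebra map underlying `ρ_k`. -/
noncomputable def rhoAlg : RAlg F k →ₐ[F] LMat F k (NH F k) :=
  Pres.lift (rhoGen F k) (rho_rel F k)

theorem rhoAlg_gen (g : Gen k) : rhoAlg F k (Pres.gen (RRel F k) g) = rhoGen F k g := by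
  rw [rhoAlg, Pres.lift_gen]

theorem rhoGen_mem (g : Gen k) : rhoGen F k g ∈ (Cpx.LPow F k).endGr (rDeg k g) := by
  intro b a
  rw [shift_eq, shift_eq]
  cases g with
  | cross i h =>
    show (_ ≠ (0 : ℤ) → em _ _ b a = 0) ∧ em _ _ b a ∈ NH.gr F k (-2 + _ - _)
    rw [em_apply]
    by_cases hd : (Cpx.LPow F k).deg b = (Cpx.LPow F k).deg a
    · refine ⟨fun h => absurd (by rw [hd, sub_self]) h, zsmul_mem ?_ _⟩
      rw [hd, add_sub_cancel_right]
      exact NH.del_mem F i h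
    · rw [flip_homog F k i b a hd, zero_smul]
      exact ⟨fun _ => rfl, zero_mem _⟩
  | dot j =>
    show (_ ≠ (1 : ℤ) → em _ _ b a = 0) ∧ em _ _ b a ∈ NH.gr F k (-2 + _ - _)
    rw [em_apply]
    by_cases hd : (Cpx.LPow F k).deg b = (Cpx.LPow F k).deg a + 1
    · refine ⟨fun h => absurd (by rw [hd]; ring) h, zsmul_mem ?_ _⟩
      rw [hd, show (-2 + -2 * (Cpx.LPow F k).deg a - -2 * ((Cpx.LPow F k).deg a + 1) : ℤ) = 0 by ring]
      exact SetLike.GradedOne.one_mem (A := NH.gr F k)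
    · rw [raise_homog F k j b a hd, zero_smul]
      exact ⟨fun _ => rfl, zero_mem _⟩

theorem rhoAlg_mem (i : ℤ × ℤ) (a : RAlg F k) (ha : a ∈ RNil.gr F k i) :
    rhoAlg F k a ∈ (Cpx.LPow F k).endGr i :=
  Pres.map_wordGr (rhoAlg F k) (Cpx.LPow F k).endGr
    (fun g => by rw [rhoAlg_gen]; exact rhoGen_mem F k g) i a ha

theorem xN_del_tr (i : ℕ) (h : i + 1 < k) (l : ℕ) (hl : l < k) :
    xN F k l * NH.del F i h - NH.del F i h * xN F k (tr i l) =
      if l = i then 1 else if l = i + 1 then -1 else 0 := by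
  unfold tr
  split_ifs with h1 h2
  · subst h1
    rw [xN_of_lt F k l hl, xN_of_lt F k (l + 1) h]
    exact NH.x_del_left F l hl h
  · subst h2
    rw [xN_of_lt F k _ hl, xN_of_lt F k i (by omega)]
    exact NH.x_del_right F i (by omega) h
  · rw [xN_of_lt F k l hl, NH.x_del F i l h hl h1 h2, sub_self]

theorem tr_tr (i j : ℕ) : tr i (tr i j) = j := by
  unfold tr
  split_ifs <;> omega

theorem tr_lt {k i : ℕ} (h : i + 1 < k) {j : ℕ} (hj : j < k) : tr i j < k := by
  unfold tr
  split_ifs <;> omega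

theorem sum_tr {M : Type*} [AddCommMonoid M] (i : ℕ) (h : i + 1 < k) (f : ℕ → M) :
    ∑ l ∈ Finset.range k, f (tr i l) = ∑ l ∈ Finset.range k, f l := by
  refine Finset.sum_nbij' (tr i) (tr i) ?_ ?_ ?_ ?_ ?_
  · exact fun a ha => Finset.mem_range.2 (tr_lt h (Finset.mem_range.1 ha))
  · exact fun a ha => Finset.mem_range.2 (tr_lt h (Finset.mem_range.1 ha))
  · exact fun a _ => tr_tr i a
  · exact fun a _ => tr_tr i a
  · exact fun a _ => rfl

/-- Moving a flip past the raising operators permutes them by `tr i`, so after reindexing `x_l ∂_i`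
is compared with `∂_i x_{tr i l}`; these differ only for `l = i` and `l = i + 1`. For a dot all
terms cancel because the raising operators anticommute. -/
theorem endD_gen (g : Gen k) : rhoAlg F k (RNil.d F k (Pres.gen (RRel F k) g)) =
    (Cpx.LPow F k).endD (rhoGen F k g) := by
  rw [Cpx.endD_apply, Cpx.par_of_mem _ _ _ (rhoGen_mem F k g), D_eq]
  cases g with
  | cross i h =>
    have hd := RNil.d_s F k i h
    rw [RNil.s] at hd
    have e : (∑ l ∈ Finset.range k, em (xN F k l) (raise F k l)) * rhoGen F k (Gen.cross i h) -
        rhoGen F k (Gen.cross i h) * ∑ l ∈ Finset.range k, em (xN F k l) (raise F k l) =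
        ∑ l ∈ Finset.range k, em (if l = i then 1 else if l = i + 1 then -1 else 0)
          (raise F k l * flip F k i) := by
      rw [rhoGen, Finset.mul_sum, ← sum_tr k i h fun l => em (NH.del F i h) (flip F k i) *
        em (xN F k l) (raise F k l), Finset.sum_mul, ← Finset.sum_sub_distrib]
      refine Finset.sum_congr rfl fun l hl => ?_
      rw [em_mul, em_mul, ← raise_flip_tr F k i h, ← em_sub_left,
        xN_del_tr F k i h l (Finset.mem_range.1 hl)]
    rw [hd, map_sub, RNil.xi, RNil.xi, rhoAlg_gen, rhoAlg_gen]
    show _ = _ - ((0 : ℤ).negOnePow • _) * _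
    rw [Int.negOnePow_zero, one_smul, e, ← Finset.sum_subset (s₁ := {i, i + 1})]
    · rw [Finset.sum_pair (by omega), if_pos rfl, if_neg (by omega), if_pos rfl, em_neg_left,
        ← sub_eq_add_neg, rhoGen, rhoGen]
      rw [← em_sub_right, ← em_sub_right, raise_sub_flip F k i h]
    · intro l hl
      simp only [Finset.mem_insert, Finset.mem_singleton] at hl
      rw [Finset.mem_range]
      omega
    · intro l _ hl
      simp only [Finset.mem_insert, Finset.mem_singleton, not_or] at hl
      rw [if_neg hl.1, if_neg hl.2, em_zero_left]
  | dot j =>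
    have hd := RNil.d_xi F k j
    rw [RNil.xi] at hd
    rw [hd, map_zero]
    show _ = _ - ((1 : ℤ).negOnePow • _) * _
    rw [Int.negOnePow_one, Units.neg_smul, one_smul, neg_mul, sub_neg_eq_add, rhoGen, Finset.mul_sum,
      Finset.sum_mul, ← Finset.sum_add_distrib]
    refine (Finset.sum_eq_zero fun l _ => ?_).symm
    rw [em_mul, em_mul, mul_one, one_mul, raise_anti F k l j, em_neg_right, neg_add_cancel]

/-- Both differentials satisfy the graded Leibniz rule, so agreement on generators propagates along
words. -/
theorem rhoAlg_d (a : RAlg F k) :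
    rhoAlg F k (RNil.d F k a) = (Cpx.LPow F k).endD (rhoAlg F k a) := by
  induction a using Pres.induction_left with
  | one =>
    rw [RNil.d_one, map_one, map_zero]
    exact ((Cpx.LPow F k).End.d_one).symm
  | gen g b hb =>
    have hg : Pres.gen (RRel F k) g ∈ RNil.gr F k (rDeg k g) := gen_mem (RRel F k) (rDeg k) g
    have h2 := (Cpx.LPow F k).End.leibniz (rDeg k g).1 (rDeg k g).2 (rhoGen F k g) (rhoAlg F k b)
      (rhoGen_mem F k g)
    rw [RNil.leibniz F k (rDeg k g).1 (rDeg k g).2 _ _ hg, map_add, map_mul, map_units_smul, map_mul,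
      map_mul, endD_gen, hb, rhoAlg_gen]
    exact h2.symm
  | add a b ha hb => rw [map_add, map_add, map_add, map_add, ha, hb]
  | smul c a ha => rw [map_smul, map_smul, map_smul, map_smul, ha]

/-- The morphism `ρ_k`. -/
noncomputable def rho : QDGA.Hom (Rnil F k) (Cpx.LPow F k).End where
  toAlgHom := rhoAlg F k
  map_mem := rhoAlg_mem F k
  map_d := rhoAlg_d F k

end Rho

/-! ### The nilCoxeter algebra, and right multiplication by dots on polynomials tensor nilCoxeter.
-/

section NilCoxeter

variable (F : Type u) [Field F] (k : ℕ)

/-- The defining relations of the nilCoxeter algebra. -/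
inductive NCRel : FreeAlgebra F {i : ℕ // i + 1 < k} → FreeAlgebra F {i : ℕ // i + 1 < k} → Prop
  | sq (i : ℕ) (h : i + 1 < k) : NCRel (FreeAlgebra.ι F ⟨i, h⟩ * FreeAlgebra.ι F ⟨i, h⟩) 0
  | braid (i : ℕ) (h : i + 1 < k) (h' : i + 1 + 1 < k) :
      NCRel (FreeAlgebra.ι F ⟨i, h⟩ * FreeAlgebra.ι F ⟨i + 1, h'⟩ * FreeAlgebra.ι F ⟨i, h⟩)
        (FreeAlgebra.ι F ⟨i + 1, h'⟩ * FreeAlgebra.ι F ⟨i, h⟩ * FreeAlgebra.ι F ⟨i + 1, h'⟩)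
  | far (i i' : ℕ) (h : i + 1 < k) (h' : i' + 1 < k) (hii : i + 1 < i') :
      NCRel (FreeAlgebra.ι F ⟨i, h⟩ * FreeAlgebra.ι F ⟨i', h'⟩)
        (FreeAlgebra.ι F ⟨i', h'⟩ * FreeAlgebra.ι F ⟨i, h⟩)

/-- The nilCoxeter algebra. -/
abbrev NC : Type u := Pres (NCRel F k)

namespace NC

variable {k}

/-- The generators of the nilCoxeter algebra. -/
noncomputable def s (i : ℕ) (h : i + 1 < k) : NC F k := Pres.gen (NCRel F k) ⟨i, h⟩

theorem s_sq (i : ℕ) (h : i + 1 < k) : s F i h * s F i h = 0 := by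
  simpa [s] using Pres.mk_rel (NCRel.sq (F := F) i h)

theorem braid (i : ℕ) (h : i + 1 < k) (h' : i + 1 + 1 < k) :
    s F i h * s F (i + 1) h' * s F i h = s F (i + 1) h' * s F i h * s F (i + 1) h' := by
  simpa [s] using Pres.mk_rel (NCRel.braid (F := F) i h h')

theorem far (i i' : ℕ) (h : i + 1 < k) (h' : i' + 1 < k) (hii : i + 1 < i') :
    s F i h * s F i' h' = s F i' h' * s F i h := by
  simpa [s] using Pres.mk_rel (NCRel.far (F := F) i i' h h' hii)

/-- The map from the nilCoxeter algebra defined by elements that satisfy its relations. -/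
noncomputable def lift {A : Type*} [Ring A] [Algebra F A] (f : ∀ i : ℕ, i + 1 < k → A)
    (hsq : ∀ i h, f i h * f i h = 0)
    (hbraid : ∀ i h h', f i h * f (i + 1) h' * f i h = f (i + 1) h' * f i h * f (i + 1) h')
    (hfar : ∀ i i' h h', i + 1 < i' → f i h * f i' h' = f i' h' * f i h) : NC F k →ₐ[F] A :=
  Pres.lift (fun i => f i.1 i.2) (by
    intro a b hab
    cases hab with
    | sq i h => simpa using hsq i h
    | braid i h h' => simpa using hbraid i h h'
    | far i i' h h' hii => simpa using hfar i i' h h' hii)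

theorem lift_s {A : Type*} [Ring A] [Algebra F A] (f : ∀ i : ℕ, i + 1 < k → A)
    (hsq : ∀ i h, f i h * f i h = 0)
    (hbraid : ∀ i h h', f i h * f (i + 1) h' * f i h = f (i + 1) h' * f i h * f (i + 1) h')
    (hfar : ∀ i i' h h', i + 1 < i' → f i h * f i' h' = f i' h' * f i h) (i : ℕ) (h : i + 1 < k) :
    lift F f hsq hbraid hfar (s F i h) = f i h := by
  rw [s, lift, Pres.lift_gen]

theorem induction_right {P : NC F k → Prop} (one : P 1)
    (gen : ∀ i h b, P b → P (b * s F i h)) (add : ∀ a b, P a → P b → P (a + b))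
    (smul : ∀ (c : F) a, P a → P (c • a)) (a : NC F k) : P a :=
  Pres.induction_right one (fun x => gen x.1 x.2) add smul a

theorem induction_left {P : NC F k → Prop} (one : P 1)
    (gen : ∀ i h b, P b → P (s F i h * b)) (add : ∀ a b, P a → P b → P (a + b))
    (smul : ∀ (c : F) a, P a → P (c • a)) (a : NC F k) : P a :=
  Pres.induction_left one (fun x => gen x.1 x.2) add smul a

variable (k)

/-- The nilCoxeter algebra maps to the nilHecke algebra. -/
noncomputable def toNH : NC F k →ₐ[F] NH F k :=
  lift F (fun i h => NH.del F i h) (NH.del_sq F) (NH.braid F) (NH.far F)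

theorem toNH_s (i : ℕ) (h : i + 1 < k) : toNH F k (s F i h) = NH.del F i h := lift_s F _ _ _ _ i h

/-- The nilCoxeter algebra maps to `R_k^nil`, with the generators mapping to `-s_i`. -/
noncomputable def toR : NC F k →ₐ[F] RAlg F k :=
  lift F (fun i h => -RNil.s F i h) (fun i h => by rw [neg_mul_neg, RNil.s_sq])
    (fun i h h' => by simp only [neg_mul, mul_neg, neg_neg]; rw [RNil.braid F i h h'])
    (fun i i' h h' hii => by rw [neg_mul_neg, neg_mul_neg, RNil.far F i i' h h' hii])

theorem toR_s (i : ℕ) (h : i + 1 < k) : toR F k (s F i h) = -RNil.s F i h := lift_s F _ _ _ _ i h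

end NC

open scoped TensorProduct

/-- The polynomial ring on the dots, tensored with the nilCoxeter algebra. -/
abbrev PNC : Type u := MvPolynomial (Fin k) F ⊗[F] NC F k

namespace PNC

/-- The variables, indexed by natural numbers. -/
noncomputable def X (j : ℕ) : MvPolynomial (Fin k) F :=
  if h : j < k then MvPolynomial.X ⟨j, h⟩ else 0

theorem X_of_lt (j : ℕ) (h : j < k) : X F k j = MvPolynomial.X ⟨j, h⟩ := dif_pos h

/-- Polynomials inside `PNC`. -/
noncomputable def poly (p : MvPolynomial (Fin k) F) : PNC F k := p ⊗ₜ 1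

variable {k} in
/-- The nilCoxeter generators inside `PNC`. -/
noncomputable def s (i : ℕ) (h : i + 1 < k) : PNC F k := 1 ⊗ₜ NC.s F i h

theorem poly_mul (p p' : MvPolynomial (Fin k) F) : poly F k p * poly F k p' = poly F k (p * p') := by
  rw [poly, poly, Algebra.TensorProduct.tmul_mul_tmul, one_mul, poly]

theorem s_sq (i : ℕ) (h : i + 1 < k) : s F i h * s F i h = 0 := by
  rw [s, Algebra.TensorProduct.tmul_mul_tmul, NC.s_sq, TensorProduct.tmul_zero]

theorem braid (i : ℕ) (h : i + 1 < k) (h' : i + 1 + 1 < k) :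
    s F i h * s F (i + 1) h' * s F i h = s F (i + 1) h' * s F i h * s F (i + 1) h' := by
  simp only [s, Algebra.TensorProduct.tmul_mul_tmul, NC.braid F i h h']

theorem far (i i' : ℕ) (h : i + 1 < k) (h' : i' + 1 < k) (hii : i + 1 < i') :
    s F i h * s F i' h' = s F i' h' * s F i h := by
  simp only [s, Algebra.TensorProduct.tmul_mul_tmul, NC.far F i i' h h' hii]

theorem tmul_mul_s (p : MvPolynomial (Fin k) F) (a : NC F k) (i : ℕ) (h : i + 1 < k) :
    (p ⊗ₜ a : PNC F k) * s F i h = p ⊗ₜ (a * NC.s F i h) := by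
  rw [s, Algebra.TensorProduct.tmul_mul_tmul, mul_one]

variable {F k} in
theorem induction {P : PNC F k → Prop} (base : ∀ p, P (poly F k p))
    (step : ∀ i h q, P q → P (q * s F i h)) (add : ∀ q q', P q → P q' → P (q + q'))
    (q : PNC F k) : P q := by
  induction q using TensorProduct.induction_on with
  | zero =>
    have := base 0
    rwa [poly, TensorProduct.zero_tmul] at this
  | tmul p a =>
    induction a using NC.induction_right generalizing p with
    | one => exact base p
    | gen i h b hb => rw [← tmul_mul_s]; exact step i h _ (hb p)
    | add a b ha hb => rw [TensorProduct.tmul_add]; exact add _ _ (ha p) (hb p)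
    | smul c a ha => rw [← TensorProduct.smul_tmul]; exact ha _
  | add q q' hq hq' => exact add _ _ hq hq'

/-- The coefficient `∂_i x_j`. -/
def eps (i j : ℕ) : ℤ := if j = i then 1 else if j = i + 1 then -1 else 0

/-- The operator `(v₀, v) ↦ (v₀ s_i, j ↦ v_{s_i j} s_i + eps_i(j) v₀)`. -/
noncomputable def opS (i : ℕ) (h : i + 1 < k) : Module.End F (PNC F k × (ℕ → PNC F k)) where
  toFun v := (v.1 * s F i h, fun j => v.2 (tr i j) * s F i h + eps i j • v.1)
  map_add' v w := by
    refine Prod.ext (add_mul _ _ _) (funext fun j => ?_)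
    show (v.2 _ + w.2 _) * _ + _ • (v.1 + w.1) = _ + (_ + _)
    rw [add_mul, smul_add, add_add_add_comm]
  map_smul' c v := by
    refine Prod.ext (smul_mul_assoc _ _ _) (funext fun j => ?_)
    show (c • v.2 _) * _ + _ • (c • v.1) = c • (_ + _)
    rw [smul_mul_assoc, smul_add, smul_comm c]

theorem opS_fst (i : ℕ) (h : i + 1 < k) (v) : (opS F k i h v).1 = v.1 * s F i h := rfl

theorem opS_snd (i : ℕ) (h : i + 1 < k) (v) (j : ℕ) :
    (opS F k i h v).2 j = v.2 (tr i j) * s F i h + eps i j • v.1 := rfl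

/-- The operators `opS` model right multiplication by `∂_i` on an element together with its products
with all the dots, according to `∂_i x_j = x_{tr i j} ∂_i + eps i j`. The nilCoxeter relations for
them come down to identities between `eps` and `tr`. -/
theorem opS_sq (i : ℕ) (h : i + 1 < k) (v) : opS F k i h (opS F k i h v) = 0 := by
  refine Prod.ext ?_ (funext fun j => ?_)
  · rw [opS_fst, opS_fst, mul_assoc, s_sq, mul_zero]; rfl
  · rw [opS_snd, opS_snd, opS_fst, add_mul, mul_assoc, s_sq, mul_zero, zero_add, smul_mul_assoc,
      ← add_smul]
    have : eps i (tr i j) + eps i j = 0 := by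
      unfold eps tr; split_ifs <;> omega
    rw [this, zero_smul]; rfl

theorem opS_braid (i : ℕ) (h : i + 1 < k) (h' : i + 1 + 1 < k) (v) :
    opS F k i h (opS F k (i + 1) h' (opS F k i h v)) =
      opS F k (i + 1) h' (opS F k i h (opS F k (i + 1) h' v)) := by
  refine Prod.ext ?_ (funext fun j => ?_)
  · simp only [opS_fst]
    rw [mul_assoc, mul_assoc, ← mul_assoc (s F i h), braid F k i h h', mul_assoc, mul_assoc, mul_assoc]
  · simp only [opS_fst, opS_snd, add_mul, smul_mul_assoc, mul_assoc, s_sq, mul_zero, smul_zero, add_zero]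
    rw [← mul_assoc (s F i h), braid F k i h h', mul_assoc]
    have h1 : tr i (tr (i + 1) (tr i j)) = tr (i + 1) (tr i (tr (i + 1) j)) := by
      unfold tr; split_ifs <;> omega
    have h2 : eps i (tr (i + 1) (tr i j)) = eps (i + 1) j := by
      unfold tr eps; split_ifs <;> omega
    have h3 : eps (i + 1) (tr i (tr (i + 1) j)) = eps i j := by
      unfold tr eps; split_ifs <;> omega
    rw [h1, h2, h3]
    abel

theorem opS_far (i i' : ℕ) (h : i + 1 < k) (h' : i' + 1 < k) (hii : i + 1 < i') (v) :
    opS F k i h (opS F k i' h' v) = opS F k i' h' (opS F k i h v) := by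
  refine Prod.ext ?_ (funext fun j => ?_)
  · simp only [opS_fst]
    rw [mul_assoc, mul_assoc, far F k i i' h h' hii]
  · simp only [opS_fst, opS_snd, add_mul, smul_mul_assoc, mul_assoc]
    rw [far F k i i' h h' hii]
    have h1 : tr i (tr i' j) = tr i' (tr i j) := by
      unfold tr; split_ifs <;> omega
    have h2 : eps i (tr i' j) = eps i j := by
      unfold tr eps; split_ifs <;> omega
    have h3 : eps i' (tr i j) = eps i' j := by
      unfold tr eps; split_ifs <;> omega
    rw [h1, h2, h3]
    abel

/-- The right action of the nilCoxeter algebra by the operators `opS`. -/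
noncomputable def act : NC F k →ₐ[F] (Module.End F (PNC F k × (ℕ → PNC F k)))ᵐᵒᵖ :=
  NC.lift F (fun i h => MulOpposite.op (opS F k i h))
    (fun i h => by
      rw [← MulOpposite.op_mul, ← MulOpposite.op_zero]
      exact congrArg _ (LinearMap.ext fun v => opS_sq F k i h v))
    (fun i h h' => by
      simp only [← MulOpposite.op_mul]
      exact congrArg _ (LinearMap.ext fun v => opS_braid F k i h h' v))
    (fun i i' h h' hii => by
      simp only [← MulOpposite.op_mul]
      exact congrArg _ (LinearMap.ext fun v => (opS_far F k i i' h h' hii v).symm))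

theorem act_mul_s (a : NC F k) (i : ℕ) (h : i + 1 < k) (v) :
    (act F k (a * NC.s F i h)).unop v = opS F k i h ((act F k a).unop v) := by
  rw [map_mul, MulOpposite.unop_mul, act, NC.lift_s]
  rfl

/-- `q ↦ (q, j ↦ q x_j)`. -/
noncomputable def dbl : PNC F k →ₗ[F] PNC F k × (ℕ → PNC F k) :=
  TensorProduct.lift (LinearMap.mk₂ F
    (fun p a => (act F k a).unop (poly F k p, fun j => poly F k (p * X F k j)))
    (by
      intro p p' a
      rw [← map_add]
      congr 1
      refine Prod.ext (TensorProduct.add_tmul _ _ _) (funext fun j => ?_)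
      show poly F k _ = poly F k _ + poly F k _
      rw [add_mul]
      exact TensorProduct.add_tmul _ _ _)
    (by
      intro c p a
      rw [← map_smul]
      congr 1
      refine Prod.ext (TensorProduct.smul_tmul' c p 1).symm (funext fun j => ?_)
      show poly F k _ = c • poly F k _
      rw [smul_mul_assoc]
      exact (TensorProduct.smul_tmul' c _ 1).symm)
    (fun p a b => by rw [map_add]; rfl)
    (fun c p a => by rw [map_smul]; rfl))

theorem dbl_tmul (p : MvPolynomial (Fin k) F) (a : NC F k) : dbl F k (p ⊗ₜ a) =
    (act F k a).unop (poly F k p, fun j => poly F k (p * X F k j)) := rfl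

theorem dbl_poly (p : MvPolynomial (Fin k) F) : dbl F k (poly F k p) =
    (poly F k p, fun j => poly F k (p * X F k j)) := by
  rw [poly, dbl_tmul, map_one]
  rfl

/-- Equivariance under the nilCoxeter action; its second component is the commutation rule of `opX`
with a crossing. -/
theorem dbl_mul_s (q : PNC F k) (i : ℕ) (h : i + 1 < k) :
    dbl F k (q * s F i h) = opS F k i h (dbl F k q) := by
  induction q using TensorProduct.induction_on with
  | zero => rw [zero_mul, map_zero, map_zero]
  | tmul p a => rw [tmul_mul_s, dbl_tmul, act_mul_s, dbl_tmul]
  | add q q' hq hq' => rw [add_mul, map_add, map_add, map_add, hq, hq']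

theorem dbl_fst (q : PNC F k) : (dbl F k q).1 = q := by
  induction q using induction with
  | base p => rw [dbl_poly]
  | step i h q hq => rw [dbl_mul_s, opS_fst, hq]
  | add q q' hq hq' => rw [map_add, Prod.fst_add, hq, hq']

/-- Right multiplication by the dots. -/
noncomputable def opX (j : ℕ) : PNC F k →ₗ[F] PNC F k :=
  LinearMap.proj j ∘ₗ LinearMap.snd F _ _ ∘ₗ dbl F k

theorem opX_poly (j : ℕ) (p : MvPolynomial (Fin k) F) :
    opX F k j (poly F k p) = poly F k (p * X F k j) := by
  show (dbl F k (poly F k p)).2 j = _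
  rw [dbl_poly]

theorem opX_mul_s (j : ℕ) (q : PNC F k) (i : ℕ) (h : i + 1 < k) :
    opX F k j (q * s F i h) = opX F k (tr i j) q * s F i h + eps i j • q := by
  show (dbl F k (q * s F i h)).2 j = _
  rw [dbl_mul_s, opS_snd, dbl_fst]
  rfl

theorem opX_poly_mul (j : ℕ) (p : MvPolynomial (Fin k) F) (q : PNC F k) :
    opX F k j (poly F k p * q) = poly F k p * opX F k j q := by
  induction q using induction generalizing j with
  | base p' => rw [poly_mul, opX_poly, opX_poly, poly_mul, mul_assoc]
  | step i h q hq =>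
    rw [← mul_assoc, opX_mul_s, hq, opX_mul_s, mul_add, mul_assoc, mul_smul_comm]
  | add q q' hq hq' => rw [mul_add, map_add, map_add, mul_add, hq, hq']

theorem opX_comm (j j' : ℕ) (q : PNC F k) : opX F k j (opX F k j' q) = opX F k j' (opX F k j q) := by
  induction q using induction generalizing j j' with
  | base p => rw [opX_poly, opX_poly, opX_poly, opX_poly, mul_assoc, mul_assoc, mul_comm (X F k j)]
  | step i h q hq =>
    simp only [opX_mul_s, map_add, map_zsmul, hq (tr i j) (tr i j')]
    -- The correction terms are symmetric in `j` and `j'`: a strand away from the crossing has `eps`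
    -- equal to zero and is fixed by `tr i`, and the remaining cases are finitely many.
    have key : eps i j • opX F k (tr i j') q + eps i j' • opX F k j q =
        eps i j' • opX F k (tr i j) q + eps i j • opX F k j' q := by
      by_cases h1 : j = i ∨ j = i + 1 <;> by_cases h2 : j' = i ∨ j' = i + 1
      · rcases h1 with rfl | rfl <;> rcases h2 with rfl | rfl <;> simp [eps, tr]
      · have e1 : eps i j' = 0 := by unfold eps; split_ifs <;> omega
        have e2 : tr i j' = j' := by unfold tr; split_ifs <;> omega
        rw [e1, e2, zero_smul, zero_smul, add_comm]
      · have e1 : eps i j = 0 := by unfold eps; split_ifs <;> omega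
        have e2 : tr i j = j := by unfold tr; split_ifs <;> omega
        rw [e1, e2, zero_smul, zero_smul, add_comm]
      · have e1 : eps i j' = 0 := by unfold eps; split_ifs <;> omega
        have e2 : eps i j = 0 := by unfold eps; split_ifs <;> omega
        rw [e1, e2, zero_smul, zero_smul, zero_smul, zero_smul]
    rw [add_assoc, key, add_assoc]
  | add q q' hq hq' => simp only [map_add, hq j j', hq' j j']

end PNC

end NilCoxeter

/-! ### Normal form in the nilHecke algebra, and regularity of the dots. -/

section PBW

open scoped TensorProduct IsMulCommutative

variable (F : Type u) [Field F] (k : ℕ)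

namespace PNC

/-- The right action of the nilHecke algebra on polynomials tensor nilCoxeter algebra. -/
noncomputable def nhAct : NH F k →ₐ[F] (Module.End F (PNC F k))ᵐᵒᵖ :=
  Pres.lift (fun g => match g with
    | .cross i h => MulOpposite.op (LinearMap.mulRight F (s F i h))
    | .dot j => MulOpposite.op (opX F k j)) (by
    intro a b hab
    cases hab with
    | sq i h =>
      simp only [map_mul, map_zero, FreeAlgebra.lift_ι_apply, ← MulOpposite.op_mul]
      rw [← MulOpposite.op_zero]
      refine congrArg _ (LinearMap.ext fun q => ?_)
      show q * s F i h * s F i h = 0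
      rw [mul_assoc, s_sq, mul_zero]
    | braid i h h' =>
      simp only [map_mul, FreeAlgebra.lift_ι_apply, ← MulOpposite.op_mul]
      refine congrArg _ (LinearMap.ext fun q => ?_)
      show q * s F i h * s F (i + 1) h' * s F i h = q * s F (i + 1) h' * s F i h * s F (i + 1) h'
      rw [mul_assoc, mul_assoc, ← mul_assoc (s F i h), braid F k i h h']
      simp only [mul_assoc]
    | far i i' h h' hii =>
      simp only [map_mul, FreeAlgebra.lift_ι_apply, ← MulOpposite.op_mul]
      refine congrArg _ (LinearMap.ext fun q => ?_)
      show q * s F i h * s F i' h' = q * s F i' h' * s F i h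
      rw [mul_assoc, far F k i i' h h' hii, mul_assoc]
    | dots j j' h h' hjj =>
      simp only [map_mul, FreeAlgebra.lift_ι_apply, ← MulOpposite.op_mul]
      exact congrArg _ (LinearMap.ext fun q => opX_comm F k j' j q)
    | left i h₀ h =>
      simp only [map_mul, map_sub, map_one, FreeAlgebra.lift_ι_apply, ← MulOpposite.op_mul,
        ← MulOpposite.op_sub]
      rw [← MulOpposite.op_one]
      refine congrArg _ (LinearMap.ext fun q => ?_)
      show opX F k i q * s F i h - opX F k (i + 1) (q * s F i h) = q
      rw [opX_mul_s]
      simp [tr, eps]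
    | right i h₀ h =>
      simp only [map_mul, map_sub, map_neg, map_one, FreeAlgebra.lift_ι_apply, ← MulOpposite.op_mul,
        ← MulOpposite.op_sub]
      rw [← MulOpposite.op_one, ← MulOpposite.op_neg]
      refine congrArg _ (LinearMap.ext fun q => ?_)
      show opX F k (i + 1) q * s F i h - opX F k i (q * s F i h) = -q
      rw [opX_mul_s]
      simp [tr, eps]
    | slide i j h hj h1 h2 =>
      simp only [map_mul, FreeAlgebra.lift_ι_apply, ← MulOpposite.op_mul]
      refine congrArg _ (LinearMap.ext fun q => ?_)
      show opX F k j q * s F i h = opX F k j (q * s F i h)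
      rw [opX_mul_s]
      simp [tr, eps, h1, h2])

/-- The action of an element of the nilHecke algebra, as a linear map. -/
noncomputable def actNH (n : NH F k) : PNC F k →ₗ[F] PNC F k := (nhAct F k n).unop

theorem actNH_mul (n m : NH F k) (q) : actNH F k (n * m) q = actNH F k m (actNH F k n q) := by
  rw [actNH, map_mul]
  rfl

theorem actNH_del (i : ℕ) (h : i + 1 < k) (q) : actNH F k (NH.del F i h) q = q * s F i h := by
  rw [actNH, NH.del, nhAct, Pres.lift_gen]
  rfl

theorem actNH_x (j : Fin k) (q) : actNH F k (NH.x F j) q = opX F k j q := by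
  rw [actNH, NH.x, nhAct, Pres.lift_gen]
  rfl

theorem actNH_one (q) : actNH F k 1 q = q := by
  rw [actNH, map_one]
  rfl

theorem actNH_add (n m : NH F k) (q) : actNH F k (n + m) q = actNH F k n q + actNH F k m q := by
  rw [actNH, map_add]
  rfl

theorem actNH_smul (c : F) (n : NH F k) (q) : actNH F k (c • n) q = c • actNH F k n q := by
  rw [actNH, map_smul]
  rfl

/-- Makes the inverse map `ofNH` linear over the dots on the left, so that questions about left
multiplication by dots can be answered in a free polynomial module. -/
theorem actNH_poly_mul (n : NH F k) (p : MvPolynomial (Fin k) F) (q : PNC F k) :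
    actNH F k n (poly F k p * q) = poly F k p * actNH F k n q := by
  induction n using Pres.induction_right with
  | one => rw [actNH_one, actNH_one]
  | gen g n hn =>
    rw [actNH_mul, hn, actNH_mul]
    cases g with
    | cross i h =>
      have := fun q => actNH_del F k i h q
      rw [NH.del] at this
      rw [this, this, mul_assoc]
    | dot j =>
      have := fun q => actNH_x F k j q
      rw [NH.x] at this
      rw [this, this, opX_poly_mul]
  | add a b ha hb => rw [actNH_add, actNH_add, ha, hb, mul_add]
  | smul c a ha => rw [actNH_smul, actNH_smul, ha, mul_smul_comm]

theorem isMulCommutative_adjoin_x :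
    IsMulCommutative (Algebra.adjoin F (Set.range (NH.x F (k := k)))) :=
  Algebra.isMulCommutative_adjoin F (by
    rintro _ ⟨j, rfl⟩ _ ⟨j', rfl⟩
    exact NH.x_x F j j')

/-- The map from polynomials in the dots to the nilHecke algebra. -/
noncomputable def polyNH : MvPolynomial (Fin k) F →ₐ[F] NH F k :=
  haveI := isMulCommutative_adjoin_x F k
  (Algebra.adjoin F (Set.range (NH.x F (k := k)))).val.comp
    (MvPolynomial.aeval fun j => ⟨NH.x F j, Algebra.subset_adjoin ⟨j, rfl⟩⟩)

theorem polyNH_X (j : Fin k) : polyNH F k (MvPolynomial.X j) = NH.x F j := by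
  have := isMulCommutative_adjoin_x F k
  exact congrArg Subtype.val (MvPolynomial.aeval_X
    (fun j => (⟨NH.x F j, Algebra.subset_adjoin ⟨j, rfl⟩⟩ :
      Algebra.adjoin F (Set.range (NH.x F (k := k))))) j)

theorem polyNH_xN (j : ℕ) : polyNH F k (X F k j) = xN F k j := by
  unfold X xN
  split_ifs with h
  · exact polyNH_X F k _
  · exact map_zero _

/-- `p ⊗ a ↦ p(x) a(∂)`. -/
noncomputable def toNH : PNC F k →ₗ[F] NH F k :=
  TensorProduct.lift ((LinearMap.mul F (NH F k)).compl₁₂ (polyNH F k).toLinearMap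
    (NC.toNH F k).toLinearMap)

theorem toNH_tmul (p : MvPolynomial (Fin k) F) (a : NC F k) :
    toNH F k (p ⊗ₜ a) = polyNH F k p * NC.toNH F k a := rfl

theorem toNH_poly (p : MvPolynomial (Fin k) F) : toNH F k (poly F k p) = polyNH F k p := by
  rw [poly, toNH_tmul, map_one, mul_one]

theorem toNH_mul_s (q : PNC F k) (i : ℕ) (h : i + 1 < k) :
    toNH F k (q * s F i h) = toNH F k q * NH.del F i h := by
  induction q using TensorProduct.induction_on with
  | zero => rw [zero_mul, map_zero, zero_mul]
  | tmul p a => rw [tmul_mul_s, toNH_tmul, map_mul, NC.toNH_s, toNH_tmul, mul_assoc]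
  | add q q' hq hq' => rw [add_mul, map_add, map_add, add_mul, hq, hq']

theorem del_xN (i : ℕ) (h : i + 1 < k) (j : ℕ) (hj : j < k) :
    NH.del F i h * xN F k j = xN F k (tr i j) * NH.del F i h + eps i j • 1 := by
  have := xN_del_tr F k i h (tr i j) (tr_lt h hj)
  rw [tr_tr, sub_eq_iff_eq_add] at this
  rw [this]
  unfold eps tr
  split_ifs <;> first | omega | simp

theorem toNH_opX (q : PNC F k) (j : ℕ) (hj : j < k) :
    toNH F k (opX F k j q) = toNH F k q * xN F k j := by
  induction q using induction generalizing j with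
  | base p => rw [opX_poly, toNH_poly, map_mul, polyNH_xN, toNH_poly]
  | step i h q hq =>
    rw [opX_mul_s, map_add, toNH_mul_s, hq _ (tr_lt h hj), toNH_mul_s, mul_assoc, mul_assoc,
      del_xN F k i h j hj, mul_add, map_zsmul, mul_smul_comm, mul_one]
  | add q q' hq hq' => rw [map_add, map_add, hq j hj, hq' j hj, map_add, add_mul]

/-- The right action was modelled on right multiplication, and `toNH` intertwines the two. Evaluated
at `1`, this is the surjectivity of `toNH`. -/
theorem toNH_actNH (n : NH F k) (q : PNC F k) : toNH F k (actNH F k n q) = toNH F k q * n := by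
  induction n using Pres.induction_right with
  | one => rw [actNH_one, mul_one]
  | gen g n hn =>
    rw [actNH_mul]
    cases g with
    | cross i h =>
      have := actNH_del F k i h (actNH F k n q)
      rw [NH.del] at this
      rw [this, toNH_mul_s, hn, mul_assoc]
      rfl
    | dot j =>
      have := actNH_x F k j (actNH F k n q)
      rw [NH.x] at this
      rw [this, toNH_opX F k _ _ j.2, hn, mul_assoc, xN_of_lt F k j j.2]
      rfl
  | add a b ha hb => rw [actNH_add, map_add, ha, hb, mul_add]
  | smul c a ha => rw [actNH_smul, map_smul, ha, mul_smul_comm]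

/-- The inverse of `toNH`. -/
noncomputable def ofNH (n : NH F k) : PNC F k := actNH F k n 1

theorem toNH_ofNH (n : NH F k) : toNH F k (ofNH F k n) = n := by
  have h1 : (1 : PNC F k) = poly F k 1 := rfl
  rw [ofNH, toNH_actNH, h1, toNH_poly, map_one, one_mul]

theorem ofNH_mul_del (n : NH F k) (i : ℕ) (h : i + 1 < k) :
    ofNH F k (n * NH.del F i h) = ofNH F k n * s F i h := by
  rw [ofNH, actNH_mul, actNH_del, ofNH]

theorem ofNH_polyNH (p : MvPolynomial (Fin k) F) : ofNH F k (polyNH F k p) = poly F k p := by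
  induction p using MvPolynomial.induction_on with
  | C c =>
    have : (MvPolynomial.C c : MvPolynomial (Fin k) F) = c • 1 := by
      rw [MvPolynomial.smul_eq_C_mul, mul_one]
    rw [this, map_smul, map_one, ofNH, actNH_smul, actNH_one]
    rfl
  | add p q hp hq =>
    rw [map_add, ofNH, actNH_add]
    rw [ofNH] at hp hq
    rw [hp, hq]
    exact (TensorProduct.add_tmul _ _ _).symm
  | mul_X p j hp =>
    rw [ofNH] at hp
    rw [map_mul, polyNH_X, ofNH, actNH_mul, hp, actNH_x, opX_poly, X_of_lt F k j j.2]

/-- The independence half of the normal form: a polynomial followed by crossings acts on `1` without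
any reordering. -/
theorem ofNH_toNH (q : PNC F k) : ofNH F k (toNH F k q) = q := by
  induction q using induction with
  | base p => rw [toNH_poly, ofNH_polyNH]
  | step i h q hq => rw [toNH_mul_s, ofNH_mul_del, hq]
  | add q q' hq hq' =>
    rw [ofNH] at hq hq'
    rw [map_add, ofNH, actNH_add, hq, hq']

theorem ofNH_xN_mul (n : NH F k) (j : ℕ) : ofNH F k (xN F k j * n) = poly F k (X F k j) * ofNH F k n := by
  have h1 : ofNH F k (xN F k j) = poly F k (X F k j) := by rw [← polyNH_xN, ofNH_polyNH]
  rw [ofNH] at h1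
  rw [ofNH, actNH_mul, h1, ofNH, ← actNH_poly_mul, mul_one]

/-- Setting the dots to zero. -/
noncomputable def eval : PNC F k →ₗ[F] NC F k :=
  TensorProduct.lift ((LinearMap.lsmul F (NC F k)).comp
    (MvPolynomial.aeval (0 : Fin k → F)).toLinearMap)

theorem eval_tmul (p : MvPolynomial (Fin k) F) (a : NC F k) :
    eval F k (p ⊗ₜ a) = MvPolynomial.aeval (0 : Fin k → F) p • a := rfl

theorem eval_X_mul (j : ℕ) (q : PNC F k) : eval F k (poly F k (X F k j) * q) = 0 := by
  induction q using TensorProduct.induction_on with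
  | zero => rw [mul_zero, map_zero]
  | tmul p a =>
    rw [poly, Algebra.TensorProduct.tmul_mul_tmul, eval_tmul, map_mul]
    have : MvPolynomial.aeval (0 : Fin k → F) (X F k j) = 0 := by
      unfold X
      split_ifs
      · rw [MvPolynomial.aeval_X]; rfl
      · exact map_zero _
    rw [this, zero_mul, zero_smul]
  | add q q' hq hq' => rw [mul_add, map_add, hq, hq', add_zero]

end PNC

/-- Setting the dots on the left to zero. -/
noncomputable def topNC : NH F k →ₗ[F] NC F k where
  toFun n := PNC.eval F k (PNC.ofNH F k n)
  map_add' n m := by rw [PNC.ofNH, PNC.actNH_add, map_add]; rfl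
  map_smul' c n := by rw [PNC.ofNH, PNC.actNH_smul, map_smul]; rfl

theorem topNC_xN_mul (j : ℕ) (n : NH F k) : topNC F k (xN F k j * n) = 0 := by
  show PNC.eval F k (PNC.ofNH F k _) = 0
  rw [PNC.ofNH_xN_mul, PNC.eval_X_mul]

theorem topNC_toNH (a : NC F k) : topNC F k (NC.toNH F k a) = a := by
  have h : NC.toNH F k a = PNC.toNH F k (1 ⊗ₜ a) := by
    rw [PNC.toNH_tmul, map_one, one_mul]
  show PNC.eval F k (PNC.ofNH F k _) = a
  rw [h, PNC.ofNH_toNH, PNC.eval_tmul, map_one, one_smul]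

/-- An element of the nilHecke algebra modulo the right ideal generated by the dots. -/
theorem exists_eq_toNH_add (n : NH F k) : ∃ b : ℕ → NH F k,
    n = NC.toNH F k (topNC F k n) + ∑ j ∈ Finset.range k, xN F k j * b j := by
  suffices h : ∀ q : PNC F k, ∃ b : ℕ → NH F k, PNC.toNH F k q =
      NC.toNH F k (PNC.eval F k q) + ∑ j ∈ Finset.range k, xN F k j * b j by
    obtain ⟨b, hb⟩ := h (PNC.ofNH F k n)
    rw [PNC.toNH_ofNH] at hb
    exact ⟨b, hb⟩
  intro q
  induction q using TensorProduct.induction_on with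
  | zero => exact ⟨0, by simp⟩
  | add q q' hq hq' =>
    obtain ⟨b, hb⟩ := hq
    obtain ⟨b', hb'⟩ := hq'
    refine ⟨b + b', ?_⟩
    rw [map_add, map_add, map_add, hb, hb', add_add_add_comm, ← Finset.sum_add_distrib]
    simp only [Pi.add_apply, mul_add]
  | tmul p a =>
    -- A factor on the right can be absorbed in the coefficients `b j`, so only the polynomial has
    -- to be reduced.
    suffices h : ∃ b : ℕ → NH F k, PNC.polyNH F k p =
        algebraMap F _ (MvPolynomial.aeval (0 : Fin k → F) p) +
          ∑ j ∈ Finset.range k, xN F k j * b j by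
      obtain ⟨b, hb⟩ := h
      refine ⟨fun j => b j * NC.toNH F k a, ?_⟩
      rw [PNC.toNH_tmul, PNC.eval_tmul, hb, map_smul, add_mul, Finset.sum_mul, Algebra.smul_def]
      simp only [mul_assoc]
    induction p using MvPolynomial.induction_on with
    | C c => exact ⟨0, by simp [MvPolynomial.algHom_C]⟩
    | add p q hp hq =>
      obtain ⟨b, hb⟩ := hp
      obtain ⟨b', hb'⟩ := hq
      refine ⟨b + b', ?_⟩
      rw [map_add, map_add, map_add, hb, hb', add_add_add_comm, ← Finset.sum_add_distrib]
      simp only [Pi.add_apply, mul_add]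
    | mul_X p j hp =>
      -- The dots commute, so the new variable can be taken out on the left.
      refine ⟨fun i => if i = j then PNC.polyNH F k p else 0, ?_⟩
      rw [mul_comm, map_mul, PNC.polyNH_X, map_mul, MvPolynomial.aeval_X, Pi.zero_apply, zero_mul,
        map_zero, zero_add, Finset.sum_eq_single j.1]
      · rw [xN_of_lt F k j j.2]
        simp
      · intro i _ hi
        simp [hi]
      · intro h
        exact absurd (Finset.mem_range.2 j.2) h

/-- The first `n` variables generate a monomial ideal, in which membership is tested monomial by
monomial; multiplying by another variable does not change the exponents that are tested. -/
theorem X_regular (n : ℕ) (hn : n < k) (p : MvPolynomial (Fin k) F) (b : ℕ → MvPolynomial (Fin k) F)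
    (h : PNC.X F k n * p = ∑ j ∈ Finset.range n, PNC.X F k j * b j) :
    ∃ c : ℕ → MvPolynomial (Fin k) F, p = ∑ j ∈ Finset.range n, PNC.X F k j * c j := by
  let I : Ideal (MvPolynomial (Fin k) F) := Ideal.span (MvPolynomial.X '' {j : Fin k | j.1 < n})
  have hI : ∀ q ∈ I, ∃ c : ℕ → MvPolynomial (Fin k) F, q = ∑ j ∈ Finset.range n, PNC.X F k j * c j := by
    intro q hq
    induction hq using Submodule.span_induction with
    | mem q hq =>
      obtain ⟨j, hj, rfl⟩ := hq
      refine ⟨fun i => if i = j then 1 else 0, ?_⟩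
      rw [Finset.sum_eq_single j.1]
      · rw [PNC.X_of_lt F k j j.2]
        simp
      · intro i _ hi
        simp [hi]
      · intro h
        exact absurd (Finset.mem_range.2 hj) h
    | zero => exact ⟨0, by simp⟩
    | add q q' _ _ hq hq' =>
      obtain ⟨c, rfl⟩ := hq
      obtain ⟨c', rfl⟩ := hq'
      exact ⟨c + c', by simp [mul_add, Finset.sum_add_distrib]⟩
    | smul r q _ hq =>
      obtain ⟨c, rfl⟩ := hq
      exact ⟨fun j => r * c j, by simp [Finset.mul_sum, mul_left_comm]⟩
  apply hI
  have hp : MvPolynomial.X ⟨n, hn⟩ * p ∈ I := by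
    rw [PNC.X_of_lt F k n hn] at h
    rw [h]
    refine Ideal.sum_mem _ fun j hj => Ideal.mul_mem_right _ _ ?_
    have hj := Finset.mem_range.1 hj
    rw [PNC.X_of_lt F k j (by omega)]
    exact Ideal.subset_span ⟨_, hj, rfl⟩
  rw [MvPolynomial.mem_ideal_span_X_image] at hp ⊢
  intro m hm
  obtain ⟨i, hi, hi'⟩ := hp (Finsupp.single ⟨n, hn⟩ 1 + m) (by
    rw [MvPolynomial.mem_support_iff, MvPolynomial.coeff_X_mul]
    exact MvPolynomial.mem_support_iff.1 hm)
  refine ⟨i, hi, ?_⟩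
  have hne : (⟨n, hn⟩ : Fin k) ≠ i := by
    rintro rfl
    exact absurd hi (lt_irrefl n)
  rwa [Finsupp.add_apply, Finsupp.single_eq_of_ne' hne, zero_add] at hi'

/-- The dots form a regular sequence for left multiplication on the nilHecke algebra. -/
theorem xN_regular (n : ℕ) (hn : n < k) (a : NH F k) (b : ℕ → NH F k)
    (h : xN F k n * a = ∑ j ∈ Finset.range n, xN F k j * b j) :
    ∃ c : ℕ → NH F k, a = ∑ j ∈ Finset.range n, xN F k j * c j := by
  -- A basis of the nilCoxeter algebra over `F` is a basis of the tensor product over the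
  -- polynomials, so the claim is the polynomial one in each coordinate.
  let B := Algebra.TensorProduct.basis (MvPolynomial (Fin k) F) (Module.Basis.ofVectorSpace F (NC F k))
  have hpm : ∀ p (q : PNC F k), PNC.poly F k p * q = p • q := fun p q => (Algebra.smul_def p q).symm
  have hsum : ∀ c : ℕ → NH F k, PNC.ofNH F k (∑ j ∈ Finset.range n, xN F k j * c j) =
      ∑ j ∈ Finset.range n, PNC.X F k j • PNC.ofNH F k (c j) := by
    intro c
    have : ∀ m, PNC.ofNH F k m = (AddMonoidHom.mk' (PNC.ofNH F k) fun n m => PNC.actNH_add F k n m 1) m :=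
      fun _ => rfl
    rw [this, map_sum]
    exact Finset.sum_congr rfl fun j _ => by rw [← this, PNC.ofNH_xN_mul, hpm]
  have h1 := congrArg (PNC.ofNH F k) h
  rw [PNC.ofNH_xN_mul, hpm, hsum] at h1
  have h2 : ∀ t, ∃ c : ℕ → MvPolynomial (Fin k) F,
      B.repr (PNC.ofNH F k a) t = ∑ j ∈ Finset.range n, PNC.X F k j * c j := by
    intro t
    apply X_regular F k n hn _ fun j => B.repr (PNC.ofNH F k (b j)) t
    have := DFunLike.congr_fun (congrArg B.repr h1) t
    rw [map_smul, map_sum, Finsupp.finsetSum_apply] at this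
    simpa using this
  choose c hc using h2
  refine ⟨fun j => PNC.toNH F k (∑ t ∈ (B.repr (PNC.ofNH F k a)).support, c t j • B t), ?_⟩
  have h3 := B.linearCombination_repr (PNC.ofNH F k a)
  rw [Finsupp.linearCombination_apply, Finsupp.sum] at h3
  rw [← PNC.toNH_ofNH F k a, ← PNC.toNH_ofNH F k (∑ j ∈ Finset.range n, _), hsum]
  congr 1
  refine h3.symm.trans ?_
  simp only [PNC.ofNH_toNH, Finset.smul_sum]
  rw [Finset.sum_comm]
  refine Finset.sum_congr rfl fun t _ => ?_
  rw [hc, Finset.sum_smul]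
  exact Finset.sum_congr rfl fun j _ => by rw [mul_smul]

end PBW

/-! ### The Koszul complex of the dots acting on the left of the nilHecke algebra. -/

section Koszul

variable (F : Type u) [Field F] (k : ℕ)

/-- The Koszul differential for left multiplication by the first `n` dots. -/
noncomputable def kD (n : ℕ) : (LI F n → NH F k) →+ (LI F n → NH F k) :=
  AddMonoidHom.mk' (fun v b => ∑ j ∈ Finset.range n, xN F k j * ∑ a, raise F n j b a • v a) (by
    intro v w
    funext b
    simp only [Pi.add_apply, smul_add, Finset.sum_add_distrib, mul_add])

variable {F k}

theorem kD_apply (n : ℕ) (v : LI F n → NH F k) (b : LI F n) : kD F k n v b =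
    ∑ j ∈ Finset.range n, xN F k j * ∑ a, raise F n j b a • v a := rfl

theorem raise_last_apply (n : ℕ) (b a : LI F n) (i j : Fin 2) : raise F (n + 1) n (sn b j) (sn a i) =
    parity F n b a * up j i := by
  rw [raise_last, kr_apply]

theorem raise_lt_apply {n j : ℕ} (h : j < n) (b a : LI F n) (i i' : Fin 2) :
    raise F (n + 1) j (sn b i') (sn a i) = raise F n j b a * (1 : Matrix (Fin 2) (Fin 2) ℤ) i' i := by
  rw [raise_lt F (by omega : j ≠ n), kr_apply]

/-- Together with `kD_succ_one`, this presents the complex for `n + 1` dots as the mapping cone of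
multiplication by `x_n` on the complex for `n` dots. -/
theorem kD_succ_zero (n : ℕ) (v : LI F (n + 1) → NH F k) (b : LI F n) :
    kD F k (n + 1) v (sn b 0) = kD F k n (fun a => v (sn a 0)) b := by
  rw [kD_apply, Finset.sum_range_succ, kD_apply]
  simp only [sum_sn, raise_last_apply]
  have : ∀ i, up 0 i = 0 := by decide
  simp only [this, mul_zero, zero_smul, add_zero, Finset.sum_const_zero]
  refine Finset.sum_congr rfl fun j hj => ?_
  simp [raise_lt_apply (Finset.mem_range.1 hj)]

theorem kD_succ_one (n : ℕ) (v : LI F (n + 1) → NH F k) (b : LI F n) :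
    kD F k (n + 1) v (sn b 1) = kD F k n (fun a => v (sn a 1)) b +
      ((Cpx.LPow F n).deg b).negOnePow • (xN F k n * v (sn b 0)) := by
  rw [kD_apply, Finset.sum_range_succ, kD_apply]
  congr 1
  · refine Finset.sum_congr rfl fun j hj => ?_
    simp [sum_sn, raise_lt_apply (Finset.mem_range.1 hj)]
  · simp only [sum_sn, raise_last_apply]
    rw [Finset.sum_eq_single b]
    · rw [parity, Matrix.diagonal_apply_eq]
      rw [show up 1 0 = 1 by decide, show up 1 1 = 0 by decide, mul_one, mul_zero, zero_smul,
        add_zero, ← Units.smul_def, mul_units_smul]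
    · intro a _ ha
      rw [parity, Matrix.diagonal_apply_ne _ ha.symm]
      simp
    · intro h
      exact absurd (Finset.mem_univ _) h

theorem xN_comm (j j' : ℕ) : xN F k j * xN F k j' = xN F k j' * xN F k j := by
  unfold xN
  split_ifs
  · exact NH.x_x F _ _
  all_goals simp

/-- The dots commute and raising operators change the parity of the degree, so multiplication by a
dot, twisted by `(-1)^deg`, anticommutes with the Koszul differential. -/
theorem kD_xN_mul (n m : ℕ) (v : LI F n → NH F k) (b : LI F n) :
    kD F k n (fun a => ((Cpx.LPow F n).deg a).negOnePow • (xN F k m * v a)) b =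
      -(((Cpx.LPow F n).deg b).negOnePow • (xN F k m * kD F k n v b)) := by
  have key : ∀ j, ∑ a, raise F n j b a • ((Cpx.LPow F n).deg a).negOnePow • (xN F k m * v a) =
      -(((Cpx.LPow F n).deg b).negOnePow • (xN F k m * ∑ a, raise F n j b a • v a)) := by
    intro j
    rw [Finset.mul_sum, Finset.smul_sum, ← Finset.sum_neg_distrib]
    refine Finset.sum_congr rfl fun a _ => ?_
    by_cases h : (Cpx.LPow F n).deg b = (Cpx.LPow F n).deg a + 1
    · rw [h, Int.negOnePow_succ, Units.neg_smul, neg_neg, mul_smul_comm, smul_comm]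
    · rw [raise_homog F n j b a h]
      simp
  rw [kD_apply, kD_apply, Finset.mul_sum, Finset.smul_sum, ← Finset.sum_neg_distrib]
  refine Finset.sum_congr rfl fun j _ => ?_
  rw [key, mul_neg, mul_units_smul, ← mul_assoc, ← mul_assoc, xN_comm m j]

theorem kD_single_top (n : ℕ) (x : NH F k) : kD F k n (Pi.single (top F n) x) = 0 := by
  funext b
  rw [kD_apply]
  refine Finset.sum_eq_zero fun j _ => ?_
  rw [Finset.sum_eq_zero, mul_zero]
  intro a _
  by_cases h : a = top F n
  · subst h
    rw [raise_homog F n j, zero_smul]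
    rw [deg_top]
    have := deg_le F n b
    omega
  · rw [Pi.single_eq_of_ne h, smul_zero]

/-- The Koszul complex of the dots on the nilHecke algebra is exact except in the top degree. -/
theorem kD_exact (n : ℕ) (hn : n ≤ k) (v : LI F n → NH F k) (hv : kD F k n v = 0)
    (htop : ∃ c : ℕ → NH F k, v (top F n) = ∑ j ∈ Finset.range n, xN F k j * c j) :
    ∃ w, kD F k n w = v ∧ w (top F n) = 0 := by
  induction n with
  | zero =>
    refine ⟨0, ?_, rfl⟩
    obtain ⟨c, hc⟩ := htop
    rw [map_zero]
    funext b
    have : b = top F 0 := rfl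
    rw [this, hc]
    rfl
  | succ n ih =>
    obtain ⟨c, hc⟩ := htop
    have h0 : ∀ b, kD F k n (fun a => v (sn a 0)) b = 0 := fun b => by
      rw [← kD_succ_zero, hv]; rfl
    have h1 : ∀ b, kD F k n (fun a => v (sn a 1)) b =
        -(((Cpx.LPow F n).deg b).negOnePow • (xN F k n * v (sn b 0))) := fun b => by
      rw [eq_neg_iff_add_eq_zero, ← kD_succ_one, hv]; rfl
    -- At the top entry the cocycle condition puts `x_n * v (sn (top F n) 0)` into the right ideal
    -- of the earlier dots; regularity cancels `x_n`, so this component meets the induction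
    -- hypothesis.
    obtain ⟨w₀, hw₀, hw₀'⟩ := ih (by omega) (fun a => v (sn a 0)) (funext h0) (by
      have hreg : xN F k n * v (sn (top F n) 0) = ∑ j ∈ Finset.range n, xN F k j *
          -(((Cpx.LPow F n).deg (top F n)).negOnePow •
            ∑ a, raise F n j (top F n) a • v (sn a 1)) := by
        have h := h1 (top F n)
        rw [kD_apply] at h
        simp only [mul_neg, mul_units_smul, Finset.sum_neg_distrib, ← Finset.smul_sum]
        rw [h, smul_neg, smul_smul, Int.units_mul_self, one_smul, neg_neg]
      exact xN_regular F k n (by omega) _ _ hreg)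
    -- A top entry can be added to the primitive for free, since it is a cocycle. With this choice
    -- `w₂` contains exactly the term `x_n * c n` of the top entry of `v`, and the difference falls
    -- into the ideal of the earlier dots.
    let e : NH F k := ((Cpx.LPow F n).deg (top F n)).negOnePow • c n
    let w₀' := w₀ + Pi.single (top F n) e
    have hw : kD F k n w₀' = fun a => v (sn a 0) := by
      rw [map_add, kD_single_top, add_zero, hw₀]
    let w₂ : LI F n → NH F k := fun a =>
      ((Cpx.LPow F n).deg a).negOnePow • (xN F k n * w₀' a)
    have hw₂ : kD F k n ((fun a => v (sn a 1)) - w₂) = 0 := by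
      funext b
      rw [map_sub, Pi.sub_apply, kD_xN_mul, h1, hw, sub_self]
      rfl
    have htop₂ : ((fun a => v (sn a 1)) - w₂) (top F n) =
        ∑ j ∈ Finset.range n, xN F k j * c j := by
      have h2 : w₂ (top F n) = xN F k n * c n := by
        show _ • (xN F k n * w₀' (top F n)) = _
        have h3 : w₀' (top F n) = e := by
          show w₀ (top F n) + (Pi.single (top F n) e : LI F n → NH F k) (top F n) = e
          rw [hw₀', Pi.single_eq_same, zero_add]
        rw [h3, mul_units_smul, smul_smul, Int.units_mul_self, one_smul]
      rw [Pi.sub_apply, h2, sub_eq_iff_eq_add, ← Finset.sum_range_succ, ← hc]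
      rfl
    obtain ⟨w₁, hw₁, hw₁'⟩ := ih (by omega) _ hw₂ ⟨c, htop₂⟩
    refine ⟨fun b => if final b = 0 then w₀' (initial b) else w₁ (initial b), ?_, ?_⟩
    · funext b
      obtain ⟨b, i, rfl⟩ := sn_surj b
      rcases fin2_cases i with rfl | rfl
      · rw [kD_succ_zero]
        simp only [final_sn, initial_sn, if_true]
        rw [hw]
      · rw [kD_succ_one]
        simp only [final_sn, initial_sn, if_true, one_ne_zero, if_false]
        rw [hw₁]
        exact sub_add_cancel _ _
    -- The normalization at the top entry serves the induction, and later keeps primitives of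
    -- endomorphisms in the kernel of `topRow`.
    · show (if (1 : Fin 2) = 0 then _ else w₁ (top F n)) = 0
      rw [if_neg one_ne_zero, hw₁']

end Koszul

/-! ### Top rows modulo dots: `ρ_k` is injective and a quasi-isomorphism. -/

section TopRowMap

variable (F : Type u) [Field F] (k : ℕ)

/-- The top row of an endomorphism, with the dots on the left set to zero. -/
noncomputable def topRow : LMat F k (NH F k) →ₗ[F] (LI F k → NC F k) where
  toFun f b := topNC F k (f (top F k) b)
  map_add' _ _ := funext fun _ => map_add (topNC F k) _ _
  map_smul' _ _ := funext fun _ => map_smul (topNC F k) _ _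

theorem topRow_apply (f : LMat F k (NH F k)) (b : LI F k) :
    topRow F k f b = topNC F k (f (top F k) b) := rfl

theorem topNC_sum (c : ℕ → NH F k) : topNC F k (∑ j ∈ Finset.range k, xN F k j * c j) = 0 := by
  rw [map_sum]
  exact Finset.sum_eq_zero fun j _ => topNC_xN_mul F k j _

theorem exists_of_topNC_eq_zero (n : NH F k) (h : topNC F k n = 0) :
    ∃ c : ℕ → NH F k, n = ∑ j ∈ Finset.range k, xN F k j * c j := by
  obtain ⟨c, hc⟩ := exists_eq_toNH_add F k n
  rw [h, map_zero, zero_add] at hc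
  exact ⟨c, hc⟩

/-- The kernel of `topNC` is the right ideal generated by the dots. -/
theorem topNC_mul (n m : NH F k) (h : topNC F k n = 0) : topNC F k (n * m) = 0 := by
  obtain ⟨c, rfl⟩ := exists_of_topNC_eq_zero F k n h
  rw [Finset.sum_mul]
  simp only [mul_assoc]
  exact topNC_sum F k _

theorem D_mul_apply (f : LMat F k (NH F k)) (b a : LI F k) :
    ((Cpx.LPow F k).D * f) b a = kD F k k (fun c => f c a) b := by
  rw [D_eq, Finset.sum_mul, Matrix.sum_apply, kD_apply]
  refine Finset.sum_congr rfl fun j _ => ?_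
  rw [Matrix.mul_apply, Finset.mul_sum]
  refine Finset.sum_congr rfl fun c _ => ?_
  rw [em_apply, smul_mul_assoc, mul_smul_comm]

/-- The kernel of `topRow` is a subcomplex: multiplying by `D` on the left lands in the right ideal
of the dots, and multiplying on the right preserves that ideal. -/
theorem topRow_endD (f : LMat F k (NH F k)) (h : topRow F k f = 0) :
    topRow F k ((Cpx.LPow F k).endD f) = 0 := by
  funext b
  rw [Cpx.endD_apply, map_sub, Pi.sub_apply, topRow_apply, D_mul_apply, kD_apply, topNC_sum, zero_sub,
    topRow_apply, Matrix.mul_apply, map_sum]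
  rw [Finset.sum_eq_zero, neg_zero, Pi.zero_apply]
  intro c _
  apply topNC_mul
  have := congrFun h c
  rw [Cpx.par, Matrix.of_apply, map_units_smul, ← topRow_apply, this, Pi.zero_apply, smul_zero]

theorem par_mul_D_eq_zero (f : LMat F k (NH F k)) (a : LI F k)
    (h : ∀ c, (Cpx.LPow F k).deg c = (Cpx.LPow F k).deg a + 1 → ∀ b, f b c = 0) (b : LI F k) :
    ((Cpx.LPow F k).par f * (Cpx.LPow F k).D) b a = 0 := by
  rw [Matrix.mul_apply]
  refine Finset.sum_eq_zero fun c _ => ?_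
  by_cases hc : (Cpx.LPow F k).deg c = (Cpx.LPow F k).deg a + 1
  · rw [Cpx.par, Matrix.of_apply, h c hc b, smul_zero, zero_mul]
  · rw [(Cpx.LPow F k).D_deg c a hc, mul_zero]

/-- The endomorphisms with vanishing top row form an acyclic complex. -/
theorem exists_endD_of_topRow_eq_zero (f : LMat F k (NH F k)) (hf : (Cpx.LPow F k).endD f = 0)
    (h : topRow F k f = 0) : ∃ g, (Cpx.LPow F k).endD g = f := by
  -- Induction on the degree of the source summands: all columns of degree at least `N` are already
  -- zero.
  suffices key : ∀ N : ℕ, ∀ f, (Cpx.LPow F k).endD f = 0 → topRow F k f = 0 →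
      (∀ a, (N : ℤ) ≤ (Cpx.LPow F k).deg a → ∀ b, f b a = 0) → ∃ g, (Cpx.LPow F k).endD g = f by
    refine key (k + 1) f hf h fun a ha => ?_
    have := deg_le F k a
    push_cast at ha
    omega
  intro N
  induction N with
  | zero =>
    intro f _ _ h
    refine ⟨0, ?_⟩
    rw [map_zero]
    ext b a
    exact (h a (deg_nonneg F k a) b).symm
  | succ N ih =>
    intro f hf htop hcol
    -- For a column of degree `N` the term `f D` involves only columns of degree `N + 1`, which
    -- vanish. So the column is a Koszul cocycle with top entry in the right ideal of the dots, and
    -- `kD_exact` applies.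
    have hex : ∀ a, ∃ w : LI F k → NH F k, w (top F k) = 0 ∧
        ((Cpx.LPow F k).deg a = N → ∀ b, kD F k k w b = f b a) := by
      intro a
      by_cases ha : (Cpx.LPow F k).deg a = N
      · obtain ⟨w, hw, hw'⟩ := kD_exact k le_rfl (fun b => f b a) (by
          funext b
          have h1 := congrFun (congrFun hf b) a
          rw [Cpx.endD_apply, Matrix.sub_apply, D_mul_apply, par_mul_D_eq_zero, sub_zero] at h1
          · exact h1
          · intro c hc
            exact hcol c (by rw [hc, ha]; push_cast; rfl))
          (exists_of_topNC_eq_zero F k _ (congrFun htop a))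
        exact ⟨w, hw', fun _ b => by rw [hw]⟩
      · exact ⟨0, rfl, fun h => absurd h ha⟩
    choose w hw hw' using hex
    let g : LMat F k (NH F k) := Matrix.of fun b a => if (Cpx.LPow F k).deg a = N then w a b else 0
    have hg : topRow F k g = 0 := by
      funext a
      rw [topRow_apply]
      show topNC F k (if _ then w a (top F k) else 0) = 0
      rw [hw, ite_self, map_zero]
    -- Subtracting the boundary of `g` clears the columns of degree `N`; the top row stays zero
    -- because that of `g` is.
    obtain ⟨g', hg'⟩ := ih (f - (Cpx.LPow F k).endD g)
      (by rw [map_sub, hf, zero_sub, neg_eq_zero]; exact (Cpx.LPow F k).End.d_d g)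
      (by rw [map_sub, htop, topRow_endD F k g hg, sub_zero]) (by
        intro a ha b
        rw [Matrix.sub_apply, Cpx.endD_apply, Matrix.sub_apply, D_mul_apply, par_mul_D_eq_zero, sub_zero]
        · by_cases haN : (Cpx.LPow F k).deg a = N
          · have : (fun c => g c a) = w a := funext fun c => if_pos haN
            rw [this, hw' a haN b, sub_self]
          · have : (fun c => g c a) = 0 := funext fun c => if_neg haN
            rw [this, map_zero, hcol a (by push_cast; omega) b]
            exact sub_self _
        · intro c hc b
          exact if_neg (by omega))
    refine ⟨g' + g, ?_⟩
    rw [map_add, hg', sub_add_cancel]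

/-- The odd generators of `R_k^nil`, indexed by natural numbers. -/
noncomputable def xiN (j : ℕ) : RAlg F k := if h : j < k then RNil.xi F ⟨j, h⟩ else 0

theorem xiN_of_lt (j : ℕ) (h : j < k) : xiN F k j = RNil.xi F ⟨j, h⟩ := dif_pos h

theorem xiN_sq (j : ℕ) : xiN F k j * xiN F k j = 0 := by
  unfold xiN
  split_ifs
  · exact RNil.xi_sq F _
  · exact mul_zero _

theorem xiN_anti (j j' : ℕ) : xiN F k j * xiN F k j' = -(xiN F k j' * xiN F k j) := by
  by_cases hjj : j = j'
  · rw [hjj, xiN_sq, neg_zero]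
  unfold xiN
  split_ifs
  · exact RNil.xi_xi F _ _ (by simpa using hjj)
  all_goals simp

theorem xiN_s (i : ℕ) (h : i + 1 < k) (j : ℕ) (hj : j < k) :
    xiN F k j * RNil.s F i h = RNil.s F i h * xiN F k (tr i j) := by
  rw [xiN_of_lt F k j hj, xiN_of_lt F k _ (tr_lt h hj)]
  by_cases h1 : j = i
  · subst h1
    rw [← RNil.s_xi_right F j hj h]
    simp [tr]
  · by_cases h2 : j = i + 1
    · subst h2
      rw [← RNil.s_xi_left F i (by omega) h]
      simp [tr]
    · rw [← RNil.s_xi F i j h hj h1 h2]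
      simp [tr, h1, h2]

/-- Each flip contributes `-1` on the top row, and the sign built into `toR` cancels it. -/
theorem rhoAlg_toR_top (a : NC F k) (b : LI F k) : rhoAlg F k (NC.toR F k a) (top F k) b =
    (1 : LMat F k ℤ) (top F k) b • NC.toNH F k a := by
  induction a using NC.induction_right generalizing b with
  | one =>
    rw [map_one, map_one, map_one, ← em_one]
    rfl
  | gen i h a ha =>
    rw [map_mul, NC.toR_s, mul_neg, map_neg, map_mul, RNil.s, rhoAlg_gen, rhoGen, Matrix.neg_apply,
      Matrix.mul_apply, map_mul, NC.toNH_s]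
    simp only [ha, em_apply, smul_mul_smul_comm]
    rw [← Finset.sum_smul]
    have := mul_flip_top F k i h 1 1 (fun b => (one_mul _).symm) b
    rw [Matrix.mul_apply] at this
    rw [this, neg_one_mul, neg_smul, neg_neg]
  | add a a' ha ha' =>
    rw [map_add, map_add, map_add, Matrix.add_apply, ha, ha', smul_add]
  | smul c a ha =>
    rw [map_smul, map_smul, map_smul, Matrix.smul_apply, ha, smul_comm]

/-- `M ↦ 1 ⊗ M` as a ring homomorphism. -/
noncomputable def emOne : LMat F k ℤ →+* LMat F k (NH F k) where
  toFun M := em 1 M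
  map_one' := em_one
  map_mul' M N := by rw [em_mul, mul_one]
  map_zero' := em_zero_right 1
  map_add' M N := by
    ext b a
    exact add_smul (M b a) (N b a) (1 : NH F k)

theorem rhoAlg_mono (S : LI F k) : rhoAlg F k (mono F (xiN F k) k S) = em 1 (mono F (raise F k) k S) := by
  have h1 := map_mono F (rhoAlg F k : RAlg F k →+* LMat F k (NH F k)) (xiN F k) k S
  have h2 := map_mono F (emOne F k) (raise F k) k S
  refine h1.trans (Eq.trans ?_ h2.symm)
  refine mono_congr F _ _ k (fun j hj => ?_) S
  rw [xiN_of_lt F k j hj]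
  exact rhoAlg_gen F k (Gen.dot ⟨j, hj⟩)

/-- The crossings fix the top summand, and the monomial reaches it from the complementary summand
only. Thus different monomials occupy different columns of the top row. -/
theorem exists_topRow_eq (S : LI F k) : ∃ u : ℤˣ, ∀ (a : NC F k) b,
    topRow F k (rhoAlg F k (NC.toR F k a * mono F (xiN F k) k S)) b =
      if b = compl F k S then u • a else 0 := by
  obtain ⟨u, hu⟩ := mono_raise_top F k S
  refine ⟨u, fun a b => ?_⟩
  rw [topRow_apply, map_mul, rhoAlg_mono, Matrix.mul_apply, Finset.sum_eq_single (top F k)]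
  · rw [rhoAlg_toR_top, Matrix.one_apply_eq, one_smul, em_apply, hu, mul_smul_comm, mul_one, map_zsmul,
      topNC_toNH]
    split_ifs
    · rfl
    · exact zero_smul _ _
  · intro c _ hc
    rw [rhoAlg_toR_top, Matrix.one_apply_ne hc.symm, zero_smul, zero_mul]
  · intro h
    exact absurd (Finset.mem_univ _) h

/-- `R_k^nil` is spanned by the products of nilCoxeter elements and monomials in the odd generators. -/
theorem exists_eq_sum_toR_mul_mono (r : RAlg F k) : ∃ a : LI F k → NC F k,
    r = ∑ S, NC.toR F k (a S) * mono F (xiN F k) k S := by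
  let P : RAlg F k → Prop := fun r => ∃ a : LI F k → NC F k,
    r = ∑ S, NC.toR F k (a S) * mono F (xiN F k) k S
  have hadd : ∀ r r', P r → P r' → P (r + r') := by
    rintro _ _ ⟨a, rfl⟩ ⟨a', rfl⟩
    exact ⟨a + a', by simp only [Pi.add_apply, map_add, add_mul, Finset.sum_add_distrib]⟩
  have hsmul : ∀ (c : F) r, P r → P (c • r) := by
    rintro c _ ⟨a, rfl⟩
    exact ⟨c • a, by simp only [Pi.smul_apply, map_smul, smul_mul_assoc, Finset.smul_sum]⟩
  have hzero : P 0 := ⟨0, by simp⟩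
  have hmul : ∀ a r, P r → P (NC.toR F k a * r) := by
    rintro a _ ⟨b, rfl⟩
    exact ⟨fun S => a * b S, by simp only [map_mul, mul_assoc, Finset.mul_sum]⟩
  have hspan : ∀ m ∈ Submodule.span F (Set.range (mono F (xiN F k) k)), P m := by
    intro m hm
    induction hm using Submodule.span_induction with
    | mem m hm =>
      obtain ⟨S, rfl⟩ := hm
      refine ⟨Pi.single S 1, ?_⟩
      rw [Finset.sum_eq_single S]
      · rw [Pi.single_eq_same, map_one, one_mul]
      · intro T _ hT
        rw [Pi.single_eq_of_ne hT, map_zero, zero_mul]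
      · intro h
        exact absurd (Finset.mem_univ _) h
    | zero => exact hzero
    | add m m' _ _ hm hm' => exact hadd _ _ hm hm'
    | smul c m _ hm => exact hsmul c _ hm
  have hleft : ∀ j < k, ∀ m ∈ Submodule.span F (Set.range (mono F (xiN F k) k)),
      xiN F k j * m ∈ Submodule.span F (Set.range (mono F (xiN F k) k)) := by
    intro j hj m hm
    induction hm using Submodule.span_induction with
    | mem m hm =>
      obtain ⟨S, rfl⟩ := hm
      exact mul_mono_mem F _ k (fun j _ => xiN_sq F k j) (fun i _ j _ _ => xiN_anti F k i j) j hj S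
    | zero => rw [mul_zero]; exact zero_mem _
    | add m m' _ _ hm hm' => rw [mul_add]; exact add_mem hm hm'
    | smul c m _ hm => rw [mul_smul_comm]; exact Submodule.smul_mem _ c hm
  -- A dot passes through a nilCoxeter element with its index permuted and then joins the monomial.
  have hxi : ∀ (a : NC F k) j, j < k → ∀ m ∈ Submodule.span F (Set.range (mono F (xiN F k) k)),
      P (xiN F k j * (NC.toR F k a * m)) := by
    intro a
    induction a using NC.induction_left with
    | one =>
      intro j hj m hm
      rw [map_one, one_mul]
      exact hspan _ (hleft j hj m hm)
    | gen i h a ha =>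
      intro j hj m hm
      rw [map_mul, NC.toR_s, neg_mul, neg_mul, mul_neg, mul_assoc, ← mul_assoc, xiN_s F k i h j hj,
        mul_assoc, ← neg_mul, ← NC.toR_s]
      exact hmul _ _ (ha _ (tr_lt h hj) m hm)
    | add a a' ha ha' =>
      intro j hj m hm
      rw [map_add, add_mul, mul_add]
      exact hadd _ _ (ha j hj m hm) (ha' j hj m hm)
    | smul c a ha =>
      intro j hj m hm
      rw [map_smul, smul_mul_assoc, mul_smul_comm]
      exact hsmul c _ (ha j hj m hm)
  have hsum : ∀ (s : Finset (LI F k)) (f : LI F k → RAlg F k), (∀ S, P (f S)) → P (∑ S ∈ s, f S) :=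
    fun s f hf => Finset.sum_induction f P hadd hzero fun S _ => hf S
  induction r using Pres.induction_left with
  | one => exact hspan _ (one_mem_span_mono F _ k)
  | gen g r hr =>
    cases g with
    | cross i h =>
      have := hmul (-NC.s F i h) r hr
      rwa [map_neg, NC.toR_s, neg_neg] at this
    | dot j =>
      obtain ⟨a, rfl⟩ := hr
      rw [Finset.mul_sum]
      refine hsum _ _ fun S => ?_
      have := hxi (a S) j j.2 (mono F (xiN F k) k S) (Submodule.subset_span ⟨S, rfl⟩)
      rw [xiN_of_lt F k j j.2] at this
      exact this
  | add r r' hr hr' => exact hadd _ _ hr hr'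
  | smul c r hr => exact hsmul c r hr

/-- `R_k^nil` is identified with the top rows of endomorphisms modulo the dots. -/
theorem topRow_rhoAlg_bijective : Function.Bijective fun r => topRow F k (rhoAlg F k r) := by
  choose u hu using exists_topRow_eq F k
  have key : ∀ (a : LI F k → NC F k) b, topRow F k (rhoAlg F k
      (∑ S, NC.toR F k (a S) * mono F (xiN F k) k S)) b = u (compl F k b) • a (compl F k b) := by
    intro a b
    rw [map_sum, map_sum, Finset.sum_apply, Finset.sum_eq_single (compl F k b)]
    · rw [hu, compl_compl, if_pos rfl]
    · intro S _ hS
      rw [hu, if_neg]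
      rintro rfl
      exact hS (compl_compl F k S).symm
    · intro h
      exact absurd (Finset.mem_univ _) h
  constructor
  · have : Function.Injective ((topRow F k).comp (rhoAlg F k).toLinearMap) := by
      rw [← LinearMap.ker_eq_bot, LinearMap.ker_eq_bot']
      intro r hr
      obtain ⟨a, rfl⟩ := exists_eq_sum_toR_mul_mono F k r
      have ha : a = 0 := by
        funext S
        have := congrFun hr (compl F k S)
        rw [LinearMap.comp_apply, AlgHom.toLinearMap_apply, key, compl_compl, Pi.zero_apply,
          Units.smul_def] at this
        rcases Int.units_eq_one_or (u S) with h | h <;> rw [h] at this <;> simpa using this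
      simp [ha]
    exact this
  · intro t
    refine ⟨∑ S, NC.toR F k (u S • t (compl F k S)) * mono F (xiN F k) k S, ?_⟩
    funext b
    refine (key (fun S => u S • t (compl F k S)) b).trans ?_
    rw [smul_smul, Int.units_mul_self, one_smul, compl_compl]

theorem rhoAlg_injective : Function.Injective (rhoAlg F k) := fun _ _ h =>
  (topRow_rhoAlg_bijective F k).1 (congrArg (topRow F k) h)

/-- Because the kernel of `topRow` is a subcomplex, cocycles and primitives among endomorphisms can
be transported to `R_k^nil` by choosing the element with the same top row. -/
theorem topRow_rhoAlg_d_eq (r : RAlg F k) (f : LMat F k (NH F k))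
    (h : topRow F k (rhoAlg F k r) = topRow F k f) :
    topRow F k (rhoAlg F k (RNil.d F k r)) = topRow F k ((Cpx.LPow F k).endD f) := by
  have := topRow_endD F k (rhoAlg F k r - f) (by rw [map_sub, h, sub_self])
  rwa [map_sub, map_sub, sub_eq_zero, ← rhoAlg_d] at this

/-- `R_k^nil` is the quotient of the endomorphism complex by the acyclic kernel of `topRow`. A
primitive yields one in `R_k^nil` with the same top row, and a cocycle differs from the image of the
element with its top row by a cocycle in the kernel. -/
theorem rho_isQuasiIso : (rho F k).IsQuasiIso := by
  constructor
  · intro x y hxy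
    rw [← sub_eq_zero] at hxy ⊢
    rw [← map_sub] at hxy
    obtain ⟨z, hz⟩ := Ideal.Quotient.mk_surjective (x - y)
    rw [← hz] at hxy ⊢
    obtain ⟨g, hg⟩ := ((Cpx.LPow F k).End.cls_eq_zero_iff ((rho F k).mapCocycles z)).1 hxy
    replace hg : (Cpx.LPow F k).endD g = rhoAlg F k z.1 := hg
    obtain ⟨r, hr⟩ := (topRow_rhoAlg_bijective F k).2 (topRow F k g)
    refine ((Rnil F k).cls_eq_zero_iff z).2 ⟨r, ?_⟩
    apply (topRow_rhoAlg_bijective F k).1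
    show topRow F k (rhoAlg F k (RNil.d F k r)) = topRow F k (rhoAlg F k z.1)
    rw [topRow_rhoAlg_d_eq F k r g hr, hg]
  · intro y
    obtain ⟨f, rfl⟩ := Ideal.Quotient.mk_surjective y
    obtain ⟨f', hf'⟩ : ∃ f' : LMat F k (NH F k), f' = f.1 := ⟨_, rfl⟩
    have hf : (Cpx.LPow F k).endD f' = 0 := by rw [hf']; exact f.2
    obtain ⟨r, hr⟩ := (topRow_rhoAlg_bijective F k).2 (topRow F k f')
    have hd : RNil.d F k r = 0 := by
      apply (topRow_rhoAlg_bijective F k).1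
      show topRow F k (rhoAlg F k (RNil.d F k r)) = topRow F k (rhoAlg F k 0)
      rw [topRow_rhoAlg_d_eq F k r f' hr, hf, map_zero, map_zero, map_zero]
    obtain ⟨g, hg⟩ := exists_endD_of_topRow_eq_zero F k (rhoAlg F k r - f')
      (by rw [map_sub, ← rhoAlg_d, hd, map_zero, hf, sub_zero])
      (by rw [map_sub, sub_eq_zero]; exact hr)
    refine ⟨(Rnil F k).cls ⟨r, hd⟩, ?_⟩
    show (Cpx.LPow F k).End.cls ((rho F k).mapCocycles ⟨r, hd⟩) = (Cpx.LPow F k).End.cls f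
    rw [← sub_eq_zero, ← map_sub]
    refine ((Cpx.LPow F k).End.cls_eq_zero_iff _).2 ⟨g, ?_⟩
    rw [hf'] at hg
    exact hg

end TopRowMap

/-! ### Conjugation by products of `1 + w_i`, for `w_i` satisfying the nilCoxeter relations. -/

section Conjugation

variable {B : Type*} [Ring B]

/-- The product `(1 + w_{n-1}) ⋯ (1 + w_0)`. -/
def descProd (w : ℕ → B) : ℕ → B
  | 0 => 1
  | n + 1 => (1 + w n) * descProd w n

/-- The product `(1 - w_0) ⋯ (1 - w_{n-1})`. -/
def ascProd (w : ℕ → B) : ℕ → B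
  | 0 => 1
  | n + 1 => ascProd w n * (1 - w n)

variable {w : ℕ → B}

theorem descProd_mul_ascProd (hsq : ∀ i, w i * w i = 0) (n : ℕ) :
    descProd w n * ascProd w n = 1 := by
  induction n with
  | zero => exact one_mul 1
  | succ n ih =>
    rw [descProd, ascProd, mul_assoc, ← mul_assoc (descProd w n), ih, one_mul, mul_sub, mul_one,
      add_mul, hsq, one_mul, add_zero, add_sub_cancel_right]

theorem ascProd_mul_descProd (hsq : ∀ i, w i * w i = 0) (n : ℕ) :
    ascProd w n * descProd w n = 1 := by
  induction n with
  | zero => exact one_mul 1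
  | succ n ih =>
    rw [descProd, ascProd, mul_assoc, ← mul_assoc (1 - w n), mul_add, mul_one, sub_mul, hsq,
      one_mul, sub_zero, sub_add_cancel, one_mul, ih]

theorem commute_descProd {b : B} (n : ℕ) (h : ∀ i < n, Commute b (w i)) :
    Commute b (descProd w n) := by
  induction n with
  | zero => exact Commute.one_right b
  | succ n ih =>
    exact ((Commute.one_right b).add_right (h n n.lt_succ_self)).mul_right
      (ih fun i hi => h i (hi.trans n.lt_succ_self))

/-- The infinitesimal form of the Fomin–Stanley commutation of such products. In the induction step
the new element fails to commute only with its neighbour, and the braid relation absorbs that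
commutator. -/
theorem sum_commute_descProd (hsq : ∀ i, w i * w i = 0)
    (hbraid : ∀ i, w i * w (i + 1) * w i = w (i + 1) * w i * w (i + 1))
    (hfar : ∀ i j, i + 1 < j → w i * w j = w j * w i) (n : ℕ) :
    Commute (∑ i ∈ Finset.range n, w i) (descProd w n) := by
  induction n with
  | zero => exact Commute.one_right _
  | succ n ih =>
    rw [Finset.sum_range_succ]
    cases n with
    | zero => simp [descProd, Commute, SemiconjBy, mul_add, add_mul]
    | succ n =>
      have hS : Commute (∑ i ∈ Finset.range n, w i) (w (n + 1)) :=
        Commute.sum_left _ _ _ fun i hi => hfar i (n + 1) (by have := Finset.mem_range.1 hi; omega)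
      have hg : Commute (w (n + 1)) (descProd w n) :=
        commute_descProd n fun i hi => (hfar i (n + 1) (by omega)).symm
      have h1 : (∑ i ∈ Finset.range (n + 1), w i) * w (n + 1) -
          w (n + 1) * (∑ i ∈ Finset.range (n + 1), w i) = w n * w (n + 1) - w (n + 1) * w n := by
        rw [Finset.sum_range_succ, add_mul, mul_add, hS.eq]
        abel
      -- The local identity that uses the braid relation: corrected by the commutator, `w (n + 1)`
      -- moves across the last two factors.
      have h2 : (w (n + 1) + (w n * w (n + 1) - w (n + 1) * w n)) * (1 + w n) =
          (1 + w (n + 1)) * (1 + w n) * w (n + 1) := by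
        have := hbraid n
        have h3 := hsq n
        have h4 := hsq (n + 1)
        simp only [add_mul, mul_add, one_mul, mul_one, sub_mul, this]
        rw [mul_assoc (w (n + 1)) (w n) (w n), h3, h4, mul_zero]
        abel
      have h5 : w (n + 1) * descProd w (n + 1) + (w n * w (n + 1) - w (n + 1) * w n) *
          descProd w (n + 1) = (1 + w (n + 1)) * descProd w (n + 1) * w (n + 1) := by
        rw [← add_mul, descProd, ← mul_assoc, h2, mul_assoc, hg.eq, ← mul_assoc, ← mul_assoc]
      have h6 := ih.eq
      set S := ∑ i ∈ Finset.range (n + 1), w i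
      set b := w (n + 1)
      set g := descProd w (n + 1)
      show (S + b) * ((1 + b) * g) = (1 + b) * g * (S + b)
      rw [mul_add ((1 + b) * g), ← h5, ← h1, mul_assoc (1 + b) g S, ← h6]
      have h4 := hsq (n + 1)
      change b * b = 0 at h4
      simp only [add_mul, mul_add, one_mul, sub_mul, ← mul_assoc, h4, zero_mul]
      abel

/-- The conjugate of `ξ` by `(1 + w_{n-1}) ⋯ (1 + w_0)`. -/
def conjDesc (w : ℕ → B) (ξ : B) (n : ℕ) : B := descProd w n * ξ * ascProd w n

variable {ξ : B}

/-- Only `w 0` interacts with `ξ`: the first conjugation gives `ξ + [w 0, ξ]`, which anticommutes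
with `ξ`, and the later factors commute with `ξ`, so conjugating by them preserves this. -/
theorem conjDesc_anti (hξ : ξ * ξ = 0) (h0 : w 0 * ξ * w 0 = 0) (hc : ∀ i, Commute (w (i + 1)) ξ) (n : ℕ) :
    ξ * conjDesc w ξ n + conjDesc w ξ n * ξ = 0 := by
  rcases n with _ | n
  · simp [conjDesc, descProd, ascProd, hξ]
  induction n with
  | zero =>
    have : conjDesc w ξ (0 + 1) = ξ + (w 0 * ξ - ξ * w 0) := by
      simp only [conjDesc, descProd, ascProd, mul_one, one_mul, add_mul, mul_sub, h0]
      abel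
    rw [this]
    simp only [mul_add, add_mul, mul_sub, sub_mul, hξ, ← mul_assoc, zero_mul]
    rw [mul_assoc (w 0), hξ, mul_zero]
    abel
  | succ n ih =>
    have e : conjDesc w ξ (n + 1 + 1) =
        (1 + w (n + 1)) * conjDesc w ξ (n + 1) * (1 - w (n + 1)) := by
      simp only [conjDesc, descProd, ascProd, mul_assoc]
    have e1 : Commute (1 + w (n + 1)) ξ := (Commute.one_left ξ).add_left (hc n)
    have e2 : Commute (1 - w (n + 1)) ξ := (Commute.one_left ξ).sub_left (hc n)
    rw [e, mul_assoc, mul_assoc, ← mul_assoc ξ, ← e1.eq, mul_assoc, mul_assoc, e2.eq,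
      ← mul_assoc ξ, ← mul_assoc (conjDesc w ξ (n + 1)) ξ, ← mul_add, ← add_mul, ih, zero_mul,
      mul_zero]

/-- With `g` the product and `S` the sum, `g ξ - ξ g = g [S, ξ]`. Multiplying by the inverse of `g`
on the right, and using that `S` commutes with `g`, gives an equation whose iteration expands the
conjugate in nested commutators with `S`. -/
theorem conjDesc_eq (hsq : ∀ i, w i * w i = 0)
    (hbraid : ∀ i, w i * w (i + 1) * w i = w (i + 1) * w i * w (i + 1))
    (hfar : ∀ i j, i + 1 < j → w i * w j = w j * w i)
    (h0 : w 0 * ξ * w 0 = 0) (hc : ∀ i, Commute (w (i + 1)) ξ) (n : ℕ) :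
    conjDesc w ξ n = ξ + ((∑ i ∈ Finset.range n, w i) * conjDesc w ξ n -
      conjDesc w ξ n * ∑ i ∈ Finset.range n, w i) := by
  have hS := (sum_commute_descProd hsq hbraid hfar n).eq
  have hinv := descProd_mul_ascProd hsq n
  have hinv' := ascProd_mul_descProd hsq n
  have key : descProd w n * ξ - ξ * descProd w n = descProd w n *
      ((∑ i ∈ Finset.range n, w i) * ξ - ξ * ∑ i ∈ Finset.range n, w i) := by
    clear hS hinv hinv'
    rcases n with _ | n
    · simp [descProd]
    -- All summands beyond `w 0` commute with `ξ`.
    have e : (∑ i ∈ Finset.range (n + 1), w i) * ξ - ξ * ∑ i ∈ Finset.range (n + 1), w i =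
        w 0 * ξ - ξ * w 0 := by
      rw [Finset.sum_range_succ', add_mul, mul_add, Finset.sum_mul, Finset.mul_sum,
        Finset.sum_congr rfl fun i _ => (hc i).eq]
      abel
    rw [e]
    clear e
    induction n with
    | zero =>
      simp only [descProd, mul_one, add_mul, mul_sub, mul_add, one_mul, ← mul_assoc, hsq, zero_mul,
        h0]
      abel
    | succ n ih =>
      rw [descProd, mul_assoc _ _ (_ - _), ← ih, mul_sub, mul_assoc, ← mul_assoc ξ,
        ← ((Commute.one_left ξ).add_left (hc n)).eq, mul_assoc]
  have hS' : ascProd w n * ∑ i ∈ Finset.range n, w i =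
      (∑ i ∈ Finset.range n, w i) * ascProd w n := by
    calc _ = ascProd w n * ((∑ i ∈ Finset.range n, w i) * descProd w n) * ascProd w n := by
          rw [mul_assoc, mul_assoc, hinv, mul_one]
      _ = _ := by rw [hS, ← mul_assoc, hinv', one_mul]
  have h1 := congrArg (· * ascProd w n) key
  simp only [sub_mul, mul_sub] at h1
  rw [mul_assoc ξ, hinv, mul_one, sub_eq_iff_eq_add'] at h1
  rw [conjDesc, mul_assoc _ (ascProd w n), hS']
  simp only [← mul_assoc] at h1 ⊢
  rw [hS]
  exact h1

end Conjugation

/-! ### The anticommuting cocycles `η_m`. -/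

section Eta

variable (F : Type u) [Field F] (k : ℕ)

/-- The generator `s_i` of `R_k^nil`, or zero when there is none. -/
noncomputable def sN (i : ℕ) : RAlg F k := if h : i + 1 < k then RNil.s F i h else 0

theorem sN_of_lt (i : ℕ) (h : i + 1 < k) : sN F k i = RNil.s F i h := dif_pos h

theorem sN_of_not_lt (i : ℕ) (h : ¬ i + 1 < k) : sN F k i = 0 := dif_neg h

theorem xiN_of_not_lt (i : ℕ) (h : ¬ i < k) : xiN F k i = 0 := dif_neg h

theorem sN_sq (i : ℕ) : sN F k i * sN F k i = 0 := by
  unfold sN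
  split_ifs
  · exact RNil.s_sq F _ _
  · exact mul_zero _

theorem sN_braid (i : ℕ) :
    sN F k i * sN F k (i + 1) * sN F k i = sN F k (i + 1) * sN F k i * sN F k (i + 1) := by
  by_cases h : i + 1 + 1 < k
  · rw [sN_of_lt F k _ h, sN_of_lt F k i (by omega)]
    exact RNil.braid F _ _ _
  · rw [sN_of_not_lt F k _ h, mul_zero, zero_mul, mul_zero]

theorem sN_far (i j : ℕ) (hij : i + 1 < j) : sN F k i * sN F k j = sN F k j * sN F k i := by
  by_cases h : j + 1 < k
  · rw [sN_of_lt F k _ h, sN_of_lt F k i (by omega)]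
    exact RNil.far F _ _ _ _ hij
  · rw [sN_of_not_lt F k _ h, mul_zero, zero_mul]

theorem xiN_sN_self (i : ℕ) : xiN F k i * sN F k i = sN F k i * xiN F k (i + 1) := by
  by_cases h : i + 1 < k
  · rw [sN_of_lt F k _ h, xiN_of_lt F k _ h, xiN_of_lt F k i (by omega)]
    exact (RNil.s_xi_right F _ _ h).symm
  · rw [sN_of_not_lt F k _ h, mul_zero, zero_mul]

theorem xiN_sN_succ (i : ℕ) : xiN F k (i + 1) * sN F k i = sN F k i * xiN F k i := by
  by_cases h : i + 1 < k
  · rw [sN_of_lt F k _ h, xiN_of_lt F k _ h, xiN_of_lt F k i (by omega)]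
    exact (RNil.s_xi_left F _ _ h).symm
  · rw [sN_of_not_lt F k _ h, mul_zero, zero_mul]

theorem xiN_sN (i j : ℕ) (h1 : j ≠ i) (h2 : j ≠ i + 1) :
    xiN F k j * sN F k i = sN F k i * xiN F k j := by
  by_cases h : i + 1 < k
  · by_cases hj : j < k
    · rw [sN_of_lt F k _ h, xiN_of_lt F k _ hj]
      exact (RNil.s_xi F _ _ h hj h1 h2).symm
    · rw [xiN_of_not_lt F k _ hj, mul_zero, zero_mul]
  · rw [sN_of_not_lt F k _ h, mul_zero, zero_mul]

theorem sN_mem (i : ℕ) : sN F k i ∈ RNil.gr F k (0, -2) := by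
  by_cases h : i + 1 < k
  · rw [sN_of_lt F k i h]
    exact gen_mem (RRel F k) (rDeg k) (Gen.cross i h)
  · rw [sN_of_not_lt F k i h]
    exact Submodule.zero_mem _

theorem xiN_mem (i : ℕ) : xiN F k i ∈ RNil.gr F k (1, -2) := by
  by_cases h : i < k
  · rw [xiN_of_lt F k i h]
    exact gen_mem (RRel F k) (rDeg k) (Gen.dot ⟨i, h⟩)
  · rw [xiN_of_not_lt F k i h]
    exact Submodule.zero_mem _

theorem d_xiN (i : ℕ) : RNil.d F k (xiN F k i) = 0 := by
  unfold xiN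
  split_ifs
  · exact RNil.d_xi F k _
  · exact map_zero _

theorem d_sN (i : ℕ) (h : i + 1 < k) : RNil.d F k (sN F k i) = xiN F k i - xiN F k (i + 1) := by
  rw [sN_of_lt F k _ h, xiN_of_lt F k _ h, xiN_of_lt F k i (by omega)]
  exact RNil.d_s F k i h

/-- The sum of the crossings. -/
noncomputable def sSum : RAlg F k := ∑ i ∈ Finset.range k, sN F k i

theorem sSum_mem : sSum F k ∈ RNil.gr F k (0, -2) := Submodule.sum_mem _ fun i _ => sN_mem F k i

theorem d_sSum (hk : 0 < k) : RNil.d F k (sSum F k) = xiN F k 0 - xiN F k (k - 1) := by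
  obtain ⟨k, rfl⟩ : ∃ m, k = m + 1 := ⟨k - 1, by omega⟩
  rw [sSum, Finset.sum_range_succ, sN_of_not_lt F _ k (by omega), add_zero, map_sum,
    Finset.sum_congr rfl fun i hi => d_sN F (k + 1) i (by have := Finset.mem_range.1 hi; omega),
    Finset.sum_range_sub', Nat.add_sub_cancel]

/-- The cocycles `[S, [S, … [S, ξ_0]]]`, where `S` is the sum of the crossings. -/
noncomputable def eta : ℕ → RAlg F k
  | 0 => xiN F k 0
  | m + 1 => sSum F k * eta m - eta m * sSum F k

theorem eta_mem (m : ℕ) : eta F k m ∈ RNil.gr F k (1, -2 * ((m : ℤ) + 1)) := by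
  induction m with
  | zero => exact xiN_mem F k 0
  | succ m ih =>
    have h1 := SetLike.GradedMul.mul_mem (A := RNil.gr F k) (sSum_mem F k) ih
    have h2 := SetLike.GradedMul.mul_mem (A := RNil.gr F k) ih (sSum_mem F k)
    have e1 : ((0, -2) + (1, -2 * ((m : ℤ) + 1)) : ℤ × ℤ) = (1, -2 * (((m + 1 : ℕ) : ℤ) + 1)) := by
      ext <;> simp; ring
    rw [add_comm] at h2
    rw [e1] at h1 h2
    exact Submodule.sub_mem _ h1 h2

-- By `conjDesc_eq`, the generating function `Σ η_m t^m` is the conjugate of `ξ_0` by the product of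
-- the `1 + t s_i`, and by `conjDesc_anti` this conjugate anticommutes with `ξ_0`. The variable `t`
-- separates the individual `η_m`.
open Polynomial in
theorem xiN_zero_eta (m : ℕ) : xiN F k 0 * eta F k m + eta F k m * xiN F k 0 = 0 := by
  let w : ℕ → (RAlg F k)[X] := fun i => C (sN F k i) * X
  have hw : ∀ i j, w i * w j = C (sN F k i * sN F k j) * X ^ 2 := fun i j => by
    simp only [w]
    rw [mul_assoc, ← mul_assoc X, X_mul, map_mul]
    simp only [mul_assoc, pow_two]
  have hw3 : ∀ i j l, w i * w j * w l = C (sN F k i * sN F k j * sN F k l) * X ^ 3 := fun i j l => by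
    rw [hw]
    simp only [w]
    rw [mul_assoc, ← mul_assoc (X ^ 2), X_pow_mul, map_mul _ _ (sN F k l)]
    simp only [mul_assoc, pow_succ]
  have hsq : ∀ i, w i * w i = 0 := fun i => by rw [hw, sN_sq, map_zero, zero_mul]
  have hbraid : ∀ i, w i * w (i + 1) * w i = w (i + 1) * w i * w (i + 1) := fun i => by
    rw [hw3, hw3, sN_braid]
  have hfar : ∀ i j, i + 1 < j → w i * w j = w j * w i := fun i j h => by
    rw [hw, hw, sN_far F k i j h]
  have hwx : ∀ i, w i * C (xiN F k 0) = C (sN F k i * xiN F k 0) * X := fun i => by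
    simp only [w]
    rw [mul_assoc, X_mul, map_mul, mul_assoc]
  have h0 : w 0 * C (xiN F k 0) * w 0 = 0 := by
    rw [hwx]
    simp only [w]
    rw [mul_assoc, ← mul_assoc X, X_mul, ← mul_assoc, ← mul_assoc, ← map_mul, ← xiN_sN_succ,
      mul_assoc (xiN F k (0 + 1)), sN_sq, mul_zero, map_zero, zero_mul, zero_mul]
  have hc : ∀ i, Commute (w (i + 1)) (C (xiN F k 0)) := fun i => by
    show _ = _
    rw [hwx, ← xiN_sN F k (i + 1) 0 (by omega) (by omega), map_mul, mul_assoc]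
  have hξ : C (xiN F k 0) * C (xiN F k 0) = 0 := by rw [← map_mul, xiN_sq, map_zero]
  have hS : ∑ i ∈ Finset.range k, w i = C (sSum F k) * X := by
    rw [sSum, map_sum, Finset.sum_mul]
  have h1 := conjDesc_anti hξ h0 hc k
  have h2 := conjDesc_eq hsq hbraid hfar h0 hc k
  rw [hS] at h2
  set f := conjDesc w (C (xiN F k 0)) k
  -- The equation `f = ξ_0 + t [S, f]` determines the coefficients by the same recursion as `eta`.
  have h3 : ∀ m, f.coeff m = eta F k m := by
    intro m
    induction m with
    | zero =>
      rw [h2, mul_assoc, X_mul, ← mul_assoc, ← mul_assoc, ← sub_mul]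
      simp [eta]
    | succ m ih =>
      rw [h2, mul_assoc, X_mul, ← mul_assoc, ← mul_assoc, ← sub_mul, coeff_add, coeff_C_succ,
        zero_add, coeff_mul_X, coeff_sub, coeff_C_mul, coeff_mul_C, ih, eta]
  have h4 := congrArg (fun p => coeff p m) h1
  simpa [h3] using h4

/-- Commutation with `S` is a derivation: the anticommutator of `η_{a+1}` and `η_b` is `[S, -]` of
that of `η_a` and `η_b`, minus that of `η_a` and `η_{b+1}`. This reduces everything to `a = 0`. -/
theorem eta_anti (a b : ℕ) : eta F k a * eta F k b + eta F k b * eta F k a = 0 := by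
  induction a generalizing b with
  | zero => exact xiN_zero_eta F k b
  | succ a ih =>
    have h := ih b
    have h' := ih (b + 1)
    rw [eta] at h' ⊢
    set S := sSum F k
    set x := eta F k a
    set y := eta F k b
    calc _ = S * (x * y + y * x) - (x * y + y * x) * S -
          (x * (S * y - y * S) + (S * y - y * S) * x) := by noncomm_ring
      _ = 0 := by rw [h, h', mul_zero, zero_mul, sub_zero, sub_zero]

/-- `η_m` only involves the strands `0` to `m`. In the induction, each crossing in `S` is either far
from `s_i` or itself commutes with `η_m`, so `[s_i, S]` commutes with `η_m`. -/
theorem sN_eta (m i : ℕ) (h : m < i) : sN F k i * eta F k m - eta F k m * sN F k i = 0 := by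
  induction m generalizing i with
  | zero => rw [eta, xiN_sN F k i 0 (by omega) (by omega), sub_self]
  | succ m ih =>
    have key : ∀ l, (sN F k i * sN F k l - sN F k l * sN F k i) * eta F k m -
        eta F k m * (sN F k i * sN F k l - sN F k l * sN F k i) = 0 := by
      intro l
      by_cases hl : m < l
      · have h1 := ih i (by omega)
        have h2 := ih l hl
        set x := eta F k m
        set a := sN F k i
        set b := sN F k l
        calc _ = a * (b * x - x * b) - (b * x - x * b) * a - (b * (a * x - x * a) -
              (a * x - x * a) * b) := by noncomm_ring
          _ = 0 := by rw [h1, h2]; simp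
      · rw [sN_far F k l i (by omega), sub_self, zero_mul, mul_zero, sub_zero]
    have h1 := ih i (by omega)
    have h2 : (sN F k i * sSum F k - sSum F k * sN F k i) * eta F k m -
        eta F k m * (sN F k i * sSum F k - sSum F k * sN F k i) = 0 := by
      rw [sSum, Finset.mul_sum, Finset.sum_mul, ← Finset.sum_sub_distrib, Finset.sum_mul,
        Finset.mul_sum, ← Finset.sum_sub_distrib]
      exact Finset.sum_eq_zero fun l _ => key l
    rw [eta]
    set x := eta F k m
    set a := sN F k i
    set S := sSum F k
    calc _ = ((a * S - S * a) * x - x * (a * S - S * a)) + (S * (a * x - x * a) -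
          (a * x - x * a) * S) := by noncomm_ring
      _ = 0 := by rw [h1, h2]; simp

theorem xiN_eta (m j : ℕ) (h : m < j) : xiN F k j * eta F k m + eta F k m * xiN F k j = 0 := by
  induction m generalizing j with
  | zero => rw [eta, xiN_anti, neg_add_cancel]
  | succ m ih =>
    have h0 := ih j (by omega)
    have key : ∀ l, (sN F k l * xiN F k j - xiN F k j * sN F k l) * eta F k m +
        eta F k m * (sN F k l * xiN F k j - xiN F k j * sN F k l) = 0 := by
      intro l
      by_cases hl : m < l
      · have h2 := sN_eta F k m l hl
        set x := eta F k m
        set a := sN F k l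
        set y := xiN F k j
        calc _ = a * (y * x + x * y) - (y * x + x * y) * a - (y * (a * x - x * a) +
              (a * x - x * a) * y) := by noncomm_ring
          _ = 0 := by rw [h0, h2]; simp
      · rw [xiN_sN F k l j (by omega) (by omega), sub_self, zero_mul, mul_zero, add_zero]
    have h2 : (sSum F k * xiN F k j - xiN F k j * sSum F k) * eta F k m +
        eta F k m * (sSum F k * xiN F k j - xiN F k j * sSum F k) = 0 := by
      rw [sSum, Finset.mul_sum, Finset.sum_mul, ← Finset.sum_sub_distrib, Finset.sum_mul,
        Finset.mul_sum, ← Finset.sum_add_distrib]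
      exact Finset.sum_eq_zero fun l _ => key l
    rw [eta]
    set x := eta F k m
    set y := xiN F k j
    set S := sSum F k
    calc _ = (S * (y * x + x * y) - (y * x + x * y) * S) - ((S * y - y * S) * x +
          x * (S * y - y * S)) := by noncomm_ring
      _ = 0 := by rw [h0, h2]; simp

/-- Since `d S = ξ_0 - ξ_{k-1}`, the Leibniz rule turns `d η_{m+1}` into the anticommutator of `η_m`
with `ξ_0` minus that with `ξ_{k-1}`. The second vanishes because strand `k - 1` lies beyond those
of `η_m`; this uses `m + 1 < k`. -/
theorem d_eta (m : ℕ) (hm : m < k) : RNil.d F k (eta F k m) = 0 := by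
  induction m with
  | zero => exact d_xiN F k 0
  | succ m ih =>
    have h0 := ih (by omega)
    have h1 := xiN_zero_eta F k m
    have h2 := xiN_eta F k m (k - 1) (by omega)
    have e1 := RNil.leibniz F k _ _ _ (eta F k m) (sSum_mem F k)
    have e2 := RNil.leibniz F k _ _ _ (sSum F k) (eta_mem F k m)
    rw [h0, mul_zero, smul_zero, add_zero, d_sSum F k (by omega)] at e1
    rw [h0, zero_mul, zero_add, Int.negOnePow_one, Units.neg_smul, one_smul,
      d_sSum F k (by omega)] at e2
    rw [eta, map_sub, e1, e2]
    calc _ = (xiN F k 0 * eta F k m + eta F k m * xiN F k 0) -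
          (xiN F k (k - 1) * eta F k m + eta F k m * xiN F k (k - 1)) := by noncomm_ring
      _ = 0 := by rw [h1, h2, sub_zero]

end Eta

/-! ### Maps out of `R_k^nil`, and the parity involution. -/

section Lift

variable {F : Type u} [Field F] {k : ℕ}

/-- The map from `R_k^nil` defined by elements that satisfy its relations. -/
noncomputable def RNil.lift {B : Type*} [Ring B] [Algebra F B] (σ ξ : ℕ → B)
    (hsq : ∀ i, σ i * σ i = 0)
    (hbraid : ∀ i, σ i * σ (i + 1) * σ i = σ (i + 1) * σ i * σ (i + 1))
    (hfar : ∀ i j, i + 1 < j → σ i * σ j = σ j * σ i)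
    (hdsq : ∀ j, ξ j * ξ j = 0) (hdots : ∀ i j, i ≠ j → ξ i * ξ j = -(ξ j * ξ i))
    (hleft : ∀ i, ξ i * σ i = σ i * ξ (i + 1)) (hright : ∀ i, ξ (i + 1) * σ i = σ i * ξ i)
    (hslide : ∀ i j, j ≠ i → j ≠ i + 1 → ξ j * σ i = σ i * ξ j) : RAlg F k →ₐ[F] B :=
  Pres.lift (fun g => match g with
    | .cross i _ => σ i
    | .dot j => ξ j) (by
    intro a b hab
    cases hab with
    | sq i h => simpa using hsq i
    | braid i h h' => simpa using hbraid i
    | far i i' h h' hii => simpa using hfar i i' hii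
    | dotSq j h => simpa using hdsq j
    | dots j j' h h' hjj => simpa using hdots j j' hjj
    | left i h₀ h => simpa using hleft i
    | right i h₀ h => simpa using hright i
    | slide i j h hj h1 h2 => simpa using hslide i j h1 h2)

section

variable {B : Type*} [Ring B] [Algebra F B] (σ ξ : ℕ → B)
    (hsq : ∀ i, σ i * σ i = 0)
    (hbraid : ∀ i, σ i * σ (i + 1) * σ i = σ (i + 1) * σ i * σ (i + 1))
    (hfar : ∀ i j, i + 1 < j → σ i * σ j = σ j * σ i)
    (hdsq : ∀ j, ξ j * ξ j = 0) (hdots : ∀ i j, i ≠ j → ξ i * ξ j = -(ξ j * ξ i))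
    (hleft : ∀ i, ξ i * σ i = σ i * ξ (i + 1)) (hright : ∀ i, ξ (i + 1) * σ i = σ i * ξ i)
    (hslide : ∀ i j, j ≠ i → j ≠ i + 1 → ξ j * σ i = σ i * ξ j)

theorem RNil.lift_sN (i : ℕ) (h : i + 1 < k) :
    RNil.lift σ ξ hsq hbraid hfar hdsq hdots hleft hright hslide (sN F k i) = σ i := by
  rw [sN_of_lt F k i h]
  exact Pres.lift_gen _ _ (Gen.cross i h)

theorem RNil.lift_xiN (j : ℕ) (h : j < k) :
    RNil.lift σ ξ hsq hbraid hfar hdsq hdots hleft hright hslide (xiN F k j) = ξ j := by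
  rw [xiN_of_lt F k j h]
  exact Pres.lift_gen _ _ (Gen.dot ⟨j, h⟩)

end

theorem RNil.induction_right {P : RAlg F k → Prop} (one : P 1)
    (crossing : ∀ i, i + 1 < k → ∀ b, P b → P (b * sN F k i))
    (dot : ∀ j, j < k → ∀ b, P b → P (b * xiN F k j)) (add : ∀ a b, P a → P b → P (a + b))
    (smul : ∀ (c : F) a, P a → P (c • a)) (a : RAlg F k) : P a :=
  Pres.induction_right one (fun x b hb => by
    cases x with
    | cross i h =>
      have := crossing i h b hb
      rw [sN_of_lt F k i h] at this
      exact this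
    | dot j =>
      have := dot j j.2 b hb
      rw [xiN_of_lt F k j j.2] at this
      exact this) add smul a

variable (F k)

/-- The parity involution `a ↦ (-1)^|a| a`. -/
noncomputable def RNil.par (a : RAlg F k) : RAlg F k := RNil.dbl F k a 0 0

theorem RNil.dbl_10 (a : RAlg F k) : RNil.dbl F k a 1 0 = 0 := by
  induction a using DirectSum.Decomposition.inductionOn (RNil.gr F k) with
  | zero => simp
  | @homogeneous i m => exact (RNil.dbl_homog F k i.1 i.2 _ m.2).1
  | add a b ha hb => rw [map_add, Matrix.add_apply, ha, hb, add_zero]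

theorem RNil.par_add (a b : RAlg F k) : RNil.par F k (a + b) = RNil.par F k a + RNil.par F k b := by
  rw [par, map_add]; rfl

theorem RNil.par_smul (c : F) (a : RAlg F k) : RNil.par F k (c • a) = c • RNil.par F k a := by
  rw [par, map_smul]; rfl

theorem RNil.par_zero : RNil.par F k 0 = 0 := by rw [par, map_zero]; rfl

theorem RNil.par_one : RNil.par F k 1 = 1 := by rw [par, map_one]; rfl

theorem RNil.par_neg (a : RAlg F k) : RNil.par F k (-a) = -RNil.par F k a := by
  rw [par, map_neg]; rfl

theorem RNil.par_mul (a b : RAlg F k) : RNil.par F k (a * b) = RNil.par F k a * RNil.par F k b := by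
  rw [par, map_mul, Matrix.mul_apply, Fin.sum_univ_two, dbl_10, mul_zero, add_zero]; rfl

/-- The Leibniz rule without homogeneity assumptions, the sign being carried by `par`. -/
theorem RNil.d_mul (a b : RAlg F k) : RNil.d F k (a * b) =
    RNil.par F k a * RNil.d F k b + RNil.d F k a * b := by
  show RNil.dbl F k (a * b) 0 1 = _
  rw [map_mul, Matrix.mul_apply, Fin.sum_univ_two, dbl_11]
  rfl

theorem RNil.par_of_mem (p q : ℤ) (a : RAlg F k) (ha : a ∈ RNil.gr F k (p, q)) :
    RNil.par F k a = p.negOnePow • a := (RNil.dbl_homog F k p q a ha).2.2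

theorem RNil.par_par (a : RAlg F k) : RNil.par F k (RNil.par F k a) = a := by
  induction a using DirectSum.Decomposition.inductionOn (RNil.gr F k) with
  | zero => rw [par_zero, par_zero]
  | @homogeneous i m =>
    have h := par_of_mem F k i.1 i.2 _ m.2
    have h' : RNil.par F k (i.1.negOnePow • (m : RAlg F k)) = i.1.negOnePow • RNil.par F k m :=
      map_units_smul (AddMonoidHom.mk' (RNil.par F k) (par_add F k)) _ _
    rw [h, h', h, smul_smul, Int.units_mul_self, one_smul]
  | add a b ha hb => rw [par_add, par_add, ha, hb]

theorem RNil.d_par (a : RAlg F k) : RNil.d F k (RNil.par F k a) = -RNil.par F k (RNil.d F k a) := by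
  induction a using DirectSum.Decomposition.inductionOn (RNil.gr F k) with
  | zero => rw [par_zero, map_zero, par_zero, neg_zero]
  | @homogeneous i m =>
    rw [par_of_mem F k i.1 i.2 _ m.2, map_units_smul,
      par_of_mem F k _ _ _ (RNil.d_mem_d_d F k i.1 i.2 _ m.2).1, Int.negOnePow_succ, Units.neg_smul,
      neg_neg]
  | add a b ha hb => rw [par_add, map_add, ha, hb, map_add, par_add, neg_add]

theorem RNil.par_sN (i : ℕ) : RNil.par F k (sN F k i) = sN F k i := by
  rw [par_of_mem F k _ _ _ (sN_mem F k i), Int.negOnePow_zero, one_smul]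

theorem RNil.par_xiN (i : ℕ) : RNil.par F k (xiN F k i) = -xiN F k i := by
  rw [par_of_mem F k _ _ _ (xiN_mem F k i), Int.negOnePow_one, Units.neg_smul, one_smul]

theorem RNil.d_d (a : RAlg F k) : RNil.d F k (RNil.d F k a) = 0 := (Rnil F k).d_d a

end Lift

/-! ### `R_k^nil` inside `R_{k+1}^nil`, and the products `t_q`, `u_q`. -/

section Inclusion

variable (F : Type u) [Field F] (k : ℕ)

/-- The inclusion of `R_k^nil` in `R_{k+1}^nil`. -/
noncomputable def incl : RAlg F k →ₐ[F] RAlg F (k + 1) :=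
  RNil.lift (sN F (k + 1)) (xiN F (k + 1)) (sN_sq F _) (sN_braid F _) (sN_far F _) (xiN_sq F _)
    (fun i j _ => xiN_anti F _ i j) (xiN_sN_self F _) (xiN_sN_succ F _) (xiN_sN F _)

theorem incl_sN (i : ℕ) (h : i + 1 < k) : incl F k (sN F k i) = sN F (k + 1) i :=
  RNil.lift_sN _ _ _ _ _ _ _ _ _ _ i h

theorem incl_xiN (j : ℕ) (h : j < k) : incl F k (xiN F k j) = xiN F (k + 1) j :=
  RNil.lift_xiN _ _ _ _ _ _ _ _ _ _ j h

theorem dbl_incl (a : RAlg F k) :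
    RNil.dbl F (k + 1) (incl F k a) = (RNil.dbl F k a).map (incl F k) := by
  have : (RNil.dbl F (k + 1)).comp (incl F k) = (incl F k).mapMatrix.comp (RNil.dbl F k) := by
    apply Pres.hom_ext
    intro g
    cases g with
    | cross i h =>
      have e := incl_sN F k i h
      have e1 := incl_xiN F k i (by omega)
      have e2 := incl_xiN F k (i + 1) h
      rw [sN_of_lt F _ i h, sN_of_lt F _ i (by omega)] at e
      rw [xiN_of_lt F _ i (by omega), xiN_of_lt F _ i (by omega)] at e1
      rw [xiN_of_lt F _ _ h, xiN_of_lt F _ (i + 1) (by omega)] at e2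
      show RNil.dbl F (k + 1) (incl F k (RNil.s F i h)) = (RNil.dbl F k (RNil.s F i h)).map (incl F k)
      rw [e, RNil.s, RNil.s, RNil.dbl_gen, RNil.dbl_gen]
      ext a b
      fin_cases a <;> fin_cases b <;> simp [RNil.dblGen, RNil.ds, e, e1, e2]
    | dot j =>
      have e := incl_xiN F k j j.2
      rw [xiN_of_lt F _ j j.2, xiN_of_lt F _ j (by omega)] at e
      show RNil.dbl F (k + 1) (incl F k (RNil.xi F j)) = (RNil.dbl F k (RNil.xi F j)).map (incl F k)
      have e' : incl F k (RNil.xi F j) = RNil.xi F ⟨j, by omega⟩ := e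
      rw [e', RNil.xi, RNil.xi, RNil.dbl_gen, RNil.dbl_gen]
      ext a b
      fin_cases a <;> fin_cases b <;> simp [RNil.dblGen, e']
  exact DFunLike.congr_fun this a

theorem d_incl (a : RAlg F k) : RNil.d F (k + 1) (incl F k a) = incl F k (RNil.d F k a) := by
  show RNil.dbl F (k + 1) (incl F k a) 0 1 = _
  rw [dbl_incl]; rfl

theorem par_incl (a : RAlg F k) : RNil.par F (k + 1) (incl F k a) = incl F k (RNil.par F k a) := by
  rw [RNil.par, dbl_incl]; rfl

theorem sSum_succ : sSum F (k + 1) = incl F k (sSum F k) + sN F (k + 1) (k - 1) := by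
  cases k with
  | zero => simp [sSum]
  | succ k =>
    rw [sSum, sSum, Finset.sum_range_succ, Finset.sum_range_succ, Finset.sum_range_succ,
      sN_of_not_lt F (k + 1 + 1) (k + 1) (by omega), sN_of_not_lt F (k + 1) k (by omega), add_zero,
      add_zero, map_sum, Finset.sum_congr rfl fun i hi =>
        incl_sN F (k + 1) i (by have := Finset.mem_range.1 hi; omega), Nat.add_sub_cancel]

/-- Adding a strand adds to `S` only the crossing `s_{k-1}`, which commutes with the cocycles
entering the recursion below `m`. -/
theorem incl_eta (m : ℕ) (hm : m < k) : incl F k (eta F k m) = eta F (k + 1) m := by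
  induction m with
  | zero => exact incl_xiN F k 0 hm
  | succ m ih =>
    have h := sN_eta F (k + 1) m (k - 1) (by omega)
    rw [eta, eta, map_sub, map_mul, map_mul, ih (by omega), sSum_succ, add_mul, mul_add,
      add_sub_add_comm, h, add_zero]

/-- The last dot sits on a strand not touched by `R_k^nil`: it commutes with the crossings there and
anticommutes with the dots. -/
theorem xiN_last_incl (a : RAlg F k) :
    xiN F (k + 1) k * incl F k a = incl F k (RNil.par F k a) * xiN F (k + 1) k := by
  induction a using RNil.induction_right with
  | one => rw [RNil.par_one, map_one, mul_one, one_mul]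
  | crossing i h b hb =>
    rw [RNil.par_mul, map_mul, map_mul, ← mul_assoc, hb, RNil.par_sN, mul_assoc, mul_assoc,
      incl_sN F k i h, xiN_sN F _ _ _ (by omega) (by omega)]
  | dot j h b hb =>
    rw [RNil.par_mul, map_mul, map_mul, ← mul_assoc, hb, RNil.par_xiN, mul_assoc, mul_assoc, map_neg,
      incl_xiN F k j h, xiN_anti F _ k j, neg_mul]
  | add a b ha hb => rw [RNil.par_add, map_add, map_add, mul_add, add_mul, ha, hb]
  | smul c a ha => rw [RNil.par_smul, map_smul, map_smul, mul_smul_comm, smul_mul_assoc, ha]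

/-- The product `s_{k-1} ⋯ s_{k-r}` in `R_{k+1}^nil`. -/
noncomputable def sDesc : ℕ → RAlg F (k + 1)
  | 0 => 1
  | r + 1 => sDesc r * sN F (k + 1) (k - r - 1)

/-- The product `s_{k-1} ⋯ s_q` in `R_{k+1}^nil`. -/
noncomputable def tR (q : ℕ) : RAlg F (k + 1) := sDesc F k (k - q)

theorem tR_last : tR F k k = 1 := by rw [tR, Nat.sub_self]; rfl

theorem tR_succ_mul (q : ℕ) (h : q < k) : tR F k (q + 1) * sN F (k + 1) q = tR F k q := by
  rw [tR, tR, show k - q = k - (q + 1) + 1 by omega, sDesc]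
  congr 2
  omega

/-- The crossing on `k` strands that corresponds to `s_i` after strand `q` is removed. -/
noncomputable def sT (i q : ℕ) : RAlg F k :=
  if i + 1 < q then sN F k i else if q < i then sN F k (i - 1) else 0

/-- The dot on `k` strands that corresponds to `ξ_l` after strand `q` is removed. -/
noncomputable def xT (l q : ℕ) : RAlg F k := if l < q then xiN F k l else xiN F k (l - 1)

variable {i l q : ℕ}

theorem sT_of_gt (h : i + 1 < q) : sT F k i q = sN F k i := if_pos h

theorem sT_of_lt (h : q < i) : sT F k i q = sN F k (i - 1) := by
  rw [sT, if_neg (by omega), if_pos h]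

theorem sT_of_eq (h : q = i ∨ q = i + 1) : sT F k i q = 0 := by
  rw [sT, if_neg (by omega), if_neg (by omega)]

theorem xT_of_lt (h : l < q) : xT F k l q = xiN F k l := if_pos h

theorem xT_of_gt (h : q < l) : xT F k l q = xiN F k (l - 1) := if_neg (by omega)

/-- The product `s_{k-1} ⋯ s_q` carries strand `q` to the last place. Multiplying by `s_q` gives
zero, multiplying by `s_{q-1}` lengthens the product, and every other crossing slides through, by
far commutation or the braid relation, to a crossing of the remaining strands. -/
theorem tR_mul_sN (i q : ℕ) (hi : i < k) (hq : q ≤ k) : tR F k q * sN F (k + 1) i =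
    incl F k (sT F k i q) * tR F k q + if q = i + 1 then tR F k i else 0 := by
  induction hr : k - q using Nat.strong_induction_on generalizing q i with
  | _ r ih =>
    by_cases h1 : q = i + 1
    · subst h1
      rw [if_pos rfl, sT_of_eq F k (Or.inr rfl), map_zero, zero_mul, zero_add]
      exact tR_succ_mul F k i hi
    rw [if_neg h1, add_zero]
    by_cases h2 : q = k
    · subst h2
      rw [tR_last, one_mul, mul_one, sT_of_gt F q (by omega), incl_sN F q i (by omega)]
    have ht := tR_succ_mul F k q (by omega)
    by_cases h3 : q = i
    · subst h3
      rw [sT_of_eq F k (Or.inl rfl), map_zero, zero_mul, ← ht, mul_assoc, sN_sq, mul_zero]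
    by_cases h4 : i = q + 1
    · subst h4
      have ht' := tR_succ_mul F k (q + 1) hi
      have := ih _ (by omega) q (q + 1 + 1) (by omega) (by omega) rfl
      rw [if_neg (by omega), add_zero, sT_of_gt F k (by omega)] at this
      rw [sT_of_lt F k (by omega), Nat.add_sub_cancel, ← ht, ← ht', mul_assoc, mul_assoc,
        ← mul_assoc (sN F (k + 1) (q + 1)), ← sN_braid, ← mul_assoc, ← mul_assoc, this]
      simp only [mul_assoc]
    · have := ih _ (by omega) i (q + 1) hi (by omega) rfl
      rw [if_neg (by omega), add_zero] at this
      have hs : sN F (k + 1) q * sN F (k + 1) i = sN F (k + 1) i * sN F (k + 1) q := by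
        rcases Nat.lt_or_ge i q with h | h
        · exact (sN_far F _ i q (by omega)).symm
        · exact sN_far F _ q i (by omega)
      have hT : sT F k i (q + 1) = sT F k i q := by
        rcases Nat.lt_or_ge i q with h | h
        · rw [sT_of_gt F k (by omega), sT_of_gt F k (by omega)]
        · rw [sT_of_lt F k (by omega), sT_of_lt F k (by omega)]
      rw [← ht, mul_assoc, hs, ← mul_assoc, this, hT, mul_assoc]

/-- The dot on strand `q` follows that strand to the last place; the other dots stay on their
strands, which are renumbered once `q` is removed. -/
theorem tR_mul_xiN (l q : ℕ) (hl : l ≤ k) (hq : q ≤ k) : tR F k q * xiN F (k + 1) l =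
    if q = l then xiN F (k + 1) k * tR F k q else incl F k (xT F k l q) * tR F k q := by
  induction hr : k - q generalizing q l with
  | zero =>
    obtain rfl : q = k := by omega
    rw [tR_last, one_mul, mul_one, mul_one]
    split_ifs with h
    · rw [h]
    · rw [xT_of_lt F q (by omega), incl_xiN F q l (by omega)]
  | succ r ih =>
    have ht := tR_succ_mul F k q (by omega)
    by_cases h1 : q = l
    · subst h1
      have := ih (q + 1) (q + 1) (by omega) (by omega) (by omega)
      rw [if_pos rfl] at this
      rw [if_pos rfl, ← ht, mul_assoc, ← xiN_sN_succ, ← mul_assoc, this, mul_assoc]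
    rw [if_neg h1]
    by_cases h2 : l = q + 1
    · subst h2
      have := ih q (q + 1) (by omega) (by omega) (by omega)
      rw [if_neg (by omega), xT_of_lt F k (by omega)] at this
      rw [xT_of_gt F k (by omega), Nat.add_sub_cancel, ← ht, mul_assoc, ← xiN_sN_self, ← mul_assoc,
        this, mul_assoc]
    · have := ih l (q + 1) (by omega) (by omega) (by omega)
      rw [if_neg (by omega)] at this
      have hT : xT F k l (q + 1) = xT F k l q := by
        rcases Nat.lt_or_ge l q with h | h
        · rw [xT_of_lt F k (by omega), xT_of_lt F k (by omega)]
        · rw [xT_of_gt F k (by omega), xT_of_gt F k (by omega)]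
      rw [← ht, mul_assoc, ← xiN_sN F _ q l (by omega) (by omega), ← mul_assoc, this, hT, mul_assoc]

/-- The product `ξ_k s_{k-1} ⋯ s_q` in `R_{k+1}^nil`. -/
noncomputable def uR (q : ℕ) : RAlg F (k + 1) := xiN F (k + 1) k * tR F k q

theorem uR_mul_sN (i q : ℕ) (hi : i < k) (hq : q ≤ k) : uR F k q * sN F (k + 1) i =
    incl F k (sT F k i q) * uR F k q + if q = i + 1 then uR F k i else 0 := by
  have h : RNil.par F k (sT F k i q) = sT F k i q := by
    unfold sT
    split_ifs
    · exact RNil.par_sN F k _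
    · exact RNil.par_sN F k _
    · exact RNil.par_zero F k
  rw [uR, mul_assoc, tR_mul_sN F k i q hi hq, mul_add, ← mul_assoc, xiN_last_incl, h, mul_assoc]
  congr 1
  split_ifs
  · rfl
  · exact mul_zero _

theorem uR_mul_xiN (l q : ℕ) (hl : l ≤ k) (hq : q ≤ k) : uR F k q * xiN F (k + 1) l =
    if q = l then 0 else -(incl F k (xT F k l q) * uR F k q) := by
  have h : RNil.par F k (xT F k l q) = -xT F k l q := by
    unfold xT
    split_ifs
    · exact RNil.par_xiN F k _
    · exact RNil.par_xiN F k _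
  rw [uR, mul_assoc, tR_mul_xiN F k l q hl hq]
  split_ifs
  · rw [← mul_assoc, xiN_sq, zero_mul]
  · rw [← mul_assoc, xiN_last_incl, h, map_neg, neg_mul, neg_mul, mul_assoc]

end Inclusion

/-! ### `R_{k+1}^nil` as a free left module over `R_k^nil`, by a right action on coordinates. -/

section RightAction

variable (F : Type u) [Field F] (k : ℕ)

/-- The right action of a crossing on one kind of coordinates of `R_{k+1}^nil` over `R_k^nil`. -/
noncomputable def crossAct (i : ℕ) : (ℕ → RAlg F k) →ₗ[RAlg F k] (ℕ → RAlg F k) where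
  toFun f q := f q * sT F k i q + if q = i then f (i + 1) else 0
  map_add' f g := by
    funext q
    simp only [Pi.add_apply, add_mul]
    split_ifs <;> abel
  map_smul' c f := by
    funext q
    simp only [Pi.smul_apply, smul_eq_mul, RingHom.id_apply, mul_add, mul_assoc, mul_ite, mul_zero]

variable {i j l q : ℕ} (f : ℕ → RAlg F k)

theorem crossAct_of_gt (h : i + 1 < q) : crossAct F k i f q = f q * sN F k i := by
  show f q * _ + _ = _
  rw [sT_of_gt F k h, if_neg (by omega), add_zero]

theorem crossAct_of_lt (h : q < i) : crossAct F k i f q = f q * sN F k (i - 1) := by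
  show f q * _ + _ = _
  rw [sT_of_lt F k h, if_neg (by omega), add_zero]

theorem crossAct_self (h : q = i) : crossAct F k i f q = f (q + 1) := by
  show f q * _ + _ = _
  rw [sT_of_eq F k (Or.inl h), if_pos h, mul_zero, zero_add, h]

theorem crossAct_succ (h : q = i + 1) : crossAct F k i f q = 0 := by
  show f q * _ + _ = _
  rw [sT_of_eq F k (Or.inr h), if_neg (by omega), mul_zero, zero_add]

/-- The multiplication rules of the `t_q` and `u_q` are now taken as a definition, and the relations
of `R_{k+1}^nil` have to be verified for it; this is what proves independence of these products. The
verifications distinguish the positions of `q` relative to the crossings and dots involved. -/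
theorem crossAct_sq : crossAct F k i (crossAct F k i f) = 0 := by
  funext q
  rw [Pi.zero_apply]
  rcases lt_or_ge q i with h | h
  · simp (disch := omega) only [crossAct_of_lt, mul_assoc, sN_sq, mul_zero]
  rcases lt_or_ge (i + 1) q with h' | h'
  · simp (disch := omega) only [crossAct_of_gt, mul_assoc, sN_sq, mul_zero]
  rcases (by omega : q = i ∨ q = i + 1) with h | h
  · simp (disch := omega) only [crossAct_self, crossAct_succ]
  · simp (disch := omega) only [crossAct_succ]

theorem crossAct_braid : crossAct F k i (crossAct F k (i + 1) (crossAct F k i f)) =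
    crossAct F k (i + 1) (crossAct F k i (crossAct F k (i + 1) f)) := by
  funext q
  rcases lt_or_ge q i with h | h
  · obtain ⟨i, rfl⟩ : ∃ m, i = m + 1 := ⟨i - 1, by omega⟩
    simp (disch := omega) only [crossAct_of_lt, Nat.add_sub_cancel]
    have := sN_braid F k i
    simp only [mul_assoc] at this ⊢
    rw [this]
  rcases lt_or_ge (i + 2) q with h' | h'
  · simp (disch := omega) only [crossAct_of_gt]
    have := sN_braid F k i
    simp only [mul_assoc] at this ⊢
    rw [this]
  rcases (by omega : q = i ∨ q = i + 1 ∨ q = i + 2) with rfl | rfl | rfl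
  · simp (disch := omega) only [crossAct_self, crossAct_of_lt, crossAct_of_gt, Nat.add_sub_cancel]
  · simp (disch := omega) only [crossAct_self, crossAct_succ, crossAct_of_gt, zero_mul]
  · simp (disch := omega) only [crossAct_succ, crossAct_of_gt, zero_mul]

theorem crossAct_far (hij : i + 1 < j) :
    crossAct F k i (crossAct F k j f) = crossAct F k j (crossAct F k i f) := by
  funext q
  have h1 := sN_far F k i j hij
  have h2 : i + 1 < j - 1 → _ := sN_far F k i (j - 1)
  have h3 : 0 < i → _ := fun h => sN_far F k (i - 1) (j - 1) (by omega)
  rcases (by omega : q < i ∨ q = i ∨ q = i + 1 ∨ (i + 1 < q ∧ q < j) ∨ q = j ∨ q = j + 1 ∨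
    j + 1 < q) with h | h | h | h | h | h | h
  · simp (disch := omega) only [crossAct_of_lt, mul_assoc, h3 (by omega)]
  · simp (disch := omega) only [crossAct_of_lt, crossAct_self]
  · simp (disch := omega) only [crossAct_of_lt, crossAct_succ, zero_mul]
  · simp (disch := omega) only [crossAct_of_lt, crossAct_of_gt, mul_assoc, h2 (by omega)]
  · simp (disch := omega) only [crossAct_self, crossAct_of_gt]
  · simp (disch := omega) only [crossAct_succ, crossAct_of_gt, zero_mul]
  · simp (disch := omega) only [crossAct_of_gt, mul_assoc, h1]

/-- Coordinates of elements of `R_{k+1}^nil` with respect to the products `s_{k-1} ⋯ s_q` and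
`ξ_k s_{k-1} ⋯ s_q`. -/
abbrev Coord : Type u := (ℕ → RAlg F k) × (ℕ → RAlg F k)

/-- The right action of a dot on coordinates. -/
noncomputable def dotAct (l : ℕ) : Coord F k →ₗ[RAlg F k] Coord F k where
  toFun v := (fun q => if q = l then 0 else v.1 q * xT F k l q,
    fun q => if q = l then v.1 q else -(v.2 q * xT F k l q))
  map_add' v w := by
    ext q
    · simp only [Prod.fst_add, Pi.add_apply, add_mul]
      split_ifs
      · rw [add_zero]
      · rfl
    · simp only [Prod.fst_add, Prod.snd_add, Pi.add_apply, add_mul, neg_add]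
      split_ifs <;> rfl
  map_smul' c v := by
    ext q
    · simp only [Prod.smul_fst, Pi.smul_apply, smul_eq_mul, mul_ite, mul_zero, mul_assoc,
        RingHom.id_apply]
    · simp only [Prod.smul_fst, Prod.smul_snd, Pi.smul_apply, smul_eq_mul, mul_ite, mul_neg,
        mul_assoc, RingHom.id_apply]

/-- The right action of a crossing on coordinates. -/
noncomputable def crossAct₂ (i : ℕ) : Coord F k →ₗ[RAlg F k] Coord F k :=
  (crossAct F k i).prodMap (crossAct F k i)

/-- The coordinates of one kind with a single nonzero entry. -/
noncomputable def sgl (q : ℕ) (a : RAlg F k) : ℕ → RAlg F k := Pi.single q a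

variable {F k} in
theorem sgl_same (q : ℕ) (a : RAlg F k) : sgl F k q a q = a := Pi.single_eq_same _ _

variable {F k} in
theorem sgl_ne {p q : ℕ} (h : p ≠ q) (a : RAlg F k) : sgl F k q a p = 0 := Pi.single_eq_of_ne h _

theorem sgl_zero (q : ℕ) : sgl F k q 0 = 0 := Pi.single_zero _

theorem sgl_add (q : ℕ) (a b : RAlg F k) : sgl F k q (a + b) = sgl F k q a + sgl F k q b :=
  Pi.single_add _ _ _

theorem sgl_smul (q : ℕ) (c : F) (a : RAlg F k) : sgl F k q (c • a) = c • sgl F k q a :=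
  Pi.single_smul _ _ _

theorem sgl_mul (q : ℕ) (a b : RAlg F k) : sgl F k q (a * b) = a • sgl F k q b := by
  funext p
  rw [Pi.smul_apply, smul_eq_mul]
  by_cases h : p = q
  · rw [h, sgl_same, sgl_same]
  · rw [sgl_ne h, sgl_ne h, mul_zero]

variable (v : Coord F k)

theorem dotAct_fst_ne (h : q ≠ l) : (dotAct F k l v).1 q = v.1 q * xT F k l q := if_neg h

theorem dotAct_snd_ne (h : q ≠ l) : (dotAct F k l v).2 q = -(v.2 q * xT F k l q) := if_neg h

theorem dotAct_fst_self (h : q = l) : (dotAct F k l v).1 q = 0 := if_pos h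

theorem dotAct_snd_self (h : q = l) : (dotAct F k l v).2 q = v.1 q := if_pos h

theorem crossAct₂_fst : (crossAct₂ F k i v).1 = crossAct F k i v.1 := rfl

theorem crossAct₂_snd : (crossAct₂ F k i v).2 = crossAct F k i v.2 := rfl

theorem xT_anti (l l' q : ℕ) : xT F k l q * xT F k l' q = -(xT F k l' q * xT F k l q) := by
  unfold xT
  split_ifs <;> exact xiN_anti F k _ _

theorem xT_sq (l q : ℕ) : xT F k l q * xT F k l q = 0 := by
  unfold xT
  split_ifs <;> exact xiN_sq F k _

theorem dotAct_sq : dotAct F k l (dotAct F k l v) = 0 := by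
  ext q
  · by_cases h : q = l
    · rw [dotAct_fst_self F k _ h]; rfl
    · rw [dotAct_fst_ne F k _ h, dotAct_fst_ne F k _ h, mul_assoc, xT_sq, mul_zero]; rfl
  · by_cases h : q = l
    · rw [dotAct_snd_self F k _ h, dotAct_fst_self F k _ h]; rfl
    · rw [dotAct_snd_ne F k _ h, dotAct_snd_ne F k _ h, neg_mul, mul_assoc, xT_sq, mul_zero,
        neg_zero, neg_zero]; rfl

theorem dotAct_anti (hij : i ≠ j) :
    dotAct F k i (dotAct F k j v) = -dotAct F k j (dotAct F k i v) := by
  ext q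
  · rw [Prod.fst_neg, Pi.neg_apply]
    by_cases h : q = i
    · have h' : q ≠ j := by omega
      rw [dotAct_fst_self F k _ h, dotAct_fst_ne F k _ h', dotAct_fst_self F k _ h, zero_mul,
        neg_zero]
    by_cases h' : q = j
    · rw [dotAct_fst_ne F k _ h, dotAct_fst_self F k _ h', dotAct_fst_self F k _ h', zero_mul,
        neg_zero]
    rw [dotAct_fst_ne F k _ h, dotAct_fst_ne F k _ h', dotAct_fst_ne F k _ h',
      dotAct_fst_ne F k _ h, mul_assoc, mul_assoc, xT_anti, mul_neg]
  · rw [Prod.snd_neg, Pi.neg_apply]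
    by_cases h : q = i
    · have h' : q ≠ j := by omega
      rw [dotAct_snd_self F k _ h, dotAct_fst_ne F k _ h', dotAct_snd_ne F k _ h',
        dotAct_snd_self F k _ h, neg_neg]
    by_cases h' : q = j
    · rw [dotAct_snd_ne F k _ h, dotAct_snd_self F k _ h', dotAct_snd_self F k _ h',
        dotAct_fst_ne F k _ h]
    rw [dotAct_snd_ne F k _ h, dotAct_snd_ne F k _ h', dotAct_snd_ne F k _ h',
      dotAct_snd_ne F k _ h, neg_mul, neg_mul, mul_assoc, mul_assoc, xT_anti, mul_neg]

theorem crossAct_dotAct_left :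
    crossAct₂ F k i (dotAct F k i v) = dotAct F k (i + 1) (crossAct₂ F k i v) := by
  have h1 := xiN_sN_self F k i
  have h2 := fun h : 0 < i => xiN_sN_self F k (i - 1)
  ext q
  all_goals
    simp only [crossAct₂_fst, crossAct₂_snd]
    rcases (by omega : q < i ∨ q = i ∨ q = i + 1 ∨ i + 1 < q) with h | h | h | h
  · have h2 := h2 (by omega)
    rw [Nat.sub_add_cancel (by omega)] at h2
    simp (disch := omega) only [crossAct_of_lt, dotAct_fst_ne, xT_of_gt, crossAct₂_fst, mul_assoc,
      h2, Nat.add_sub_cancel]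
  · simp (disch := omega) only [crossAct_self, dotAct_fst_ne, xT_of_gt, xT_of_lt, crossAct₂_fst,
      Nat.add_sub_cancel]
  · simp (disch := omega) only [crossAct_succ, dotAct_fst_self]
  · simp (disch := omega) only [crossAct_of_gt, dotAct_fst_ne, xT_of_lt, crossAct₂_fst, mul_assoc, h1]
  · have h2 := h2 (by omega)
    rw [Nat.sub_add_cancel (by omega)] at h2
    simp (disch := omega) only [crossAct_of_lt, dotAct_snd_ne, xT_of_gt, crossAct₂_snd, mul_assoc,
      h2, Nat.add_sub_cancel, neg_mul]
  · simp (disch := omega) only [crossAct_self, dotAct_snd_ne, xT_of_gt, xT_of_lt, crossAct₂_snd,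
      Nat.add_sub_cancel]
  · simp (disch := omega) only [crossAct_succ, dotAct_snd_self, crossAct₂_fst]
  · simp (disch := omega) only [crossAct_of_gt, dotAct_snd_ne, xT_of_lt, crossAct₂_snd, mul_assoc, h1,
      neg_mul]

theorem crossAct_dotAct_right :
    crossAct₂ F k i (dotAct F k (i + 1) v) = dotAct F k i (crossAct₂ F k i v) := by
  have h1 := xiN_sN_succ F k i
  have h2 := fun h : 0 < i => xiN_sN_succ F k (i - 1)
  ext q
  all_goals
    simp only [crossAct₂_fst, crossAct₂_snd]
    rcases (by omega : q < i ∨ q = i ∨ q = i + 1 ∨ i + 1 < q) with h | h | h | h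
  · have h2 := h2 (by omega)
    rw [Nat.sub_add_cancel (by omega)] at h2
    simp (disch := omega) only [crossAct_of_lt, dotAct_fst_ne, xT_of_gt, crossAct₂_fst, mul_assoc,
      h2, Nat.add_sub_cancel]
  · simp (disch := omega) only [crossAct_self, dotAct_fst_self]
  · simp (disch := omega) only [crossAct_succ, dotAct_fst_ne, crossAct₂_fst, zero_mul]
  · simp (disch := omega) only [crossAct_of_gt, dotAct_fst_ne, xT_of_lt, crossAct₂_fst, mul_assoc, h1]
  · have h2 := h2 (by omega)
    rw [Nat.sub_add_cancel (by omega)] at h2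
    simp (disch := omega) only [crossAct_of_lt, dotAct_snd_ne, xT_of_gt, crossAct₂_snd, mul_assoc,
      h2, Nat.add_sub_cancel, neg_mul]
  · simp (disch := omega) only [crossAct_self, dotAct_snd_self, crossAct₂_fst]
  · simp (disch := omega) only [crossAct_succ, dotAct_snd_ne, crossAct₂_snd, zero_mul, neg_zero]
  · simp (disch := omega) only [crossAct_of_gt, dotAct_snd_ne, xT_of_lt, crossAct₂_snd, mul_assoc, h1,
      neg_mul]

theorem crossAct_mul_xT (hji : j ≠ i) (hji' : j ≠ i + 1) (f : ℕ → RAlg F k) (hq : q ≠ j) :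
    crossAct F k i (fun q => f q * xT F k j q) q = crossAct F k i f q * xT F k j q := by
  rcases (by omega : q < i ∨ q = i ∨ q = i + 1 ∨ i + 1 < q) with h | h | h | h
  · simp (disch := omega) only [crossAct_of_lt, mul_assoc]
    congr 1
    rcases lt_or_ge j q with h' | h'
    · rw [xT_of_lt F k h']
      exact xiN_sN F k _ _ (by omega) (by omega)
    · rw [xT_of_gt F k (by omega)]
      exact xiN_sN F k _ _ (by omega) (by omega)
  · simp (disch := omega) only [crossAct_self]
    rcases lt_or_ge j q with h' | h'
    · simp (disch := omega) only [xT_of_lt]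
    · simp (disch := omega) only [xT_of_gt]
  · simp (disch := omega) only [crossAct_succ, zero_mul]
  · simp (disch := omega) only [crossAct_of_gt, mul_assoc]
    congr 1
    rcases lt_or_ge j q with h' | h'
    · rw [xT_of_lt F k h']
      exact xiN_sN F k _ _ (by omega) (by omega)
    · rw [xT_of_gt F k (by omega)]
      exact xiN_sN F k _ _ (by omega) (by omega)

theorem crossAct_congr {f g : ℕ → RAlg F k} (h1 : f q = g q) (h2 : q = i → f (i + 1) = g (i + 1)) :
    crossAct F k i f q = crossAct F k i g q := by
  show f q * _ + _ = g q * _ + _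
  rw [h1]
  split_ifs with h
  · rw [h2 h]
  · rfl

theorem crossAct_dotAct (hji : j ≠ i) (hji' : j ≠ i + 1) :
    crossAct₂ F k i (dotAct F k j v) = dotAct F k j (crossAct₂ F k i v) := by
  ext q
  · rw [crossAct₂_fst]
    by_cases h : q = j
    · rw [dotAct_fst_self F k _ h]
      rcases lt_or_ge j i with h' | h'
      · rw [crossAct_of_lt F k _ (by omega), dotAct_fst_self F k _ h, zero_mul]
      · rw [crossAct_of_gt F k _ (by omega), dotAct_fst_self F k _ h, zero_mul]
    · rw [dotAct_fst_ne F k _ h, crossAct₂_fst, ← crossAct_mul_xT F k hji hji' _ h]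
      exact crossAct_congr F k (dotAct_fst_ne F k _ h) fun h' => dotAct_fst_ne F k _ (by omega)
  · rw [crossAct₂_snd]
    by_cases h : q = j
    · rw [dotAct_snd_self F k _ h]
      rcases lt_or_ge j i with h' | h'
      · rw [crossAct_of_lt F k _ (by omega), dotAct_snd_self F k _ h, crossAct₂_fst,
          crossAct_of_lt F k _ (by omega)]
      · rw [crossAct_of_gt F k _ (by omega), dotAct_snd_self F k _ h, crossAct₂_fst,
          crossAct_of_gt F k _ (by omega)]
    · rw [dotAct_snd_ne F k _ h, crossAct₂_snd, ← crossAct_mul_xT F k hji hji' _ h, ← Pi.neg_apply,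
        ← map_neg]
      exact crossAct_congr F k (dotAct_snd_ne F k _ h) fun h' => dotAct_snd_ne F k _ (by omega)

/-- The right action of `R_{k+1}^nil` on coordinates. -/
noncomputable def coordAct :
    RAlg F (k + 1) →ₐ[F] (Module.End F (Coord F k))ᵐᵒᵖ :=
  RNil.lift (fun i => MulOpposite.op ((crossAct₂ F k i).restrictScalars F))
    (fun l => MulOpposite.op ((dotAct F k l).restrictScalars F))
    (fun _ => congrArg MulOpposite.op (LinearMap.ext fun v =>
      Prod.ext (crossAct_sq F k v.1) (crossAct_sq F k v.2)))
    (fun _ => congrArg MulOpposite.op (LinearMap.ext fun v =>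
      Prod.ext (crossAct_braid F k v.1) (crossAct_braid F k v.2)))
    (fun _ _ h => congrArg MulOpposite.op (LinearMap.ext fun v =>
      Prod.ext (crossAct_far F k v.1 h).symm (crossAct_far F k v.2 h).symm))
    (fun _ => congrArg MulOpposite.op (LinearMap.ext fun v => dotAct_sq F k v))
    (fun _ _ h => congrArg MulOpposite.op (LinearMap.ext fun v => dotAct_anti F k v h.symm))
    (fun _ => congrArg MulOpposite.op (LinearMap.ext fun v => crossAct_dotAct_left F k v))
    (fun _ => congrArg MulOpposite.op (LinearMap.ext fun v => crossAct_dotAct_right F k v))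
    (fun _ _ h h' => congrArg MulOpposite.op (LinearMap.ext fun v => crossAct_dotAct F k v h h'))

/-- The right action of an element of `R_{k+1}^nil` on coordinates. -/
noncomputable def ract (r : RAlg F (k + 1)) : Coord F k →ₗ[F] Coord F k := (coordAct F k r).unop

theorem ract_one : ract F k 1 v = v := by rw [ract, map_one]; rfl

theorem ract_mul (r r' : RAlg F (k + 1)) : ract F k (r * r') v = ract F k r' (ract F k r v) := by
  rw [ract, map_mul]; rfl

theorem ract_add (r r' : RAlg F (k + 1)) : ract F k (r + r') v = ract F k r v + ract F k r' v := by
  rw [ract, map_add]; rfl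

theorem ract_smul (c : F) (r : RAlg F (k + 1)) : ract F k (c • r) v = c • ract F k r v := by
  rw [ract, map_smul]; rfl

theorem ract_sN (h : i < k) : ract F k (sN F (k + 1) i) v = crossAct₂ F k i v := by
  rw [ract, coordAct, RNil.lift_sN _ _ _ _ _ _ _ _ _ _ i (by omega)]; rfl

theorem ract_xiN (h : l ≤ k) : ract F k (xiN F (k + 1) l) v = dotAct F k l v := by
  rw [ract, coordAct, RNil.lift_xiN _ _ _ _ _ _ _ _ _ _ l (by omega)]; rfl

theorem ract_left_smul (r : RAlg F (k + 1)) (a : RAlg F k) :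
    ract F k r (a • v) = a • ract F k r v := by
  induction r using RNil.induction_right with
  | one => rw [ract_one, ract_one]
  | crossing i h r hr =>
    rw [ract_mul, ract_mul, hr, ract_sN F k _ (by omega), ract_sN F k _ (by omega), map_smul]
  | dot j h r hr =>
    rw [ract_mul, ract_mul, hr, ract_xiN F k _ (by omega), ract_xiN F k _ (by omega), map_smul]
  | add r r' hr hr' => rw [ract_add, ract_add, hr, hr', smul_add]
  | smul c r hr => rw [ract_smul, ract_smul, hr, smul_comm]

/-- The element of `R_{k+1}^nil` with given coordinates. -/
noncomputable def ofCoord (v : Coord F k) : RAlg F (k + 1) :=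
  ∑ q ∈ Finset.range (k + 1), (incl F k (v.1 q) * tR F k q + incl F k (v.2 q) * uR F k q)

theorem sum_crossAct_mul (x : ℕ → RAlg F (k + 1)) (hi : i < k)
    (hx : ∀ q, q ≤ k → x q * sN F (k + 1) i =
      incl F k (sT F k i q) * x q + if q = i + 1 then x i else 0) :
    ∑ q ∈ Finset.range (k + 1), incl F k (crossAct F k i f q) * x q =
      (∑ q ∈ Finset.range (k + 1), incl F k (f q) * x q) * sN F (k + 1) i := by
  have e1 : ∀ q, incl F k (crossAct F k i f q) * x q =
      incl F k (f q) * (incl F k (sT F k i q) * x q) +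
        if q = i then incl F k (f (i + 1)) * x i else 0 := by
    intro q
    show incl F k (f q * _ + _) * x q = _
    rw [map_add, map_mul, add_mul, mul_assoc]
    congr 1
    split_ifs with h
    · rw [h]
    · rw [map_zero, zero_mul]
  have e2 : ∀ q ∈ Finset.range (k + 1), incl F k (f q) * x q * sN F (k + 1) i =
      incl F k (f q) * (incl F k (sT F k i q) * x q) +
        if q = i + 1 then incl F k (f (i + 1)) * x i else 0 := by
    intro q hq
    rw [mul_assoc, hx q (by have := Finset.mem_range.1 hq; omega), mul_add]
    congr 1
    split_ifs with h
    · rw [h]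
    · rw [mul_zero]
  rw [Finset.sum_mul, Finset.sum_congr rfl e2, Finset.sum_congr rfl fun q _ => e1 q,
    Finset.sum_add_distrib, Finset.sum_add_distrib, Finset.sum_ite_eq', Finset.sum_ite_eq',
    if_pos (Finset.mem_range.2 (by omega)), if_pos (Finset.mem_range.2 (by omega))]

theorem ofCoord_dotAct (hl : l ≤ k) :
    ofCoord F k (dotAct F k l v) = ofCoord F k v * xiN F (k + 1) l := by
  rw [ofCoord, ofCoord, Finset.sum_mul]
  refine Finset.sum_congr rfl fun q hq => ?_
  have hq : q ≤ k := by have := Finset.mem_range.1 hq; omega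
  rw [add_mul, mul_assoc _ (tR F k q), mul_assoc _ (uR F k q), tR_mul_xiN F k l q hl hq,
    uR_mul_xiN F k l q hl hq]
  by_cases h : q = l
  · rw [if_pos h, if_pos h, dotAct_fst_self F k _ h, dotAct_snd_self F k _ h, map_zero, zero_mul,
      zero_add, mul_zero, add_zero]
    rfl
  · rw [if_neg h, if_neg h, dotAct_fst_ne F k _ h, dotAct_snd_ne F k _ h, map_neg, map_mul, map_mul,
      neg_mul, mul_neg, mul_assoc, mul_assoc]

theorem ofCoord_ract (r : RAlg F (k + 1)) : ofCoord F k (ract F k r v) = ofCoord F k v * r := by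
  have hadd : ∀ v w : Coord F k, ofCoord F k (v + w) = ofCoord F k v + ofCoord F k w := by
    intro v w
    simp only [ofCoord, Prod.fst_add, Prod.snd_add, Pi.add_apply, map_add, add_mul]
    rw [← Finset.sum_add_distrib]
    exact Finset.sum_congr rfl fun q _ => by abel
  have hsmul : ∀ (c : F) (v : Coord F k), ofCoord F k (c • v) = c • ofCoord F k v := by
    intro c v
    simp only [ofCoord, Prod.smul_fst, Prod.smul_snd, Pi.smul_apply, map_smul, smul_mul_assoc,
      Finset.smul_sum, smul_add]
  induction r using RNil.induction_right with
  | one => rw [ract_one, mul_one]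
  | crossing i h r hr =>
    rw [ract_mul, ract_sN F k _ (by omega), ← mul_assoc, ← hr, ofCoord, ofCoord,
      Finset.sum_add_distrib, Finset.sum_add_distrib, crossAct₂_fst, crossAct₂_snd, add_mul,
      sum_crossAct_mul F k _ _ (by omega) (fun q hq => tR_mul_sN F k i q (by omega) hq),
      sum_crossAct_mul F k _ _ (by omega) (fun q hq => uR_mul_sN F k i q (by omega) hq)]
  | dot j h r hr =>
    rw [ract_mul, ract_xiN F k _ (by omega), ← mul_assoc, ← hr, ofCoord_dotAct F k _ (by omega)]
  | add r r' hr hr' => rw [ract_add, hadd, hr, hr', mul_add]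
  | smul c r hr => rw [ract_smul, hsmul, hr, mul_smul_comm]

theorem crossAct_single (h : i + 1 < q) (a : RAlg F k) :
    crossAct F k i (sgl F k q a) = sgl F k q (a * sN F k i) := by
  funext p
  by_cases hp : p = q
  · subst hp
    rw [crossAct_of_gt F k _ h, sgl_same, sgl_same]
  · show sgl F k q a p * _ + _ = _
    rw [sgl_ne hp, sgl_ne hp, sgl_ne (by omega), ite_self,
      zero_mul, zero_add]

theorem crossAct_single_succ (a : RAlg F k) :
    crossAct F k i (sgl F k (i + 1) a) = sgl F k i a := by
  funext p
  by_cases hp : p = i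
  · subst hp
    rw [crossAct_self F k _ rfl, sgl_same, sgl_same]
  · show sgl F k (i + 1) a p * _ + _ = _
    rw [sgl_ne hp, if_neg hp, add_zero]
    by_cases hp' : p = i + 1
    · rw [sT_of_eq F k (Or.inr hp'), mul_zero]
    · rw [sgl_ne hp', zero_mul]

theorem dotAct_sgl (h : j < k) (b c : RAlg F k) : dotAct F k j (sgl F k k b, sgl F k k c) =
    (sgl F k k (b * xiN F k j), sgl F k k (-(c * xiN F k j))) := by
  refine Prod.ext (funext fun p => ?_) (funext fun p => ?_)
  · show (if p = j then 0 else sgl F k k b p * xT F k j p) = sgl F k k (b * xiN F k j) p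
    by_cases hp : p = k
    · subst hp
      rw [if_neg (by omega), sgl_same, sgl_same, xT_of_lt F p h]
    · rw [sgl_ne hp, sgl_ne hp, zero_mul, ite_self]
  · show (if p = j then sgl F k k b p else -(sgl F k k c p * xT F k j p)) =
      sgl F k k (-(c * xiN F k j)) p
    by_cases hp : p = k
    · subst hp
      rw [if_neg (by omega), sgl_same, sgl_same, xT_of_lt F p h]
    · rw [sgl_ne hp, sgl_ne hp, sgl_ne hp, zero_mul, neg_zero, ite_self]

theorem ract_incl (a b c : RAlg F k) : ract F k (incl F k a) (sgl F k k b, sgl F k k c) =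
    (sgl F k k (b * a), sgl F k k (c * RNil.par F k a)) := by
  induction a using RNil.induction_right with
  | one => rw [map_one, ract_one, RNil.par_one, mul_one, mul_one]
  | crossing i h r hr =>
    rw [map_mul, ract_mul, hr, incl_sN F k i h, ract_sN F k _ (by omega), RNil.par_mul, RNil.par_sN,
      ← mul_assoc, ← mul_assoc, ← crossAct_single F k h, ← crossAct_single F k h]
    rfl
  | dot j h r hr =>
    rw [map_mul, ract_mul, hr, incl_xiN F k j h, ract_xiN F k _ (by omega), RNil.par_mul,
      RNil.par_xiN]
    rw [dotAct_sgl F k h, mul_neg, mul_neg, mul_assoc, mul_assoc]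
  | add r r' hr hr' =>
    rw [map_add, ract_add, hr, hr', RNil.par_add, mul_add, mul_add, sgl_add, sgl_add]
    rfl
  | smul t r hr =>
    rw [map_smul, ract_smul, hr, RNil.par_smul, mul_smul_comm, mul_smul_comm, sgl_smul,
      sgl_smul]
    rfl

theorem ract_tR (q : ℕ) (hq : q ≤ k) (b c : RAlg F k) :
    ract F k (tR F k q) (sgl F k k b, sgl F k k c) = (sgl F k q b, sgl F k q c) := by
  induction hr : k - q generalizing q with
  | zero =>
    obtain rfl : q = k := by omega
    rw [tR_last, ract_one]
  | succ r ih =>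
    rw [← tR_succ_mul F k q (by omega), ract_mul, ih (q + 1) (by omega) (by omega),
      ract_sN F k _ (by omega)]
    exact Prod.ext (crossAct_single_succ F k b) (crossAct_single_succ F k c)

theorem ract_xiN_last : ract F k (xiN F (k + 1) k) (sgl F k k 1, 0) = (0, sgl F k k 1) := by
  rw [ract_xiN F k _ le_rfl]
  ext p
  · by_cases hp : p = k
    · rw [dotAct_fst_self F k _ hp]; rfl
    · rw [dotAct_fst_ne F k _ hp]
      show sgl F k k 1 p * _ = 0
      rw [sgl_ne hp, zero_mul]
  · by_cases hp : p = k
    · rw [dotAct_snd_self F k _ hp]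
    · rw [dotAct_snd_ne F k _ hp]
      show -((0 : RAlg F k) * _) = sgl F k k 1 p
      rw [sgl_ne hp, zero_mul, neg_zero]

/-- The coordinates of an element of `R_{k+1}^nil`. -/
noncomputable def coord : RAlg F (k + 1) →ₗ[F] Coord F k where
  toFun r := ract F k r (sgl F k k 1, 0)
  map_add' r r' := ract_add F k _ r r'
  map_smul' c r := ract_smul F k _ c r

theorem coord_mul (r r' : RAlg F (k + 1)) : coord F k (r * r') = ract F k r' (coord F k r) :=
  ract_mul F k _ r r'

/-- The coordinates of `1` give back `1`, and the action on coordinates corresponds to right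
multiplication; hence the `t_q` and `u_q` span over `R_k^nil`. -/
theorem ofCoord_coord (r : RAlg F (k + 1)) : ofCoord F k (coord F k r) = r := by
  show ofCoord F k (ract F k r (sgl F k k 1, 0)) = r
  rw [ofCoord_ract, ofCoord, Finset.sum_eq_single k]
  · show (incl F k (sgl F k k 1 k) * _ + incl F k ((0 : ℕ → RAlg F k) k) * _) * _ = _
    rw [sgl_same, map_one, tR_last, one_mul, Pi.zero_apply, map_zero, zero_mul, add_zero,
      one_mul]
  · intro q _ hq
    show incl F k (sgl F k k 1 q) * _ + incl F k ((0 : ℕ → RAlg F k) q) * _ = _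
    rw [sgl_ne hq, Pi.zero_apply, map_zero, zero_mul, zero_mul, add_zero]
  · intro h
    exact absurd (Finset.mem_range.2 (by omega)) h

theorem coord_incl_mul (a : RAlg F k) (r : RAlg F (k + 1)) :
    coord F k (incl F k a * r) = a • coord F k r := by
  have h : coord F k (incl F k a) = a • ((sgl F k k 1, 0) : Coord F k) := by
    have := ract_incl F k a 1 0
    rw [sgl_zero] at this
    refine this.trans ?_
    rw [zero_mul, one_mul, sgl_zero, Prod.smul_mk, smul_zero, ← sgl_mul, mul_one]
  rw [coord_mul, h, ract_left_smul]
  rfl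

/-- With `coord_uR` and left linearity of `coord`, this is the independence of the `t_q` and `u_q`
over `R_k^nil`. -/
theorem coord_tR (q : ℕ) (hq : q ≤ k) : coord F k (tR F k q) = (sgl F k q 1, 0) := by
  have := ract_tR F k q hq 1 0
  rwa [sgl_zero, sgl_zero] at this

theorem coord_uR (q : ℕ) (hq : q ≤ k) : coord F k (uR F k q) = (0, sgl F k q 1) := by
  have h : coord F k (xiN F (k + 1) k) = _ := ract_xiN_last F k
  have := ract_tR F k q hq 0 1
  rw [sgl_zero, sgl_zero] at this
  rw [uR, coord_mul, h, this]

theorem incl_injective : Function.Injective (incl F k) := by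
  intro a b hab
  have h1 := coord_incl_mul F k a 1
  rw [hab, coord_incl_mul, ← tR_last, coord_tR F k k le_rfl] at h1
  have h2 : b * sgl F k k 1 k = a * sgl F k k 1 k := congrFun (congrArg Prod.fst h1) k
  rw [sgl_same, mul_one, mul_one] at h2
  exact h2.symm

end RightAction

/-! ### The filtration of `R_{k+1}^nil` and its cohomology in terms of `R_k^nil`. -/

section Filtration

variable (F : Type u) [Field F] (k : ℕ)

/-- The elements of `R_{k+1}^nil` whose first coordinates of both kinds vanish. -/
noncomputable def fil (n m : ℕ) : Submodule F (RAlg F (k + 1)) where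
  carrier := {z | (∀ q < n, (coord F k z).1 q = 0) ∧ ∀ q < m, (coord F k z).2 q = 0}
  zero_mem' := by
    rw [Set.mem_ofPred_eq, map_zero]
    exact ⟨fun _ _ => rfl, fun _ _ => rfl⟩
  add_mem' := by
    rintro z w ⟨hz, hz'⟩ ⟨hw, hw'⟩
    rw [Set.mem_ofPred_eq, map_add]
    refine ⟨fun q hq => ?_, fun q hq => ?_⟩
    · rw [Prod.fst_add, Pi.add_apply, hz q hq, hw q hq, add_zero]
    · rw [Prod.snd_add, Pi.add_apply, hz' q hq, hw' q hq, add_zero]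
  smul_mem' := by
    rintro c z ⟨hz, hz'⟩
    rw [Set.mem_ofPred_eq, map_smul]
    refine ⟨fun q hq => ?_, fun q hq => ?_⟩
    · rw [Prod.smul_fst, Pi.smul_apply, hz q hq, smul_zero]
    · rw [Prod.smul_snd, Pi.smul_apply, hz' q hq, smul_zero]

variable {n m n' m' : ℕ}

theorem mem_fil (z : RAlg F (k + 1)) : z ∈ fil F k n m ↔
    (∀ q < n, (coord F k z).1 q = 0) ∧ ∀ q < m, (coord F k z).2 q = 0 := Iff.rfl

theorem fil_mono (hn : n ≤ n') (hm : m ≤ m') : fil F k n' m' ≤ fil F k n m :=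
  fun _ hz => ⟨fun q hq => hz.1 q (by omega), fun q hq => hz.2 q (by omega)⟩

theorem incl_mul_mem_fil (a : RAlg F k) {z : RAlg F (k + 1)} (hz : z ∈ fil F k n m) :
    incl F k a * z ∈ fil F k n m := by
  rw [mem_fil, coord_incl_mul]
  refine ⟨fun q hq => ?_, fun q hq => ?_⟩
  · rw [Prod.smul_fst, Pi.smul_apply, hz.1 q hq, smul_zero]
  · rw [Prod.smul_snd, Pi.smul_apply, hz.2 q hq, smul_zero]

variable {q : ℕ}

theorem tR_mem_fil (hn : n ≤ q) (hq : q ≤ k) : tR F k q ∈ fil F k n m := by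
  rw [mem_fil, coord_tR F k q hq]
  exact ⟨fun p hp => sgl_ne (by omega) _, fun p _ => rfl⟩

theorem uR_mem_fil (hm : m ≤ q) (hq : q ≤ k) : uR F k q ∈ fil F k n m := by
  rw [mem_fil, coord_uR F k q hq]
  exact ⟨fun p _ => rfl, fun p hp => sgl_ne (by omega) _⟩

/-- The only entry that a crossing moves is the one at `i + 1`, which goes to `i`; this can break
the vanishing conditions only when they stop exactly at `i + 1`. -/
theorem mul_sN_mem_fil (i : ℕ) (hi : i < k) (hn : n ≠ i + 1) (hm : m ≠ i + 1)
    {z : RAlg F (k + 1)} (hz : z ∈ fil F k n m) : z * sN F (k + 1) i ∈ fil F k n m := by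
  have key : ∀ (f : ℕ → RAlg F k) (n : ℕ), n ≠ i + 1 → (∀ q < n, f q = 0) → ∀ q < n,
      crossAct F k i f q = 0 := by
    intro f n hn hf q hq
    show f q * _ + _ = 0
    rw [hf q hq, zero_mul, zero_add]
    split_ifs with h
    · exact hf _ (by omega)
    · rfl
  rw [mem_fil, coord_mul, ract_sN F k _ hi]
  exact ⟨key _ n hn hz.1, key _ m hm hz.2⟩

theorem par_tR (q : ℕ) : RNil.par F (k + 1) (tR F k q) = tR F k q := by
  unfold tR
  induction k - q with
  | zero => exact RNil.par_one F _
  | succ r ih => rw [sDesc, RNil.par_mul, ih, RNil.par_sN]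

theorem par_uR (q : ℕ) : RNil.par F (k + 1) (uR F k q) = -uR F k q := by
  rw [uR, RNil.par_mul, par_tR, RNil.par_xiN, neg_mul]

theorem uR_succ_mul (q : ℕ) (h : q < k) : uR F k (q + 1) * sN F (k + 1) q = uR F k q := by
  rw [uR, uR, mul_assoc, tR_succ_mul F k q h]

/-- The leading term of `d t_q`: differentiating the rightmost crossing gives `ξ_q - ξ_{q+1}`, and
`t_{q+1}` carries `ξ_{q+1}` to the last strand, producing `u_{q+1}` with sign `-1`. All other terms
lie deeper in the filtration. -/
theorem d_tR_add_uR (hq : q < k) (ih : RNil.d F (k + 1) (tR F k (q + 1)) ∈ fil F k (q + 2) (q + 2)) :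
    RNil.d F (k + 1) (tR F k q) + uR F k (q + 1) ∈ fil F k (q + 1) (q + 2) := by
  have e : RNil.d F (k + 1) (tR F k q) + uR F k (q + 1) =
      incl F k (xiN F k q) * tR F k (q + 1) + RNil.d F (k + 1) (tR F k (q + 1)) * sN F (k + 1) q := by
    rw [← tR_succ_mul F k q hq, RNil.d_mul, par_tR, d_sN F _ q (by omega), mul_sub,
      tR_mul_xiN F k _ _ (by omega) (by omega), tR_mul_xiN F k _ _ (by omega) (by omega),
      if_neg (by omega), if_pos rfl, xT_of_lt F k (by omega), ← uR]
    abel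
  rw [e]
  exact Submodule.add_mem _ (incl_mul_mem_fil F k _ (tR_mem_fil F k le_rfl (by omega)))
    (fil_mono F k (by omega) le_rfl (mul_sN_mem_fil F k q hq (by omega) (by omega) ih))

theorem d_tR_mem (hq : q ≤ k) : RNil.d F (k + 1) (tR F k q) ∈ fil F k (q + 1) (q + 1) := by
  induction hr : k - q generalizing q with
  | zero =>
    obtain rfl : q = k := by omega
    rw [tR_last, RNil.d_one]
    exact Submodule.zero_mem _
  | succ r ih =>
    have h := d_tR_add_uR F k (by omega) (ih (q := q + 1) (by omega) (by omega))
    rw [← add_sub_cancel_right (RNil.d F (k + 1) (tR F k q)) (uR F k (q + 1))]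
    exact Submodule.sub_mem _ (fil_mono F k le_rfl (by omega) h)
      (uR_mem_fil F k le_rfl (by omega))

/-- As for `t_q`, except that the leading term would contain the last dot twice and so vanishes. -/
theorem d_uR_mem (hq : q ≤ k) : RNil.d F (k + 1) (uR F k q) ∈ fil F k (q + 1) (q + 1) := by
  induction hr : k - q generalizing q with
  | zero =>
    obtain rfl : q = k := by omega
    rw [uR, tR_last, mul_one, d_xiN]
    exact Submodule.zero_mem _
  | succ r ih =>
    have h := ih (q := q + 1) (by omega) (by omega)
    have e : RNil.d F (k + 1) (uR F k q) = incl F k (xiN F k q) * uR F k (q + 1) +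
        RNil.d F (k + 1) (uR F k (q + 1)) * sN F (k + 1) q := by
      rw [← uR_succ_mul F k q (by omega), RNil.d_mul, par_uR, d_sN F _ q (by omega), mul_sub,
        neg_mul, neg_mul, uR_mul_xiN F k _ _ (by omega) (by omega),
        uR_mul_xiN F k _ _ (by omega) (by omega), if_neg (by omega), if_pos rfl,
        xT_of_lt F k (by omega), neg_neg, neg_zero, sub_zero]
    rw [e]
    exact Submodule.add_mem _ (incl_mul_mem_fil F k _ (uR_mem_fil F k le_rfl (by omega)))
      (fil_mono F k (by omega) (by omega)
        (mul_sN_mem_fil F k q (by omega) (by omega) (by omega) h))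

theorem d_incl_mul (a : RAlg F k) (z : RAlg F (k + 1)) : RNil.d F (k + 1) (incl F k a * z) =
    incl F k (RNil.par F k a) * RNil.d F (k + 1) z + incl F k (RNil.d F k a) * z := by
  rw [RNil.d_mul, par_incl, d_incl]

/-- The differentials of `t_q` and `u_q` involve later indices only. The offset between the two cuts
puts `t_p` and `u_{p+1}`, which are to cancel, in the same filtration step. -/
theorem d_mem_fil (p : ℕ) {z : RAlg F (k + 1)} (hz : z ∈ fil F k p (p + 1)) :
    RNil.d F (k + 1) z ∈ fil F k p (p + 1) := by
  rw [← ofCoord_coord F k z, ofCoord, map_sum]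
  refine Submodule.sum_mem _ fun q hq => ?_
  have hq : q ≤ k := by have := Finset.mem_range.1 hq; omega
  rw [map_add, d_incl_mul, d_incl_mul]
  refine Submodule.add_mem _ ?_ ?_
  · by_cases h : q < p
    · rw [hz.1 q h, RNil.par_zero, map_zero, map_zero, map_zero, zero_mul, zero_mul, add_zero]
      exact Submodule.zero_mem _
    · exact Submodule.add_mem _ (incl_mul_mem_fil F k _ (fil_mono F k (by omega) (by omega)
        (d_tR_mem F k hq))) (incl_mul_mem_fil F k _ (tR_mem_fil F k (by omega) hq))
  · by_cases h : q < p + 1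
    · rw [hz.2 q h, RNil.par_zero, map_zero, map_zero, map_zero, zero_mul, zero_mul, add_zero]
      exact Submodule.zero_mem _
    · exact Submodule.add_mem _ (incl_mul_mem_fil F k _ (fil_mono F k (by omega) (by omega)
        (d_uR_mem F k hq))) (incl_mul_mem_fil F k _ (uR_mem_fil F k (by omega) hq))

theorem coord_incl_mul_tR (a : RAlg F k) (hq : q ≤ k) :
    coord F k (incl F k a * tR F k q) = (sgl F k q a, 0) := by
  rw [coord_incl_mul, coord_tR F k q hq, Prod.smul_mk, smul_zero, ← sgl_mul, mul_one]

theorem coord_incl_mul_uR (a : RAlg F k) (hq : q ≤ k) :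
    coord F k (incl F k a * uR F k q) = (0, sgl F k q a) := by
  rw [coord_incl_mul, coord_uR F k q hq, Prod.smul_mk, smul_zero, ← sgl_mul, mul_one]

theorem coord_incl (a : RAlg F k) : coord F k (incl F k a) = (sgl F k k a, 0) := by
  rw [← mul_one (incl F k a), ← tR_last, coord_incl_mul_tR F k a le_rfl]

/-- Gaussian elimination: `t_p` cancels against `u_{p+1}`, so their coefficients can be removed by
subtracting a coboundary, which moves `z` one step down. At the end only `t_k = 1` is left. -/
theorem exists_eq_incl_add_d (p : ℕ) (hp : p ≤ k) (z : RAlg F (k + 1)) (hz : z ∈ fil F k p (p + 1))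
    (c : RAlg F k) (hd : RNil.d F (k + 1) z = incl F k c) :
    ∃ a y, z = incl F k a + RNil.d F (k + 1) y := by
  induction hr : k - p generalizing p z with
  | zero =>
    obtain rfl : p = k := by omega
    refine ⟨(coord F p z).1 p, 0, ?_⟩
    rw [map_zero, add_zero]
    conv_lhs => rw [← ofCoord_coord F p z, ofCoord]
    rw [Finset.sum_range_succ, Finset.sum_eq_zero, zero_add, hz.2 p (by omega), map_zero, zero_mul,
      add_zero, tR_last, mul_one]
    intro q hq
    have := Finset.mem_range.1 hq
    rw [hz.1 q this, hz.2 q (by omega), map_zero, zero_mul, zero_mul, add_zero]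
  | succ r ih =>
    set α := (coord F k z).1 p
    set β := (coord F k z).2 (p + 1)
    set w := z - incl F k α * tR F k p - incl F k β * uR F k (p + 1) with hw
    have hwm : w ∈ fil F k (p + 1) (p + 2) := by
      rw [mem_fil, hw, map_sub, map_sub, coord_incl_mul_tR F k _ hp,
        coord_incl_mul_uR F k _ (by omega)]
      refine ⟨fun q hq => ?_, fun q hq => ?_⟩
      · show (coord F k z).1 q - sgl F k p α q - 0 = 0
        by_cases h : q = p
        · rw [h, sgl_same, sub_self, sub_self]
        · rw [hz.1 q (by omega), sgl_ne h, sub_self, sub_self]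
      · show (coord F k z).2 q - 0 - sgl F k (p + 1) β q = 0
        by_cases h : q = p + 1
        · rw [h, sgl_same, sub_zero, sub_self]
        · rw [hz.2 q (by omega), sgl_ne h, sub_self, sub_self]
    have htu := d_tR_add_uR F k (q := p) (by omega) (d_tR_mem F k (by omega))
    have hdz : RNil.d F (k + 1) z - incl F k (RNil.d F k β - RNil.par F k α) * uR F k (p + 1) -
        incl F k (RNil.d F k α) * tR F k p ∈ fil F k (p + 1) (p + 2) := by
      have e : RNil.d F (k + 1) z - incl F k (RNil.d F k β - RNil.par F k α) * uR F k (p + 1) -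
          incl F k (RNil.d F k α) * tR F k p = RNil.d F (k + 1) w +
          incl F k (RNil.par F k α) * (RNil.d F (k + 1) (tR F k p) + uR F k (p + 1)) +
          incl F k (RNil.par F k β) * RNil.d F (k + 1) (uR F k (p + 1)) := by
        rw [hw, map_sub (RNil.d F (k + 1)), map_sub (RNil.d F (k + 1)), d_incl_mul, d_incl_mul,
          map_sub (incl F k), sub_mul, mul_add]
        abel
      rw [e]
      exact Submodule.add_mem _ (Submodule.add_mem _ (d_mem_fil F k (p + 1) hwm)
        (incl_mul_mem_fil F k _ htu)) (incl_mul_mem_fil F k _ (fil_mono F k (by omega) (by omega)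
          (d_uR_mem F k (by omega))))
    -- The differential of `z` lies in `R_k^nil`, so its coefficient at `u_{p+1}` is zero; this ties
    -- `α` to the differential of `β`.
    have hαβ : RNil.d F k β = RNil.par F k α := by
      have h := hdz.2 (p + 1) (by omega)
      rw [hd, map_sub, map_sub, coord_incl, coord_incl_mul_tR F k _ hp,
        coord_incl_mul_uR F k _ (by omega)] at h
      change (0 : RAlg F k) - sgl F k (p + 1) _ (p + 1) - 0 = 0 at h
      rwa [sgl_same, sub_zero, zero_sub, neg_eq_zero, sub_eq_zero] at h
    have hdb : RNil.d F k (-RNil.par F k β) = α := by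
      rw [map_neg, RNil.d_par, neg_neg, hαβ, RNil.par_par]
    -- The coboundary of `-par β * t_p` reproduces both coefficients: the derivative of the
    -- coefficient gives `α * t_p`, the leading term of `d t_p` gives `β * u_{p+1}`.
    have hy : z - RNil.d F (k + 1) (incl F k (-RNil.par F k β) * tR F k p) =
        w + incl F k β * (RNil.d F (k + 1) (tR F k p) + uR F k (p + 1)) := by
      rw [d_incl_mul, hdb, RNil.par_neg, RNil.par_par, hw, map_neg, neg_mul, mul_add]
      abel
    obtain ⟨a, y, h⟩ := ih (p + 1) (by omega)
      (z - RNil.d F (k + 1) (incl F k (-RNil.par F k β) * tR F k p)) (by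
      rw [hy]
      exact Submodule.add_mem _ hwm (incl_mul_mem_fil F k _ htu)) (by
      rw [map_sub, RNil.d_d, sub_zero, hd]) (by omega)
    refine ⟨a, y + incl F k (-RNil.par F k β) * tR F k p, ?_⟩
    rw [map_add, ← add_assoc, ← h, sub_add_cancel]

theorem ract_sum {ι : Type*} (s : Finset ι) (r : ι → RAlg F (k + 1)) (v : Coord F k) :
    ract F k (∑ i ∈ s, r i) v = ∑ i ∈ s, ract F k (r i) v := by
  induction s using Finset.cons_induction with
  | empty =>
    rw [Finset.sum_empty, Finset.sum_empty, ← zero_smul F (0 : RAlg F (k + 1)), ract_smul, zero_smul]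
  | cons a s ha ih => rw [Finset.sum_cons, Finset.sum_cons, ract_add, ih]

theorem ract_sSum (v : Coord F k) : ract F k (sSum F (k + 1)) v =
    (∑ i ∈ Finset.range k, crossAct F k i v.1, ∑ i ∈ Finset.range k, crossAct F k i v.2) := by
  rw [sSum, Finset.sum_range_succ, sN_of_not_lt F (k + 1) k (by omega), add_zero, ract_sum,
    Finset.sum_congr rfl fun i hi => ract_sN F k v (Finset.mem_range.1 hi)]
  exact Prod.ext (by rw [Prod.fst_sum]; rfl) (by rw [Prod.snd_sum]; rfl)

theorem sum_crossAct_of_eq_zero (f : ℕ → RAlg F k) (h : f q = 0) :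
    (∑ i ∈ Finset.range k, crossAct F k i f) q = if q < k then f (q + 1) else 0 := by
  have : ∀ i, crossAct F k i f q = if q = i then f (q + 1) else 0 := by
    intro i
    show f q * _ + _ = _
    rw [h, zero_mul, zero_add]
    split_ifs with h
    · rw [h]
    · rfl
  rw [Finset.sum_apply, Finset.sum_congr rfl fun i _ => this i, Finset.sum_ite_eq]
  simp only [Finset.mem_range]

theorem ract_eta_succ (m : ℕ) (v : Coord F k) : ract F k (eta F (k + 1) (m + 1)) v =
    ract F k (eta F (k + 1) m) (ract F k (sSum F (k + 1)) v) -
      ract F k (sSum F (k + 1)) (ract F k (eta F (k + 1) m) v) := by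
  rw [eta, sub_eq_add_neg, ← neg_one_smul F, ract_add, ract_smul, ract_mul, ract_mul, neg_one_smul,
    ← sub_eq_add_neg]

theorem ract_eta_snd_eq_zero (m : ℕ) (v : Coord F k) (hv : v.2 = 0)
    (hv' : ∀ q < m + 1, v.1 q = 0) : (ract F k (eta F (k + 1) m) v).2 = 0 := by
  induction m generalizing v with
  | zero =>
    rw [eta, ract_xiN F k v (Nat.zero_le k)]
    funext q
    by_cases h : q = 0
    · rw [dotAct_snd_self F k _ h, hv' q (by omega)]; rfl
    · rw [dotAct_snd_ne F k _ h, hv, Pi.zero_apply, zero_mul, neg_zero]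
  | succ m ih =>
    rw [ract_eta_succ, Prod.snd_sub, ih, ract_sSum]
    · show 0 - ∑ i ∈ Finset.range k, crossAct F k i (ract F k (eta F (k + 1) m) v).2 = 0
      rw [ih v hv fun q hq => hv' q (by omega)]
      simp only [map_zero, Finset.sum_const_zero, sub_zero]
    · rw [ract_sSum, hv]
      simp only [map_zero, Finset.sum_const_zero]
    · intro q hq
      rw [ract_sSum]
      show (∑ i ∈ Finset.range k, crossAct F k i v.1) q = 0
      rw [sum_crossAct_of_eq_zero F k _ (hv' q (by omega)), hv' (q + 1) (by omega), ite_self]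

/-- Where entries vanish, `S` moves the next entry down by one position, and `ξ_0` turns the first
entry `0` into the second entry `0`. So `η_m` brings entry `m` down step by step; the other term of
each commutator drops out by `ract_eta_snd_eq_zero`. -/
theorem ract_eta_snd (m : ℕ) (hm : m ≤ k) (v : Coord F k) (hv : v.2 = 0)
    (hv' : ∀ q < m, v.1 q = 0) : (ract F k (eta F (k + 1) m) v).2 0 = v.1 m := by
  induction m generalizing v with
  | zero => rw [eta, ract_xiN F k v (Nat.zero_le k), dotAct_snd_self F k _ rfl]
  | succ m ih =>
    rw [ract_eta_succ, Prod.snd_sub, Pi.sub_apply, ih (by omega), ract_sSum, ract_sSum]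
    · show (∑ i ∈ Finset.range k, crossAct F k i v.1) m -
        (∑ i ∈ Finset.range k, crossAct F k i (ract F k (eta F (k + 1) m) v).2) 0 = _
      rw [ract_eta_snd_eq_zero F k m v hv hv', sum_crossAct_of_eq_zero F k _ (hv' m (by omega)),
        if_pos (by omega)]
      simp only [map_zero, Finset.sum_const_zero, Pi.zero_apply, sub_zero]
    · rw [ract_sSum, hv]
      simp only [map_zero, Finset.sum_const_zero]
    · intro q hq
      rw [ract_sSum]
      show (∑ i ∈ Finset.range k, crossAct F k i v.1) q = 0
      rw [sum_crossAct_of_eq_zero F k _ (hv' q (by omega)), hv' (q + 1) (by omega), ite_self]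

theorem coord_eta_last : (coord F k (eta F (k + 1) k)).2 0 = 1 := by
  have := ract_eta_snd F k k le_rfl (sgl F k k 1, 0) rfl fun q hq => sgl_ne (by omega) _
  exact this.trans (sgl_same k 1)

theorem coord_incl_mul_eta (a : RAlg F k) :
    (coord F k (incl F k a * eta F (k + 1) k)).2 0 = a := by
  rw [coord_incl_mul, Prod.smul_snd, Pi.smul_apply, coord_eta_last, smul_eq_mul, mul_one]

theorem d_incl_mul_eta (a : RAlg F k) : RNil.d F (k + 1) (incl F k a * eta F (k + 1) k) =
    incl F k (RNil.d F k a) * eta F (k + 1) k := by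
  rw [d_incl_mul, d_eta F (k + 1) k (by omega), mul_zero, zero_add]

/-- The coefficient of `u_0` is a chain map: after subtracting that multiple of the cocycle `η_k`,
the element lies in the subcomplex `fil F k 0 1`. -/
theorem coord_d_snd_zero (z : RAlg F (k + 1)) :
    (coord F k (RNil.d F (k + 1) z)).2 0 = RNil.d F k ((coord F k z).2 0) := by
  set b := (coord F k z).2 0
  have h1 : z - incl F k b * eta F (k + 1) k ∈ fil F k 0 1 := by
    refine ⟨fun q hq => absurd hq (Nat.not_lt_zero q), fun q hq => ?_⟩
    obtain rfl : q = 0 := by omega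
    rw [map_sub, Prod.snd_sub, Pi.sub_apply, coord_incl_mul_eta, sub_self]
  have h2 := (d_mem_fil F k 0 h1).2 0 (by omega)
  rwa [map_sub, d_incl_mul_eta, map_sub, Prod.snd_sub, Pi.sub_apply, coord_incl_mul_eta,
    sub_eq_zero] at h2

/-- Subtracting the multiple of `η_k` reduces this to the elimination with `p = 0`. Cocycles have `c
= 0`; nonzero `c` is needed for primitives, in the uniqueness statement. -/
theorem exists_eq_incl_add_incl_mul_eta (z : RAlg F (k + 1)) (c : RAlg F k)
    (hd : RNil.d F (k + 1) z = incl F k c +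
      incl F k (RNil.d F k ((coord F k z).2 0)) * eta F (k + 1) k) :
    ∃ a y, z = incl F k a + incl F k ((coord F k z).2 0) * eta F (k + 1) k +
      RNil.d F (k + 1) y := by
  set b := (coord F k z).2 0
  have h1 : z - incl F k b * eta F (k + 1) k ∈ fil F k 0 1 := by
    refine ⟨fun q hq => absurd hq (Nat.not_lt_zero q), fun q hq => ?_⟩
    obtain rfl : q = 0 := by omega
    rw [map_sub, Prod.snd_sub, Pi.sub_apply, coord_incl_mul_eta, sub_self]
  obtain ⟨a, y, h⟩ := exists_eq_incl_add_d F k 0 (Nat.zero_le k) _ h1 c (by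
    rw [map_sub, d_incl_mul_eta, hd, add_sub_cancel_right])
  refine ⟨a, y, ?_⟩
  rw [add_right_comm, ← h, sub_add_cancel]

/-- Every cocycle of `R_{k+1}^nil` is cohomologous to a combination of `1` and `eta k` with
coefficients that are cocycles of `R_k^nil`. -/
theorem exists_cocycle_decomposition (z : RAlg F (k + 1)) (hz : RNil.d F (k + 1) z = 0) :
    ∃ a b y, RNil.d F k a = 0 ∧ RNil.d F k b = 0 ∧
      z = incl F k a + incl F k b * eta F (k + 1) k + RNil.d F (k + 1) y := by
  have hb : RNil.d F k ((coord F k z).2 0) = 0 := by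
    rw [← coord_d_snd_zero, hz, map_zero]; rfl
  obtain ⟨a, y, h⟩ := exists_eq_incl_add_incl_mul_eta F k z 0 (by
    rw [hb, map_zero, zero_mul, add_zero, hz])
  refine ⟨a, _, y, ?_, hb, h⟩
  have := congrArg (RNil.d F (k + 1)) h
  rw [hz, map_add, map_add, d_incl, d_incl_mul_eta, hb, RNil.d_d, map_zero, zero_mul, add_zero,
    add_zero] at this
  exact incl_injective F k (this.symm.trans (map_zero _).symm)

/-- The decomposition of a cohomology class of `R_{k+1}^nil` is unique. -/
theorem coboundary_decomposition (a b : RAlg F k) (y : RAlg F (k + 1))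
    (h : incl F k a + incl F k b * eta F (k + 1) k = RNil.d F (k + 1) y) :
    (∃ a', a = RNil.d F k a') ∧ ∃ b', b = RNil.d F k b' := by
  have hb : b = RNil.d F k ((coord F k y).2 0) := by
    rw [← coord_d_snd_zero, ← h, map_add, Prod.snd_add, Pi.add_apply, coord_incl_mul_eta, coord_incl]
    exact (zero_add b).symm
  -- The primitive decomposes too, and comparing differentials exhibits `a` as a coboundary.
  obtain ⟨a', y', h'⟩ := exists_eq_incl_add_incl_mul_eta F k y a (by rw [← hb, h])
  have := congrArg (RNil.d F (k + 1)) h'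
  rw [← h, map_add, map_add, d_incl, d_incl_mul_eta, ← hb, RNil.d_d, add_zero] at this
  exact ⟨⟨a', incl_injective F k (add_right_cancel this)⟩, _, hb⟩

end Filtration

/-! ### Ordered monomials in the `η_m` as a basis of the cohomology. -/

section Cohomology

variable (F : Type u) [Field F] (k : ℕ)

theorem incl_mono_eta (S : LI F k) :
    incl F k (mono F (eta F k) k S) = mono F (eta F (k + 1)) k S :=
  (map_mono F (incl F k : RAlg F k →+* RAlg F (k + 1)) _ k S).trans
    (mono_congr F _ _ k (fun j hj => incl_eta F k j hj) S)

theorem exists_eq_smul_one (z : RAlg F 0) : ∃ c : F, z = c • 1 := by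
  induction z using RNil.induction_right with
  | one => exact ⟨1, (one_smul F _).symm⟩
  | crossing i h => omega
  | dot j h => omega
  | add a b ha hb =>
    obtain ⟨c, rfl⟩ := ha
    obtain ⟨c', rfl⟩ := hb
    exact ⟨c + c', (add_smul c c' _).symm⟩
  | smul c a ha =>
    obtain ⟨c', rfl⟩ := ha
    exact ⟨c * c', smul_smul c c' _⟩

/-- Every cocycle is cohomologous to a combination of the ordered monomials in the elements `eta`. -/
theorem exists_eq_sum_mono_eta_add_d (z : RAlg F k) (hz : RNil.d F k z = 0) :
    ∃ (c : LI F k → F) (y : RAlg F k),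
      z = ∑ S, c S • mono F (eta F k) k S + RNil.d F k y := by
  induction k with
  | zero =>
    obtain ⟨c, rfl⟩ := exists_eq_smul_one F z
    refine ⟨fun _ => c, 0, ?_⟩
    rw [map_zero, add_zero]
    exact (Fintype.sum_unique (ι := Unit) fun _ => c • (1 : RAlg F 0)).symm
  | succ k ih =>
    obtain ⟨a, b, y, ha, hb, rfl⟩ := exists_cocycle_decomposition F k z hz
    obtain ⟨c₀, y₀, rfl⟩ := ih a ha
    obtain ⟨c₁, y₁, rfl⟩ := ih b hb
    refine ⟨fun S => if final S = 1 then c₁ (initial S) else c₀ (initial S),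
      incl F k y₀ + incl F k y₁ * eta F (k + 1) k + y, ?_⟩
    rw [sum_sn]
    simp only [final_sn, initial_sn, mono_succ_zero, mono_succ_one, if_true,
      zero_ne_one, if_false]
    simp only [map_add, map_sum, map_smul, incl_mono_eta, d_incl, d_incl_mul_eta,
      Finset.sum_add_distrib, add_mul, Finset.sum_mul, smul_mul_assoc]
    abel

/-- The ordered monomials in the elements `eta` are linearly independent modulo coboundaries. -/
theorem eq_zero_of_sum_mono_eta_eq_d (c : LI F k → F) (y : RAlg F k)
    (h : ∑ S, c S • mono F (eta F k) k S = RNil.d F k y) : c = 0 := by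
  induction k with
  | zero =>
    -- The augmentation shows that `1` is nonzero in the algebra on no strands.
    let ε : RAlg F 0 →ₐ[F] F := RNil.lift (fun _ => 0) (fun _ => 0) (by simp) (by simp) (by simp)
      (by simp) (by simp) (by simp) (by simp) (by simp)
    have hy : RNil.d F 0 y = 0 := by
      obtain ⟨t, rfl⟩ := exists_eq_smul_one F y
      rw [map_smul, RNil.d_one, smul_zero]
    have h1 : ∑ S, c S • mono F (eta F 0) 0 S = c () • (1 : RAlg F 0) :=
      Fintype.sum_unique (ι := Unit) fun S => c S • (1 : RAlg F 0)
    have h2 := congrArg ε (h1.symm.trans (h.trans hy))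
    rw [map_smul, map_one, map_zero, smul_eq_mul, mul_one] at h2
    funext S
    exact h2
  | succ k ih =>
    have e : ∑ S, c S • mono F (eta F (k + 1)) (k + 1) S =
        incl F k (∑ S, c (sn S 0) • mono F (eta F k) k S) +
          incl F k (∑ S, c (sn S 1) • mono F (eta F k) k S) * eta F (k + 1) k := by
      rw [sum_sn]
      simp only [mono_succ_zero, mono_succ_one, map_sum, map_smul, incl_mono_eta,
        Finset.sum_add_distrib, Finset.sum_mul, smul_mul_assoc]
    rw [e] at h
    obtain ⟨⟨y₀, h₀⟩, y₁, h₁⟩ := coboundary_decomposition F k _ _ y h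
    have h₀ := ih _ _ h₀
    have h₁ := ih _ _ h₁
    funext S
    obtain ⟨S, i, rfl⟩ := sn_surj S
    rcases fin2_cases i with rfl | rfl
    · exact congrFun h₀ S
    · exact congrFun h₁ S

/-- The bidegree of an ordered monomial in the elements `eta`. -/
def etaDeg : (k : ℕ) → LI F k → ℤ × ℤ
  | 0, _ => 0
  | k + 1, S => etaDeg k (initial S) + if final S = 1 then (1, -2 * ((k : ℤ) + 1)) else 0

theorem mono_eta_mem (n : ℕ) (S : LI F n) :
    mono F (eta F k) n S ∈ RNil.gr F k (etaDeg F n S) := by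
  induction n with
  | zero => exact SetLike.GradedOne.one_mem (A := RNil.gr F k)
  | succ n ih =>
    obtain ⟨S, i, rfl⟩ := sn_surj S
    rcases fin2_cases i with rfl | rfl
    · exact SetLike.GradedMul.mul_mem (A := RNil.gr F k) (ih S)
        (SetLike.GradedOne.one_mem (A := RNil.gr F k))
    · exact SetLike.GradedMul.mul_mem (A := RNil.gr F k) (ih S) (eta_mem F k n)

variable {F k}

/-- A combination of monomials in the elements `eta` that is cohomologous to a homogeneous cocycle is
homogeneous. -/
theorem sum_mono_eta_mem (i : ℤ × ℤ) (c : LI F k → F) (z y : RAlg F k) (hz : z ∈ RNil.gr F k i)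
    (h : ∑ S, c S • mono F (eta F k) k S = z + RNil.d F k y) :
    ∑ S, c S • mono F (eta F k) k S ∈ RNil.gr F k i := by
  obtain ⟨π, hsame, hne, hd⟩ : ∃ π : RAlg F k →ₗ[F] RAlg F k,
      (∀ a ∈ RNil.gr F k i, π a = a) ∧ (∀ j, j ≠ i → ∀ a ∈ RNil.gr F k j, π a = 0) ∧
      ∃ y', π (RNil.d F k y) = RNil.d F k y' := by
    refine ⟨(Rnil F k).proj i, (Rnil F k).proj_same i, fun j hj => (Rnil F k).proj_ne j i hj,
      (Rnil F k).proj (i.1 - 1, i.2) y, ?_⟩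
    have h1 := (Rnil F k).d_proj (i.1 - 1) i.2 y
    rw [sub_add_cancel] at h1
    exact h1.symm
  obtain ⟨y', hy'⟩ := hd
  have hp : π (∑ S, c S • mono F (eta F k) k S) =
      ∑ S, (if etaDeg F k S = i then c S else 0) • mono F (eta F k) k S := by
    rw [map_sum]
    refine Finset.sum_congr rfl fun S _ => ?_
    rw [map_smul]
    split_ifs with hS
    · rw [hsame _ (hS ▸ mono_eta_mem F k k S)]
    · rw [hne _ hS _ (mono_eta_mem F k k S), smul_zero, zero_smul]
  rw [h, map_add, hsame z hz, hy'] at hp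
  -- The sum and its projection to bidegree `i` are cohomologous to the same cocycle, so
  -- independence modulo coboundaries kills the coefficients in all other bidegrees.
  have hc := eq_zero_of_sum_mono_eta_eq_d F k
    (fun S => c S - if etaDeg F k S = i then c S else 0) (y - y') (by
      simp only [sub_smul, Finset.sum_sub_distrib]
      rw [← hp, h, map_sub]
      abel)
  refine Submodule.sum_mem _ fun S _ => ?_
  by_cases hS : etaDeg F k S = i
  · exact Submodule.smul_mem _ _ (hS ▸ mono_eta_mem F k k S)
  · have := congrFun hc S
    simp only [if_neg hS, sub_zero, Pi.zero_apply] at this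
    rw [this, zero_smul]
    exact Submodule.zero_mem _

end Cohomology

/-! ### The exterior algebra, formality and bidegrees. -/

section Exterior

variable (F : Type u) [Field F] (k : ℕ)

/-- The generators of the exterior algebra. -/
noncomputable def extGen (j : ℕ) : ExteriorAlgebra F (Fin k → F) :=
  if h : j < k then ExteriorAlgebra.ι F (Pi.single ⟨j, h⟩ 1) else 0

theorem extGen_of_lt (j : ℕ) (h : j < k) :
    extGen F k j = ExteriorAlgebra.ι F (Pi.single ⟨j, h⟩ 1) := dif_pos h

theorem exists_eq_sum_mono_extGen (x : ExteriorAlgebra F (Fin k → F)) :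
    ∃ c : LI F k → F, x = ∑ S, c S • mono F (extGen F k) k S := by
  suffices h : x ∈ Submodule.span F (Set.range (mono F (extGen F k) k)) by
    obtain ⟨c, hc⟩ := (Submodule.mem_span_range_iff_exists_fun F).1 h
    exact ⟨c, hc.symm⟩
  suffices h : ∀ y ∈ Submodule.span F (Set.range (mono F (extGen F k) k)),
      x * y ∈ Submodule.span F (Set.range (mono F (extGen F k) k)) by
    have := h 1 (one_mem_span_mono F (extGen F k) k)
    rwa [mul_one] at this
  induction x using ExteriorAlgebra.induction with
  | algebraMap r =>
    intro y hy
    rw [← Algebra.smul_def]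
    exact Submodule.smul_mem _ r hy
  | ι v =>
    intro y hy
    have hv : ExteriorAlgebra.ι F v = ∑ j : Fin k, v j • extGen F k j := by
      conv_lhs => rw [pi_eq_sum_univ' v]
      rw [map_sum]
      refine Finset.sum_congr rfl fun j _ => ?_
      rw [map_smul, extGen_of_lt F k j j.2]
    rw [hv, Finset.sum_mul]
    refine Submodule.sum_mem _ fun j _ => ?_
    rw [smul_mul_assoc]
    refine Submodule.smul_mem _ _ ?_
    induction hy using Submodule.span_induction with
    | mem y hy =>
      obtain ⟨S, rfl⟩ := hy
      refine mul_mono_mem F _ k (fun j hj => ?_) (fun i hi j hj _ => ?_) j j.2 S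
      · rw [extGen_of_lt F k j hj, ExteriorAlgebra.ι_sq_zero]
      · rw [extGen_of_lt F k j hj, extGen_of_lt F k i hi, ← add_eq_zero_iff_eq_neg]
        exact ExteriorAlgebra.ι_add_mul_swap _ _
    | zero => rw [mul_zero]; exact Submodule.zero_mem _
    | add y y' _ _ hy hy' => rw [mul_add]; exact Submodule.add_mem _ hy hy'
    | smul c y _ hy => rw [mul_smul_comm]; exact Submodule.smul_mem _ c hy
  | mul a b ha hb =>
    intro y hy
    rw [mul_assoc]
    exact ha _ (hb _ hy)
  | add a b ha hb =>
    intro y hy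
    rw [add_mul]
    exact Submodule.add_mem _ (ha _ hy) (hb _ hy)

/-- The elements `eta` as cocycles. -/
noncomputable def etaCocycle (i : Fin k) : (Rnil F k).cocycles := ⟨eta F k i, d_eta F k i i.2⟩

variable {F}

/-- The map from the exterior algebra to the cocycles of `R_k^nil` given by the elements `eta`. -/
noncomputable def extToCocycles (hF : ringChar F ≠ 2) :
    ExteriorAlgebra F (Fin k → F) →ₐ[F] (Rnil F k).cocycles :=
  ExteriorAlgebra.lift F ⟨Fintype.linearCombination F (etaCocycle F k), fun v => by
    -- The only use of the characteristic: anticommutation yields no more than `2 x² = 0`.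
    have h2 : (2 : F) ≠ 0 := Ring.two_ne_zero hF
    have key : ∀ i j : Fin k, etaCocycle F k i * etaCocycle F k j +
        etaCocycle F k j * etaCocycle F k i = 0 := fun i j => Subtype.ext (eta_anti F k i j)
    set x := Fintype.linearCombination F (etaCocycle F k) v with hx
    have h : (2 : F) • (x * x) = 0 := by
      rw [two_smul]
      have e : x * x = ∑ i, ∑ j, (v i * v j) • (etaCocycle F k i * etaCocycle F k j) := by
        rw [hx, Fintype.linearCombination_apply, Finset.sum_mul_sum]
        simp only [smul_mul_smul_comm]
      have e' : x * x = ∑ i, ∑ j, (v i * v j) • (etaCocycle F k j * etaCocycle F k i) := by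
        rw [e, Finset.sum_comm]
        refine Finset.sum_congr rfl fun i _ => Finset.sum_congr rfl fun j _ => ?_
        rw [mul_comm (v j)]
      nth_rewrite 2 [e']
      rw [e, ← Finset.sum_add_distrib]
      refine Finset.sum_eq_zero fun i _ => ?_
      rw [← Finset.sum_add_distrib]
      refine Finset.sum_eq_zero fun j _ => ?_
      rw [← smul_add, key, smul_zero]
    exact (smul_eq_zero.1 h).resolve_left h2⟩

variable (hF : ringChar F ≠ 2)

theorem extToCocycles_ι (j : Fin k) :
    extToCocycles k hF (ExteriorAlgebra.ι F (Pi.single j 1)) = etaCocycle F k j := by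
  rw [extToCocycles, ExteriorAlgebra.lift_ι_apply, Fintype.linearCombination_apply_single, one_smul]

/-- The map from the exterior algebra to `R_k^nil` given by the elements `eta`. -/
noncomputable def extToR : ExteriorAlgebra F (Fin k → F) →ₐ[F] RAlg F k :=
  (Rnil F k).cocycles.val.comp (extToCocycles k hF)

theorem extToR_sum_mono (c : LI F k → F) :
    extToR k hF (∑ S, c S • mono F (extGen F k) k S) = ∑ S, c S • mono F (eta F k) k S := by
  rw [map_sum]
  refine Finset.sum_congr rfl fun S _ => ?_
  rw [map_smul]
  congr 1
  refine (map_mono F (extToR k hF : ExteriorAlgebra F (Fin k → F) →+* RAlg F k) _ k S).trans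
    (mono_congr F _ _ k (fun j hj => ?_) S)
  show extToR k hF (extGen F k j) = _
  rw [extGen_of_lt F k j hj]
  exact congrArg Subtype.val (extToCocycles_ι k hF ⟨j, hj⟩)

/-- Ordered monomials span the exterior algebra and go to the basis of the cohomology given by
monomials in the `η_m`. Only spanning is needed upstairs; independence downstairs gives injectivity.
-/
theorem cls_extToCocycles_bijective :
    Function.Bijective ((Rnil F k).cls.comp (extToCocycles k hF)) := by
  constructor
  · rw [injective_iff_map_eq_zero]
    intro x hx
    obtain ⟨c, rfl⟩ := exists_eq_sum_mono_extGen F k x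
    obtain ⟨y, hy⟩ := ((Rnil F k).cls_eq_zero_iff _).1 hx
    have hc := eq_zero_of_sum_mono_eta_eq_d F k c y
      ((extToR_sum_mono k hF c).symm.trans hy.symm)
    simp [hc]
  · intro h
    obtain ⟨z, rfl⟩ := Ideal.Quotient.mk_surjective h
    obtain ⟨c, y, hz⟩ := exists_eq_sum_mono_eta_add_d F k z.1 z.2
    refine ⟨∑ S, c S • mono F (extGen F k) k S, ?_⟩
    show (Rnil F k).cls _ = (Rnil F k).cls z
    rw [← sub_eq_zero, ← map_sub]
    refine ((Rnil F k).cls_eq_zero_iff _).2 ⟨-y, ?_⟩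
    show RNil.d F k (-y) = @HSub.hSub (RAlg F k) (RAlg F k) _ _ (extToR k hF _) z.1
    rw [extToR_sum_mono, hz, map_neg]
    abel

/-- The cohomology algebra of `R_k^nil` is an exterior algebra. -/
noncomputable def extEquivCoh : ExteriorAlgebra F (Fin k → F) ≃ₐ[F] (Rnil F k).Coh :=
  AlgEquiv.ofBijective _ (cls_extToCocycles_bijective k hF)

theorem extEquivCoh_apply (x : ExteriorAlgebra F (Fin k → F)) :
    extEquivCoh k hF x = (Rnil F k).cls (extToCocycles k hF x) := rfl

/-- The section of the projection from cocycles to cohomology, as a morphism of dgas. -/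
noncomputable def cohToRnil : QDGA.Hom (Rnil F k).H (Rnil F k) where
  toAlgHom := show (Rnil F k).Coh →ₐ[F] RAlg F k from
    (extToR k hF).comp ((extEquivCoh k hF).symm : (Rnil F k).Coh →ₐ[F] _)
  map_mem := by
    rintro i _ ⟨z, hz, rfl⟩
    obtain ⟨c, hc⟩ := exists_eq_sum_mono_extGen F k ((extEquivCoh k hF).symm ((Rnil F k).cls z))
    have h := congrArg (extEquivCoh k hF) hc
    rw [AlgEquiv.apply_symm_apply, extEquivCoh_apply, eq_comm, ← sub_eq_zero, ← map_sub] at h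
    obtain ⟨y, hy⟩ := ((Rnil F k).cls_eq_zero_iff _).1 h
    show extToR k hF ((extEquivCoh k hF).symm ((Rnil F k).cls z)) ∈ RNil.gr F k i
    rw [hc, extToR_sum_mono]
    -- The chosen representative is homogeneous because it is cohomologous to the homogeneous
    -- cocycle `z`.
    refine sum_mono_eta_mem i c z.1 y hz ?_
    rw [← extToR_sum_mono k hF]
    exact (sub_eq_iff_eq_add'.1 hy.symm)
  map_d a := by
    refine (map_zero _).trans ?_
    exact (Subtype.prop (extToCocycles k hF ((extEquivCoh k hF).symm a))).symm

/-- With zero differential the cohomology of `H` is `H` itself, and the induced map is the identity,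
since the section picks a representative of each class. -/
theorem cohToRnil_isQuasiIso : (cohToRnil k hF).IsQuasiIso := by
  have key : ∀ z, (cohToRnil k hF).mapH ((Rnil F k).H.cls z) = z.1 := by
    intro z
    refine Eq.trans ?_ ((extEquivCoh k hF).apply_symm_apply z.1)
    rfl
  constructor
  · intro x x' h
    obtain ⟨z, rfl⟩ := Ideal.Quotient.mk_surjective x
    obtain ⟨z', rfl⟩ := Ideal.Quotient.mk_surjective x'
    have : z = z' := Subtype.ext (((key z).symm.trans h).trans (key z'))
    rw [this]
  · intro x
    exact ⟨(Rnil F k).H.cls ⟨x, rfl⟩, key ⟨x, rfl⟩⟩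

theorem isFormal_Rnil (hF : ringChar F ≠ 2) : (Rnil F k).IsFormal :=
  Relation.EqvGen.symm _ _ (Relation.EqvGen.rel _ _ ⟨cohToRnil k hF, cohToRnil_isQuasiIso k hF⟩)

end Exterior

end QDG

open QDG

theorem theorem1p6 {F : Type u} [Field F] (hF : ringChar F ≠ 2) (k : ℕ) :
    (∃ ρ : QDGA.Hom (Rnil F k) (Cpx.LPow F k).End,
      (∀ j : Fin k, ρ.toAlgHom (RNil.xi F j) = Cpx.xiOp F k j) ∧
      (∀ (i : ℕ) (h : i + 1 < k), ρ.toAlgHom (RNil.s F i h) = Cpx.sOp F k i) ∧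
      Function.Injective ρ.toAlgHom ∧
      ρ.IsQuasiIso) ∧
    (Rnil F k).IsFormal ∧
    ∃ φ : ExteriorAlgebra F (Fin k → F) ≃ₐ[F] (Rnil F k).H.carrier,
      ∀ i : Fin k, φ (ExteriorAlgebra.ι F (Pi.single i 1)) ∈
        (Rnil F k).H.gr (1, -2 * ((i : ℤ) + 1)) := by
  refine ⟨⟨rho F k, fun j => (rhoAlg_gen F k (Gen.dot j)).trans (xiOp_eq F k j).symm,
    fun i h => (rhoAlg_gen F k (Gen.cross i h)).trans (sOp_eq F k i h).symm,
    rhoAlg_injective F k, rho_isQuasiIso F k⟩, isFormal_Rnil k hF, extEquivCoh k hF, fun i => ?_⟩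
  refine ⟨etaCocycle F k i, eta_mem F k i, ?_⟩
  exact congrArg (Rnil F k).cls (extToCocycles_ι k hF i).symm
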